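/- Let $k$ be an algebraically closed field with a fixed linear order $\prec$ (no compatibility with the operations of $k$ is assumed). **The matrix problem.** Let $\Gamma\subset k^{t\times t}$ be a basic matrix algebra, i.e. a (unital) algebra of upper triangular matrices that contains the diagonal part of each of its elements. For $i,j\in\{1,\dots,t\}$ put $i\sim j$ if $x_{ii}=x_{jj}$ for all $X\in\Gamma$. Let $\mathcal M\subset k^{t\times t}$ be a vector space with $\Gamma\mathcal M\subset\mathcal M$ and $\mathcal M\Gamma\subset\mathcal M$, and let $\underline n=(n_1,\dots,n_t)$ be a sequence of nonnegative integers with $n_i=n_j$ whenever $i\sim j$. Let $\Lambda=\Gamma_{\underline n\times\underline n}$ and $\mathcal M_{\underline n\times\underline n}$ consist of the block matrices $[A_{ij}]_{i,j=1}^t$, $A_{ij}\in k^{n_i\times n_j}$, whose blocks satisfy the same linear relations as the entries of the matrices from $\Gamma$ and $\mathcal M$, respectively. A block $A_{lr}$ is *dependent* if on $\mathcal M$ the coordinate $x_{lr}$ is a linear combination of preceding coordinates in the order $x_{t1},x_{t2},\dots,x_{tt},x_{t-1,1},\dots,x_{1t}$, and *free* otherwise. A *reduced algebra* $\Lambda$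 for a block partition and an equivalence relation $\sim$ on its strips is an algebra consisting of all upper block-triangular matrices $S$ with $S_{ii}=S_{jj}$ for $i\sim j$ and with $\sum_{I\ni i<j\in J}c_{ij}S_{ij}=0$ for finitely many families $(c_{ij})$ for each pair $(I,J)$ of equivalence classes; $\Gamma_{\underline n\times\underline n}$ is such an algebra. A *Weyr matrix* is $W_{\lambda_1}\oplus\dots\oplus W_{\lambda_r}$ with $\lambda_1\prec\dots\prec\lambda_r$, where $W_{\lambda_i}$ has diagonal blocks $\lambda_iI_{m_{i1}},\dots,\lambda_iI_{m_{ik_i}}$ with $m_{i1}\ge\dots\ge m_{ik_i}>0$, blocks $\begin{bmatrix}I\\0\end{bmatrix}$ immediately to the right of them, and zeros elsewhere. **Belitskii's algorithm.** Given a matrix $M$ and a reduced algebra $\Lambda$, order the blocks by $M_{t1}<M_{t2}<\dots<M_{tt}<M_{t-1,1}<\cdots$ for the current partition. A block is *stable* if it is the same in $S^{-1}MS$ for all nonsingular $S\in\Lambda$. If all blocks are stable, stop. Otherwise let $M_{lr}$ be the first nonstable block, and replace $M$ by $M'=S^{-1}MS$ with nonsingular $S\in\Lambda$ as follows. - Case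 I: the equality $(*)$ $\sum_{j<r}M_{lj}S_{jr}=\sum_{i>l}S_{li}M_{ir}$ fails for some $S\in\Lambda$. Then $M'_{lr}=0$, and $S$ is taken with identity diagonal blocks. - Case II: $(*)$ holds on $\Lambda$ and $l\not\sim r$. Then $M'_{lr}=\begin{bmatrix}0&I\\0&0\end{bmatrix}$. - Case III: $(*)$ holds on $\Lambda$ and $l\sim r$. Then $M'_{lr}$ is a Weyr matrix. Then replace $\Lambda$ by $\Lambda'=\{S\in\Lambda : SM' \text{ and } M'S \text{ coincide on the block } (l,r)\}$, which is a reduced algebra for a finer partition, and repeat. A matrix is *canonical* if the algorithm reduces it to itself. It is then divided into *boxes*: at each stage one adds, as boxes, all nonempty blocks of the current partition not exceeding the first nonstable block (all nonempty blocks at the last stage) that are not contained in earlier boxes. A box is marked $\emptyset$ if it falls into Case I, and is a Weyr box if it falls into Case III (for stable boxes: if its two strips are equivalent). A canonical matrix with its boxes and their types is called *structured*. Boxes are ordered by last row from bottom to top, then by first column from left to right. **Parametric canonical matrices.** Let $M\in\mathcal M_{\underline n\times\underline n}$ be a structured $\Gamma_{\underline n\times\underline n}$-canonical matrix, let $M_{r_1}<\dots<M_{r_s}$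 be those Weyr boxes that lie in free blocks, and let $\lambda_{t_{i-1}+1}\prec\dots\prec\lambda_{t_i}$ be the distinct eigenvalues of $M_{r_i}$ ($t_0=0$, $p=t_s$). Then $\vec\lambda=(\lambda_1,\dots,\lambda_p)$ is called the parameter sequence of $M$. For $\vec a\in k^p$ let $M(\vec a)\in\mathcal M_{\underline n\times\underline n}$ be the matrix obtained by replacing the diagonal entries $\lambda_j$ of the boxes $M_{r_i}$ ($t_{i-1}<j\le t_i$) by $a_j$, leaving all other entries of free blocks unchanged; the dependent blocks are then determined. The *domain of parameters* $\mathcal D\subset k^p$ of the parametric canonical matrix $M(\vec\lambda)$ is the set of all $\vec a$ such that $M(\vec a)$ is a structured canonical matrix of the same form as $M$, that is, with the same boxes of the same types (in particular with the same disposition of the boxes $\emptyset$) and with parameter sequence $\vec a$. **Theorem.** The domain of parameters $\mathcal D$ of every parametric canonical $\underline n\times\underline n$ matrix $M(\vec\lambda)$ is the set of all $\vec\lambda\in k^p$ satisfying a certain finite system of conditions of the following three types: 1. $f(\vec\lambda)=0$, 2. $(d_1(\vec\lambda),\dots,d_m(\vec\lambda))\neq(0,\dots,0)$, 3. $\lambda_i\prec\lambda_{i+1}$,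 where $f,d_1,\dots,d_m\in k[x_1,\dots,x_p]$ and $m$ may depend on the condition. -/

import Mathlib

noncomputable section

open Classical

namespace Belitskii

/-! ### Rectangular parts of a matrix -/

section Parts

variable {P : Type*} [LinearOrder P] {k : Type*} [Zero k]

/-- The entry at place `(a, b)` (counted from `0`) of the part of `A` with rows `R` and columns `C`;
it is `0` if there is no such place. -/
def entryAt (A : Matrix P P k) (R C : Finset P) (a b : ℕ) : k :=
  if h : a < R.card ∧ b < C.card then
    A (R.orderEmbOfFin rfl ⟨a, h.1⟩) (C.orderEmbOfFin rfl ⟨b, h.2⟩)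
  else 0

/-- The part of `A` with rows `R` and columns `C` as a square matrix
(used only for `R.card = C.card`). -/
def squarePart (A : Matrix P P k) (R C : Finset P) : Matrix (Fin R.card) (Fin R.card) k :=
  Matrix.of fun a b => entryAt A R C a b

/-- `(x, y)` is a place on the main diagonal of the part with rows `R` and columns `C`. -/
def IsDiagonalPlace (R C : Finset P) (x y : P) : Prop :=
  ∃ (a : ℕ) (hR : a < R.card) (hC : a < C.card),
    x = R.orderEmbOfFin rfl ⟨a, hR⟩ ∧ y = C.orderEmbOfFin rfl ⟨a, hC⟩

/-- The part of `A` with rows `R` and columns `C` has the form `[0 I; 0 0]`, where `I` is an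
identity matrix of some size `s ≥ 0` and the zero blocks may be empty. -/
def IsCornerPart [One k] (A : Matrix P P k) (R C : Finset P) : Prop :=
  ∃ s : ℕ, s ≤ R.card ∧ s ≤ C.card ∧ ∀ a b : ℕ, a < R.card → b < C.card →
    entryAt A R C a b = if a < s ∧ b + s = a + C.card then 1 else 0

end Parts

/-! ### Weyr matrices -/

/-- The data of a Weyr matrix `W = W_{λ_1} ⊕ ⋯ ⊕ W_{λ_r}`: the eigenvalues `λ_1 < ⋯ < λ_r`
and, for each `i`, the sizes `m_{i1} ≥ ⋯ ≥ m_{i k_i} > 0` of the diagonal blocks of `W_{λ_i}`. -/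
structure WeyrData (k : Type*) [LinearOrder k] where
  r : ℕ
  eigenvalue : Fin r → k
  eigenvalue_strictMono : StrictMono eigenvalue
  len : Fin r → ℕ
  len_pos : ∀ i, 0 < len i
  size : ∀ i, Fin (len i) → ℕ
  size_antitone : ∀ i, Antitone (size i)
  size_pos : ∀ i j, 0 < size i j

/-- The rows (and columns) of the Weyr matrix: `(i, j, a)` is the `a`-th row of the `j`-th strip of
`W_{λ_i}`; these are ordered lexicographically. -/
abbrev WeyrData.Index {k : Type*} [LinearOrder k] (D : WeyrData k) : Type :=
  Σₗ i : Fin D.r, Σₗ j : Fin (D.len i), Fin (D.size i j)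

/-- The entries of the Weyr matrix: the diagonal blocks of `W_{λ_i}` are `λ_i I`, the blocks next
to the right of them are `[I; 0]`, all other blocks are zero. -/
def WeyrData.entry {k : Type*} [LinearOrder k] [Zero k] [One k] (D : WeyrData k)
    (x y : D.Index) : k :=
  if (ofLex x).1 = (ofLex y).1 ∧
      ((ofLex (ofLex x).2).2 : ℕ) = ((ofLex (ofLex y).2).2 : ℕ) then
    if ((ofLex (ofLex x).2).1 : ℕ) = ((ofLex (ofLex y).2).1 : ℕ) then D.eigenvalue (ofLex x).1
    else if ((ofLex (ofLex x).2).1 : ℕ) + 1 = ((ofLex (ofLex y).2).1 : ℕ) then 1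
    else 0
  else 0

/-- `W` is a Weyr matrix (with respect to the given linear order of the field). -/
def IsWeyr {k : Type*} [LinearOrder k] [Zero k] [One k] {m : ℕ}
    (W : Matrix (Fin m) (Fin m) k) : Prop :=
  ∃ (D : WeyrData k) (e : Fin m ≃o D.Index), ∀ x y, W x y = D.entry (e x) (e y)

/-! ### Reduced matrix algebras -/

/-- A partition of the rows (and of the columns) indexed by `P` into `t` consecutive strips, some
of which may be empty, with an equivalence relation on the set of strips. -/
structure BlockStructure (P : Type*) [LinearOrder P] where
  t : ℕ
  strip : P → Fin t
  strip_mono : Monotone strip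
  equiv : Setoid (Fin t)

section Algorithm

variable {P : Type*} [LinearOrder P] [Fintype P] {k : Type*} [Field k]

/-- The set of rows of the `i`-th strip. -/
def BlockStructure.rows (B : BlockStructure P) (i : Fin B.t) : Finset P :=
  Finset.univ.filter fun x => B.strip x = i

/-- The entry at place `(a, b)` of the block `A_{ij}`; zero outside the block. -/
def BlockStructure.block (B : BlockStructure P) (A : Matrix P P k) (i j : Fin B.t) (a b : ℕ) : k :=
  entryAt A (B.rows i) (B.rows j) a b

/-- `Λ` is a reduced `n × n` algebra, where `B` consists of the partition `n × n` and of the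
equivalence relation on the set of strips: `Λ` is an algebra of matrices, and it
consists of all upper block-triangular matrices `S` such that `S_{ii} = S_{jj}` whenever `i ∼ j`,
and whose blocks over the diagonal satisfy a finite system of equations
`∑_{I ∋ i < j ∈ J} c_{ij} S_{ij} = 0` for each pair `(I, J)` of equivalence classes. -/
def IsReducedAlgebra (Λ : Submodule k (Matrix P P k)) (B : BlockStructure P) : Prop :=
  (1 ∈ Λ ∧ ∀ S ∈ Λ, ∀ T ∈ Λ, S * T ∈ Λ) ∧
  ∃ (q : Quotient B.equiv → Quotient B.equiv → ℕ)
    (c : ∀ I J, Fin (q I J) → Fin B.t → Fin B.t → k),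
    ∀ S : Matrix P P k, S ∈ Λ ↔
      (∀ x y, B.strip y < B.strip x → S x y = 0) ∧
      (∀ i j, B.equiv i j → ∀ a b, B.block S i i a b = B.block S j j a b) ∧
      (∀ I J (l : Fin (q I J)) (a b : ℕ),
        ∑ i : Fin B.t, ∑ j : Fin B.t,
          (if (Quotient.mk B.equiv i = I ∧ Quotient.mk B.equiv j = J) ∧ i < j then
            c I J l i j * B.block S i j a b else 0) = 0)

/-! ### The algorithm -/

/-- The linear order in which blocks are processed:
`M_{t1} < M_{t2} < ⋯ < M_{tt} < M_{t-1,1} < M_{t-1,2} < ⋯`. -/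
def BlockLT {t : ℕ} (i j l r : Fin t) : Prop :=
  l < i ∨ (i = l ∧ j < r)

/-- The block `M_{ij}` is stable: it is invariant under `Λ`-similarity transformations with `M`. -/
def IsStable (Λ : Submodule k (Matrix P P k)) (B : BlockStructure P) (M : Matrix P P k)
    (i j : Fin B.t) : Prop :=
  ∀ S ∈ Λ, IsUnit S → ∀ x ∈ B.rows i, ∀ y ∈ B.rows j, (S⁻¹ * M * S) x y = M x y

/-- `M_{lr}` is the first nonstable block of `M`. -/
def IsFirstNonstable (Λ : Submodule k (Matrix P P k)) (B : BlockStructure P) (M : Matrix P P k)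
    (l r : Fin B.t) : Prop :=
  ¬ IsStable Λ B M l r ∧ ∀ i j, BlockLT i j l r → IsStable Λ B M i j

/-- Case I: the equations of `Λ` do not imply
`M_{l1} S_{1r} + ⋯ + M_{l,r-1} S_{r-1,r} = S_{l,l+1} M_{l+1,r} + ⋯ + S_{lt} M_{tr}`,
i.e. there is a nonzero admissible addition to `M_{lr}` from other blocks. -/
def HasAddition (Λ : Submodule k (Matrix P P k)) (B : BlockStructure P) (M : Matrix P P k)
    (l r : Fin B.t) : Prop :=
  ∃ S ∈ Λ, ∃ x ∈ B.rows l, ∃ y ∈ B.rows r,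
    ∑ z ∈ Finset.univ.filter (fun z => B.strip z < r), M x z * S z y ≠
      ∑ z ∈ Finset.univ.filter (fun z => l < B.strip z), S x z * M z y

/-- The three types of reduced boxes: `empty` is the marked zero box `∅` (Case I), `corner` is
`[0 I; 0 0]` (Case II), and `weyr` is a Weyr matrix (Case III). -/
inductive BoxKind
  | empty
  | corner
  | weyr

/-- A rectangular part, given by its sets of rows and columns, together with its type. -/
structure Box (P : Type*) where
  rows : Finset P
  cols : Finset P
  kind : BoxKind

/-- The case of the algorithm that the block `M_{ij}` falls into. -/
def blockKind (Λ : Submodule k (Matrix P P k)) (B : BlockStructure P) (M : Matrix P P k)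
    (i j : Fin B.t) : BoxKind :=
  if HasAddition Λ B M i j then .empty else if B.equiv i j then .weyr else .corner

/-- The reduced algebra restricts to those transformations that preserve the reduced block with
rows `R` and columns `C`: `Λ' = {S ∈ Λ | S M' ≡ M' S}`, where `≡` is equality on this block. -/
def restrict (Λ : Submodule k (Matrix P P k)) (M' : Matrix P P k) (R C : Finset P) :
    Submodule k (Matrix P P k) where
  carrier := {S | S ∈ Λ ∧ ∀ x ∈ R, ∀ y ∈ C, (S * M') x y = (M' * S) x y}
  add_mem' := by
    rintro S T ⟨hS, hS'⟩ ⟨hT, hT'⟩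
    refine ⟨Λ.add_mem hS hT, fun x hx y hy => ?_⟩
    rw [add_mul, mul_add, Matrix.add_apply, Matrix.add_apply, hS' x hx y hy, hT' x hx y hy]
  zero_mem' := ⟨Λ.zero_mem, fun x _ y _ => by simp⟩
  smul_mem' := by
    rintro c S ⟨hS, hS'⟩
    refine ⟨Λ.smul_mem c hS, fun x hx y hy => ?_⟩
    rw [smul_mul_assoc, mul_smul_comm, Matrix.smul_apply, Matrix.smul_apply, hS' x hx y hy]

variable [LinearOrder k]

/-- One step of the algorithm: `M' = S⁻¹ M S` is obtained from `M` by reducing the block `M_{lr}`.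
In Case I, `M'_{lr} = 0` and `S` has identity diagonal blocks; in Case II,
`M'_{lr} = [0 I; 0 0]`; in Case III, `M'_{lr}` is a Weyr matrix. -/
def IsReduction (Λ : Submodule k (Matrix P P k)) (B : BlockStructure P) (M : Matrix P P k)
    (l r : Fin B.t) (M' : Matrix P P k) : Prop :=
  ∃ S ∈ Λ, IsUnit S ∧ M' = S⁻¹ * M * S ∧
    match blockKind Λ B M l r with
    | .empty =>
        (∀ x y, B.strip x = B.strip y → S x y = (1 : Matrix P P k) x y) ∧
        ∀ x ∈ B.rows l, ∀ y ∈ B.rows r, M' x y = 0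
    | .corner => IsCornerPart M' (B.rows l) (B.rows r)
    | .weyr => IsWeyr (squarePart M' (B.rows l) (B.rows r))

/-- The boxes added at one stage of the algorithm, when `old` is the set of boxes obtained before:
all (nonempty) blocks `M_{ij}` that satisfy the condition `Q` and are
not contained in the boxes obtained before. -/
def newBoxes (Λ : Submodule k (Matrix P P k)) (B : BlockStructure P) (M : Matrix P P k)
    (old : Set (Box P)) (Q : Fin B.t → Fin B.t → Prop) : Set (Box P) :=
  {b | ∃ i j, Q i j ∧ (B.rows i).Nonempty ∧ (B.rows j).Nonempty ∧
    (¬ ∃ o ∈ old, B.rows i ⊆ o.rows ∧ B.rows j ⊆ o.cols) ∧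
    b = ⟨B.rows i, B.rows j, blockKind Λ B M i j⟩}

/-- `Run Λ B M old N boxes`: the algorithm, started with the matrix `M`, the reduced algebra `Λ`
with block structure `B`, and the set `old` of already obtained boxes, ends with the matrix
`N`, partitioned into the set `boxes` of boxes.

If all blocks are stable, then the algorithm stops. Otherwise the first nonstable block `M_{lr}` is
reduced, which gives a matrix `M'` and the algebra `Λ'`, which is a reduced algebra for a
finer partition; the boxes obtained at this stage are the blocks
not exceeding `M_{lr}` and not contained in the previous boxes. -/
inductive Run : Submodule k (Matrix P P k) → BlockStructure P → Matrix P P k → Set (Box P) →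
    Matrix P P k → Set (Box P) → Prop
  | finish (Λ : Submodule k (Matrix P P k)) (B : BlockStructure P) (M : Matrix P P k)
      (old : Set (Box P)) (h : ∀ i j, IsStable Λ B M i j) :
      Run Λ B M old M (old ∪ newBoxes Λ B M old fun _ _ => True)
  | step (Λ : Submodule k (Matrix P P k)) (B : BlockStructure P) (M : Matrix P P k)
      (old : Set (Box P)) (l r : Fin B.t) (M' : Matrix P P k) (B' : BlockStructure P)
      (N : Matrix P P k) (boxes : Set (Box P))
      (h : IsFirstNonstable Λ B M l r) (hM : IsReduction Λ B M l r M')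
      (hB : IsReducedAlgebra (restrict Λ M' (B.rows l) (B.rows r)) B')
      (hrun : Run (restrict Λ M' (B.rows l) (B.rows r)) B' M'
        (old ∪ newBoxes Λ B M old fun i j => BlockLT i j l r ∨ (i = l ∧ j = r)) N boxes) :
      Run Λ B M old N boxes

/-- `M` is a structured `Λ`-canonical matrix with the given set of boxes: the algorithm reduces `M`
to `M` itself (`M^∞ = M`) and divides it into these boxes. -/
def IsStructuredCanonical (Λ : Submodule k (Matrix P P k)) (B : BlockStructure P)
    (M : Matrix P P k) (boxes : Set (Box P)) : Prop :=
  Run Λ B M ∅ M boxes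

end Algorithm

/-- The order of boxes: `b < b'` if the last row of `b` is below the last row of `b'`, or these
rows coincide and the first column of `b` precedes the first column of `b'`. -/
def Box.Before {P : Type*} [LinearOrder P] (b b' : Box P) : Prop :=
  b'.rows.max < b.rows.max ∨ (b.rows.max = b'.rows.max ∧ b.cols.min < b'.cols.min)

/-! ### Linear matrix problems -/

section Problem

variable {k : Type*} [Field k] {t : ℕ}

/-- A basic matrix algebra: an algebra of upper triangular matrices that contains the diagonal part
of each of its elements. -/
def IsBasic (Γ : Subalgebra k (Matrix (Fin t) (Fin t) k)) : Prop :=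
  ∀ X ∈ Γ, (∀ i j, j < i → X i j = 0) ∧ Matrix.diagonal (fun i => X i i) ∈ Γ

/-- The equivalence relation on `{1, …, t}` determined by a basic matrix algebra. -/
def diagEquiv (Γ : Subalgebra k (Matrix (Fin t) (Fin t) k)) : Setoid (Fin t) where
  r i j := ∀ X ∈ Γ, X i i = X j j
  iseqv :=
    { refl := fun _ _ _ => rfl
      symm := fun h X hX => (h X hX).symm
      trans := fun h h' X hX => (h X hX).trans (h' X hX) }

/-- `n` is a step-sequence: `n_i = n_j` whenever `i ∼ j`. -/
def IsStepSequence (Γ : Subalgebra k (Matrix (Fin t) (Fin t) k)) (n : Fin t → ℕ) : Prop :=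
  ∀ i j, diagEquiv Γ i j → n i = n j

/-- The set of rows of `n × n` matrices; `(i, a)` is the `a`-th row of the `i`-th strip. -/
abbrev Place (n : Fin t → ℕ) : Type := Σₗ i : Fin t, Fin (n i)

/-- The `n × n` partition with the equivalence relation determined by `Γ`. -/
def initialStructure (Γ : Subalgebra k (Matrix (Fin t) (Fin t) k)) (n : Fin t → ℕ) :
    BlockStructure (Place n) where
  t := t
  strip x := (ofLex x).1
  strip_mono := by
    intro x y h
    rcases Sigma.Lex.le_def.1 h with h | ⟨h, _⟩
    · exact h.le
    · exact h.le
  equiv := diagEquiv Γ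

/-- The space of all `n × n` matrices whose blocks satisfy the same linear relations as the entries
of the matrices from `V`: for each place `(a, b)`, the `t × t` matrix formed by the entries of
the blocks at this place (with zeros for the blocks without such a place) belongs to `V`. -/
def blowUp (Γ : Subalgebra k (Matrix (Fin t) (Fin t) k))
    (V : Submodule k (Matrix (Fin t) (Fin t) k)) (n : Fin t → ℕ) :
    Submodule k (Matrix (Place n) (Place n) k) where
  carrier := {A | ∀ a b : ℕ,
    (Matrix.of fun i j : Fin t => (initialStructure Γ n).block A i j a b) ∈ V}
  add_mem' := by
    intro A A' hA hA' a b
    convert V.add_mem (hA a b) (hA' a b) using 1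
    ext i j
    simp only [Matrix.of_apply, Matrix.add_apply, BlockStructure.block, entryAt]
    split_ifs <;> simp
  zero_mem' := by
    intro a b
    convert V.zero_mem using 1
    ext i j
    simp [BlockStructure.block, entryAt]
  smul_mem' := by
    intro c A hA a b
    convert V.smul_mem c (hA a b) using 1
    ext i j
    simp only [Matrix.of_apply, Matrix.smul_apply, BlockStructure.block, entryAt]
    split_ifs <;> simp

/-- The reduced algebra `Γ_{n×n}`. -/
def blowUpAlgebra (Γ : Subalgebra k (Matrix (Fin t) (Fin t) k)) (n : Fin t → ℕ) :
    Submodule k (Matrix (Place n) (Place n) k) :=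
  blowUp Γ (Subalgebra.toSubmodule Γ) n

/-- The pair `(l, r)` is dependent if the unknown `x_{lr}` is, on the space `V`, a linear
combination of the preceding unknowns; these are the pivots of the Gauss–Jordan elimination that
starts with the last unknown. -/
def IsDependent (V : Submodule k (Matrix (Fin t) (Fin t) k)) (l r : Fin t) : Prop :=
  ∃ c : Fin t → Fin t → k, (∀ i j, c i j ≠ 0 → BlockLT i j l r) ∧
    ∀ X ∈ V, X l r = ∑ i, ∑ j, c i j * X i j

variable {n : Fin t → ℕ}

/-- The place `(x, y)` lies in a free (i.e. not dependent) block. -/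
def IsFreePlace (V : Submodule k (Matrix (Fin t) (Fin t) k)) (x y : Place n) : Prop :=
  ¬ IsDependent V (ofLex x).1 (ofLex y).1

/-- A free box whose type is Weyr matrix. -/
def IsFreeWeyrBox (V : Submodule k (Matrix (Fin t) (Fin t) k)) (b : Box (Place n)) : Prop :=
  b.kind = .weyr ∧ ∀ x ∈ b.rows, ∀ y ∈ b.cols, IsFreePlace V x y

/-- `lam = (λ_1, …, λ_p)` is the sequence of parameters of the matrix `M` with the given boxes:
it lists, box by box, the distinct eigenvalues of the free Weyr boxes `M_{r_1} < ⋯ < M_{r_s}`,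
in increasing order for each box; `boxOf i` is the box to which the parameter `λ_i` belongs. -/
def IsParameterSequence [LinearOrder k] (V : Submodule k (Matrix (Fin t) (Fin t) k))
    (boxes : Set (Box (Place n))) (M : Matrix (Place n) (Place n) k) {p : ℕ}
    (boxOf : Fin p → Box (Place n)) (lam : Fin p → k) : Prop :=
  (∀ i, boxOf i ∈ boxes ∧ IsFreeWeyrBox V (boxOf i)) ∧
  (∀ i j, i < j → (boxOf i).Before (boxOf j) ∨ (boxOf i = boxOf j ∧ lam i < lam j)) ∧
  ∀ b ∈ boxes, IsFreeWeyrBox V b → ∀ μ : k,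
    Module.End.HasEigenvalue (Matrix.toLin' (squarePart M b.rows b.cols)) μ ↔
      ∃ i, boxOf i = b ∧ lam i = μ

/-- `A = M(a)`: the matrix `A` of the problem is obtained from `M = M(λ)` by replacing, in the free
boxes that are Weyr matrices, the eigenvalues `λ_i` by `a_i`; all other entries of the
free blocks are unchanged (and the dependent blocks are the corresponding linear combinations of
the free ones, since `A` belongs to the space of matrices of the problem). -/
def IsValueAt (Γ : Subalgebra k (Matrix (Fin t) (Fin t) k))
    (V : Submodule k (Matrix (Fin t) (Fin t) k)) (M : Matrix (Place n) (Place n) k) {p : ℕ}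
    (boxOf : Fin p → Box (Place n)) (lam a : Fin p → k) (A : Matrix (Place n) (Place n) k) : Prop :=
  A ∈ blowUp Γ V n ∧
  (∀ i x y, IsDiagonalPlace (boxOf i).rows (boxOf i).cols x y → M x y = lam i → A x y = a i) ∧
  (∀ x y, IsFreePlace V x y → (¬ ∃ i, IsDiagonalPlace (boxOf i).rows (boxOf i).cols x y) →
    A x y = M x y)

/-- The domain of parameters of the parametric canonical matrix `M(x_1, …, x_p)` obtained from the
structured canonical matrix `M` with the given boxes: the set of all `a ∈ k^p` such
that `M(a)` is a structured canonical matrix of the same form, i.e. with the same boxes (in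
particular, with the same disposition of the boxes `∅`) and with the sequence of parameters `a`. -/
def parameterDomain [LinearOrder k] (Γ : Subalgebra k (Matrix (Fin t) (Fin t) k))
    (V : Submodule k (Matrix (Fin t) (Fin t) k)) (M : Matrix (Place n) (Place n) k)
    (boxes : Set (Box (Place n))) {p : ℕ} (boxOf : Fin p → Box (Place n)) (lam : Fin p → k) :
    Set (Fin p → k) :=
  {a | ∃ A, IsValueAt Γ V M boxOf lam a A ∧
    IsStructuredCanonical (blowUpAlgebra Γ n) (initialStructure Γ n) A boxes ∧
    IsParameterSequence V boxes A boxOf a}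

end Problem

end Belitskii

end

/-! The free entries of `M(a)` are constants or parameters and the dependent ones are fixed linear
combinations of them, so the entries of `M(a)` are polynomials in `a`. It remains to express by
polynomials that the algorithm leaves `M(a)` fixed and divides it into the boxes of `M`.

A canonical matrix is not moved by any step, so its run is a decreasing chain of algebras, each cut
out of the previous one by commutation with the matrix on a block (`CRun`, `Run.cRun`). Over an
infinite field every matrix becomes invertible after adding a scalar, hence stability, a condition
on invertible transformations, is the linear condition that commutators vanish (`stable_iff`). Case
I likewise concerns the strictly block-triangular part of the algebra (`IsRed.hasAddition_iff`).

If the parameters increase within each box, the Weyr boxes of `M(a)` have the same centralizers as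
those of `M` (`commute_of_commute`), so block-diagonal transformations see no difference between the
two matrices. If moreover the boxes coincide, the first nonstable block of `M(a)` can be neither
earlier nor later than that of `M`, and both runs pass through the same blocks and partitions
(`stable_of_stable`, `CRun.forced_step`). Conversely, a run on `M(a)` can be built along that on `M`
(`CRun.step_of_sameForm`).

Thus each step asks only two things of `a`: the preceding blocks are stable, and Case I occurs for
`M(a)` exactly when it does for `M`. The current algebra of `M(a)` is the solution space of a linear
system with coefficients polynomial in `a`, and its dimension is one known number for all `a`
meeting the earlier conditions (`IsRed.finrank_inf_of_hasAdd`, `IsRed.finrank_inf_of_not_hasAdd`).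
Both requirements therefore compare ranks with known numbers: either all minors of some order vanish
(type 1), or not all of them do (type 2, coming from the boxes `∅`). Conditions of type 3 compare
neighbouring parameters of one box. -/

noncomputable section

open Classical

namespace Belitskii

/-! ### Sets given by polynomial equations and by nonvanishing of tuples of polynomials -/

section Definable

/-- A linearly independent choice of `r` rows of a matrix of rank at least `r`. -/
theorem exists_linearIndependent_rows {K ι κ : Type*} [Field K] [Fintype ι] [Fintype κ]
    (A : Matrix ι κ K) {r : ℕ} (h : r ≤ A.rank) :
    ∃ f : Fin r → ι, LinearIndependent K (A.submatrix f id).row := by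
  obtain ⟨τ, a, ha, hspan, hli⟩ := exists_linearIndependent' K A.row
  have : Fintype τ := Fintype.ofInjective a ha
  have hc : r ≤ Fintype.card τ := by
    rw [Matrix.rank_eq_finrank_span_row, ← hspan, finrank_span_eq_card hli] at h
    exact h
  obtain ⟨g⟩ : Nonempty (Fin r ↪ τ) := by
    rw [Function.Embedding.nonempty_iff_card_le]
    simpa using hc
  exact ⟨a ∘ g, hli.comp g g.injective⟩

/-- The rank of a matrix is at least `r` if and only if it has a nonzero minor of order `r`. -/
theorem le_rank_iff_exists_minor {K ι κ : Type*} [Field K] [Fintype ι] [Fintype κ]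
    (A : Matrix ι κ K) (r : ℕ) :
    r ≤ A.rank ↔ ∃ (f : Fin r → ι) (g : Fin r → κ), (A.submatrix f g).det ≠ 0 := by
  constructor
  · intro h
    obtain ⟨f, hf⟩ := exists_linearIndependent_rows A h
    have hr : r ≤ (A.submatrix f id).transpose.rank := by
      rw [Matrix.rank_transpose, hf.rank_matrix, Fintype.card_fin]
    obtain ⟨g, hg⟩ := exists_linearIndependent_rows _ hr
    refine ⟨f, g, fun h0 => ?_⟩
    have hu := Matrix.linearIndependent_rows_iff_isUnit.1 hg
    rw [Matrix.isUnit_iff_isUnit_det] at hu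
    apply hu.ne_zero
    rw [← h0, ← Matrix.det_transpose]
    rfl
  · rintro ⟨f, g, hd⟩
    have h1 : (A.submatrix f g).rank = r := by
      rw [Matrix.rank_of_isUnit _ ((Matrix.isUnit_iff_isUnit_det _).2 (isUnit_iff_ne_zero.2 hd)),
        Fintype.card_fin]
    rw [← h1]
    exact Matrix.rank_submatrix_le _ _ _

variable {k : Type*} [Field k] {p : ℕ}

/-- `K` is given by a finite system of polynomial equations and of conditions that some
tuples of polynomials do not vanish. -/
def PolyDefinable (K : Set (Fin p → k)) : Prop :=
  ∃ (F : Finset (MvPolynomial (Fin p) k)) (G : Finset (Finset (MvPolynomial (Fin p) k))),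
    ∀ a, a ∈ K ↔ (∀ f ∈ F, MvPolynomial.eval a f = 0) ∧
      ∀ g ∈ G, ∃ d ∈ g, MvPolynomial.eval a d ≠ 0

theorem PolyDefinable.univ : PolyDefinable (Set.univ : Set (Fin p → k)) :=
  ⟨∅, ∅, fun a => by simp⟩

theorem PolyDefinable.inter {K L : Set (Fin p → k)} (hK : PolyDefinable K)
    (hL : PolyDefinable L) : PolyDefinable (K ∩ L) := by
  obtain ⟨F, G, h⟩ := hK
  obtain ⟨F', G', h'⟩ := hL
  refine ⟨F ∪ F', G ∪ G', fun a => ?_⟩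
  rw [Set.mem_inter_iff, h, h']
  simp only [Finset.mem_union, or_imp, forall_and]
  tauto

theorem polyDefinable_forall_eq_zero {ι : Type*} [Finite ι] (f : ι → MvPolynomial (Fin p) k) :
    PolyDefinable {a : Fin p → k | ∀ i, MvPolynomial.eval a (f i) = 0} := by
  have := Fintype.ofFinite ι
  exact ⟨Finset.univ.image f, ∅, fun a => by simp⟩

theorem polyDefinable_exists_ne_zero {ι : Type*} [Finite ι] (f : ι → MvPolynomial (Fin p) k) :
    PolyDefinable {a : Fin p → k | ∃ i, MvPolynomial.eval a (f i) ≠ 0} := by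
  have := Fintype.ofFinite ι
  exact ⟨∅, {Finset.univ.image f}, fun a => by simp⟩

theorem PolyDefinable.forall {ι : Type*} [Finite ι] {K : ι → Set (Fin p → k)}
    (h : ∀ i, PolyDefinable (K i)) : PolyDefinable {a | ∀ i, a ∈ K i} := by
  have := Fintype.ofFinite ι
  choose F G hFG using h
  refine ⟨Finset.univ.biUnion F, Finset.univ.biUnion G, fun a => ?_⟩
  simp only [Set.mem_ofPred_eq, hFG, Finset.mem_biUnion, Finset.mem_univ, true_and]
  constructor
  · intro h
    exact ⟨fun f ⟨i, hi⟩ => (h i).1 f hi, fun g ⟨i, hi⟩ => (h i).2 g hi⟩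
  · rintro ⟨h1, h2⟩ i
    exact ⟨fun f hf => h1 f ⟨i, hf⟩, fun g hg => h2 g ⟨i, hg⟩⟩

theorem eval_minor {ι κ : Type*} (Q : Matrix ι κ (MvPolynomial (Fin p) k)) {r : ℕ}
    (f : Fin r → ι) (g : Fin r → κ) (a : Fin p → k) :
    MvPolynomial.eval a (Q.submatrix f g).det =
      ((Q.map (MvPolynomial.eval a)).submatrix f g).det := by
  rw [RingHom.map_det]
  rfl

/-- All minors of order `r` form one tuple, which must not vanish: a single condition of type 2. -/
theorem polyDefinable_le_rank {ι κ : Type*} [Fintype ι] [Fintype κ]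
    (Q : Matrix ι κ (MvPolynomial (Fin p) k)) (r : ℕ) :
    PolyDefinable {a : Fin p → k | r ≤ (Q.map (MvPolynomial.eval a)).rank} := by
  convert polyDefinable_exists_ne_zero
    (fun fg : (Fin r → ι) × (Fin r → κ) => (Q.submatrix fg.1 fg.2).det) using 1
  ext a
  simp only [Set.mem_ofPred_eq, le_rank_iff_exists_minor, Prod.exists, eval_minor]

/-- Every minor of order `r` vanishes: conditions of type 1 only. -/
theorem polyDefinable_rank_lt {ι κ : Type*} [Fintype ι] [Fintype κ]
    (Q : Matrix ι κ (MvPolynomial (Fin p) k)) (r : ℕ) :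
    PolyDefinable {a : Fin p → k | (Q.map (MvPolynomial.eval a)).rank < r} := by
  convert polyDefinable_forall_eq_zero
    (fun fg : (Fin r → ι) × (Fin r → κ) => (Q.submatrix fg.1 fg.2).det) using 1
  ext a
  rw [Set.mem_ofPred_eq, ← not_le, le_rank_iff_exists_minor]
  simp only [Set.mem_ofPred_eq, Prod.forall, eval_minor, not_exists, not_not]

variable {P : Type*} [Fintype P]

/-- `E a` is, for every `a`, the space of solutions of a homogeneous linear system whose
coefficients are polynomials in `a`. -/
def IsPolyFamily (E : (Fin p → k) → Submodule k (Matrix P P k)) : Prop :=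
  ∃ (m : ℕ) (q : Fin m → P → P → MvPolynomial (Fin p) k), ∀ a S,
    S ∈ E a ↔ ∀ i, ∑ x, ∑ y, MvPolynomial.eval a (q i x y) * S x y = 0

theorem isPolyFamily_of_fintype {ι : Type*} [Finite ι]
    {E : (Fin p → k) → Submodule k (Matrix P P k)}
    (q : ι → P → P → MvPolynomial (Fin p) k)
    (h : ∀ a S, S ∈ E a ↔ ∀ i, ∑ x, ∑ y, MvPolynomial.eval a (q i x y) * S x y = 0) :
    IsPolyFamily E := by
  have := Fintype.ofFinite ι
  refine ⟨Fintype.card ι, fun i => q ((Fintype.equivFin ι).symm i), fun a S => ?_⟩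
  rw [h, (Fintype.equivFin ι).symm.forall_congr_right.symm]

/-- Rank plus nullity for the coefficient matrix, after matrices are flattened to vectors indexed by
`P × P`. -/
theorem IsPolyFamily.finrank_eq {E : (Fin p → k) → Submodule k (Matrix P P k)}
    (hE : IsPolyFamily E) :
    ∃ (m : ℕ) (Q : Matrix (Fin m) (P × P) (MvPolynomial (Fin p) k)), ∀ a,
      Module.finrank k (E a) + (Q.map (MvPolynomial.eval a)).rank = Fintype.card (P × P) := by
  obtain ⟨m, q, h⟩ := hE
  refine ⟨m, Matrix.of fun i z => q i z.1 z.2, fun a => ?_⟩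
  set Q : Matrix (Fin m) (P × P) k :=
    (Matrix.of fun i z => q i z.1 z.2 : Matrix (Fin m) (P × P) (MvPolynomial (Fin p) k)).map
      (MvPolynomial.eval a)
  let e : Matrix P P k ≃ₗ[k] (P × P → k) :=
    (Matrix.ofLinearEquiv k).symm ≪≫ₗ (LinearEquiv.curry k k P P).symm
  have hE : (E a).map (e : Matrix P P k →ₗ[k] (P × P → k)) = LinearMap.ker Q.mulVecLin := by
    ext v
    rw [Submodule.mem_map_equiv, LinearMap.mem_ker, Matrix.mulVecLin_apply]
    refine (h a _).trans ?_
    rw [funext_iff]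
    refine forall_congr' fun i => ?_
    simp only [Matrix.mulVec, dotProduct, Q, Fintype.sum_prod_type]
    rfl
  have h1 := LinearMap.finrank_range_add_finrank_ker Q.mulVecLin
  rw [← hE, LinearEquiv.finrank_map_eq] at h1
  rw [Matrix.rank, add_comm, h1, Module.finrank_fintype_fun_eq_card]

theorem IsPolyFamily.polyDefinable_le_finrank {E : (Fin p → k) → Submodule k (Matrix P P k)}
    (hE : IsPolyFamily E) (d : ℕ) : PolyDefinable {a | d ≤ Module.finrank k (E a)} := by
  obtain ⟨m, Q, h⟩ := hE.finrank_eq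
  by_cases hd : d ≤ Fintype.card (P × P)
  · convert polyDefinable_rank_lt Q (Fintype.card (P × P) + 1 - d) using 1
    ext a
    have := h a
    simp only [Set.mem_ofPred_eq]
    omega
  -- Here `d` exceeds the dimension of the whole matrix space and the set is empty; the empty tuple
  -- has no nonzero member.
  · convert polyDefinable_exists_ne_zero (fun i : Fin 0 => (0 : MvPolynomial (Fin p) k)) using 1
    ext a
    have := h a
    simp only [Set.mem_ofPred_eq, IsEmpty.exists_iff, iff_false]
    omega

theorem IsPolyFamily.polyDefinable_finrank_lt {E : (Fin p → k) → Submodule k (Matrix P P k)}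
    (hE : IsPolyFamily E) (d : ℕ) : PolyDefinable {a | Module.finrank k (E a) < d} := by
  obtain ⟨m, Q, h⟩ := hE.finrank_eq
  -- If `d` exceeds the number of entries, the truncated difference is `0` and the condition is
  -- void, as it should be; for `d = 0` it asks for a rank greater than the number of columns.
  convert polyDefinable_le_rank Q (Fintype.card (P × P) + 1 - d) using 1
  ext a
  have := h a
  simp only [Set.mem_ofPred_eq]
  omega

theorem IsPolyFamily.inf {E E' : (Fin p → k) → Submodule k (Matrix P P k)}
    (hE : IsPolyFamily E) (hE' : IsPolyFamily E') : IsPolyFamily fun a => E a ⊓ E' a := by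
  obtain ⟨m, q, h⟩ := hE
  obtain ⟨m', q', h'⟩ := hE'
  refine isPolyFamily_of_fintype (ι := Fin m ⊕ Fin m') (Sum.elim q q') fun a S => ?_
  rw [Submodule.mem_inf, h, h']
  simp

/-- Every subspace is the common kernel of finitely many linear forms. -/
theorem exists_equations {X : Type*} [AddCommGroup X] [Module k X] [FiniteDimensional k X]
    (U : Submodule k X) : ∃ (m : ℕ) (φ : Fin m → X →ₗ[k] k), ∀ u, u ∈ U ↔ ∀ i, φ i u = 0 := by
  let b := Module.finBasis k (X ⧸ U)
  refine ⟨_, fun i => (b.coord i).comp U.mkQ, fun u => ?_⟩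
  rw [← Submodule.Quotient.mk_eq_zero, ← b.forall_coord_eq_zero_iff]
  rfl

theorem linearMap_apply_eq_sum {P' : Type*} [Fintype P'] [DecidableEq P] [DecidableEq P'] (φ : Matrix P P' k →ₗ[k] k)
    (S : Matrix P P' k) : φ S = ∑ x, ∑ y, φ (Matrix.single x y 1) * S x y := by
  conv_lhs => rw [Matrix.matrix_eq_sum_single S]
  simp only [map_sum]
  refine Finset.sum_congr rfl fun x _ => Finset.sum_congr rfl fun y _ => ?_
  have : Matrix.single x y (S x y) = S x y • Matrix.single x y (1 : k) := by simp
  rw [this, map_smul, smul_eq_mul, mul_comm]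

theorem isPolyFamily_const (U : Submodule k (Matrix P P k)) :
    IsPolyFamily fun _ : Fin p → k => U := by
  obtain ⟨m, φ, h⟩ := exists_equations U
  refine ⟨m, fun i x y => MvPolynomial.C (φ i (Matrix.single x y 1)), fun a S => ?_⟩
  rw [h]
  simp [linearMap_apply_eq_sum (φ _) S]

/-- The matrices that commute with `A` at the places from `U`. -/
def commutantOn (A : Matrix P P k) (U : P → P → Prop) : Submodule k (Matrix P P k) where
  carrier := {S | ∀ x y, U x y → (S * A - A * S) x y = 0}
  add_mem' := by
    intro S T hS hT x y h
    have h1 := hS x y h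
    have h2 := hT x y h
    have : (S + T) * A - A * (S + T) = (S * A - A * S) + (T * A - A * T) := by
      rw [add_mul, mul_add]; abel
    rw [this, Matrix.add_apply, h1, h2, add_zero]
  zero_mem' := by intro x y _; simp
  smul_mem' := by
    intro c S hS x y h
    have h1 := hS x y h
    have : (c • S) * A - A * (c • S) = c • (S * A - A * S) := by
      rw [smul_mul_assoc, mul_smul_comm, smul_sub]
    rw [this, Matrix.smul_apply, h1, smul_zero]

theorem mem_commutantOn {A : Matrix P P k} {U : P → P → Prop} {S : Matrix P P k} :
    S ∈ commutantOn A U ↔ ∀ x y, U x y → (S * A - A * S) x y = 0 := Iff.rfl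

theorem isPolyFamily_commutantOn (A : P → P → MvPolynomial (Fin p) k) (U : P → P → Prop) :
    IsPolyFamily fun a : Fin p → k =>
      commutantOn (Matrix.of fun x y => MvPolynomial.eval a (A x y)) U := by
  -- The unknown `S x y` enters the entry `z` of `S * A` when `x = z.1`, with coefficient `A y z.2`,
  -- and that of `A * S` when `y = z.2`, with coefficient `A z.1 x`. Places outside `U` give the
  -- void equation.
  refine isPolyFamily_of_fintype (ι := P × P) (fun z x y =>
    if U z.1 z.2 then (if x = z.1 then A y z.2 else 0) - (if y = z.2 then A z.1 x else 0) else 0)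
    fun a S => ?_
  rw [mem_commutantOn, Prod.forall]
  refine forall_congr' fun x => forall_congr' fun y => ?_
  by_cases hU : U x y
  · simp only [hU, forall_const, if_true]
    simp only [map_sub, apply_ite (MvPolynomial.eval a), map_zero, sub_mul, ite_mul, zero_mul,
      Finset.sum_sub_distrib, Matrix.sub_apply, Matrix.mul_apply, Matrix.of_apply]
    rw [Finset.sum_eq_single (f := fun x1 => ∑ y1, if x1 = x then _ else _) x]
    · simp [mul_comm]
    · intro b _ hb; simp [hb]
    · simp
  · simp [hU]

end Definable

/-! ### Positions in strips -/

section Positions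

variable {P : Type*} [LinearOrder P]

/-- The number of elements of `R` that precede `x`. -/
def posIn (R : Finset P) (x : P) : ℕ := (R.filter (· < x)).card

theorem posIn_orderEmbOfFin (R : Finset P) (a : Fin R.card) :
    posIn R (R.orderEmbOfFin rfl a) = a := by
  have h : R.filter (· < R.orderEmbOfFin rfl a) =
      (Finset.Iio a).map (R.orderEmbOfFin rfl).toEmbedding := by
    ext x
    simp only [Finset.mem_filter, Finset.mem_map, Finset.mem_Iio, RelEmbedding.coe_toEmbedding]
    constructor
    · rintro ⟨hx, hlt⟩
      have : x ∈ Set.range (R.orderEmbOfFin rfl) := by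
        rw [Finset.range_orderEmbOfFin]; exact hx
      obtain ⟨b, rfl⟩ := this
      exact ⟨b, by simpa using hlt, rfl⟩
    · rintro ⟨b, hb, rfl⟩
      exact ⟨Finset.orderEmbOfFin_mem _ _ _, by simpa using hb⟩
  rw [posIn, h, Finset.card_map, Fin.card_Iio]

theorem exists_orderEmbOfFin_eq {R : Finset P} {x : P} (hx : x ∈ R) :
    ∃ a : Fin R.card, R.orderEmbOfFin rfl a = x := by
  have : x ∈ Set.range (R.orderEmbOfFin rfl) := by
    rw [Finset.range_orderEmbOfFin]; exact hx
  exact this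

theorem posIn_lt_card {R : Finset P} {x : P} (hx : x ∈ R) : posIn R x < R.card := by
  obtain ⟨a, rfl⟩ := exists_orderEmbOfFin_eq hx
  rw [posIn_orderEmbOfFin]
  exact a.2

theorem orderEmbOfFin_posIn {R : Finset P} {x : P} (hx : x ∈ R) :
    R.orderEmbOfFin rfl ⟨posIn R x, posIn_lt_card hx⟩ = x := by
  obtain ⟨a, rfl⟩ := exists_orderEmbOfFin_eq hx
  congr 1
  exact Fin.ext (posIn_orderEmbOfFin R a)

theorem posIn_injOn {R : Finset P} {x y : P} (hx : x ∈ R) (hy : y ∈ R)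
    (h : posIn R x = posIn R y) : x = y := by
  rw [← orderEmbOfFin_posIn hx, ← orderEmbOfFin_posIn hy]
  congr 1
  exact Fin.ext h

theorem entryAt_posIn {k : Type*} [Zero k] (A : Matrix P P k) {R C : Finset P} {x y : P}
    (hx : x ∈ R) (hy : y ∈ C) : entryAt A R C (posIn R x) (posIn C y) = A x y := by
  rw [entryAt, dif_pos ⟨posIn_lt_card hx, posIn_lt_card hy⟩, orderEmbOfFin_posIn hx,
    orderEmbOfFin_posIn hy]

end Positions

/-! ### Relations on places determined by a partition into strips -/

/-- The relations between places determined by a partition into strips and an equivalence of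
strips: to be in the same strip, to be in a preceding strip, and to occupy the same position
in equivalent strips. -/
@[ext]
structure Strips (P : Type*) where
  same : P → P → Prop
  lt : P → P → Prop
  corr : P → P → Prop

section Reduced

variable {P : Type*} [LinearOrder P] [Fintype P] {k : Type*} [Field k]

theorem BlockStructure.mem_rows (B : BlockStructure P) {x : P} {i : Fin B.t} :
    x ∈ B.rows i ↔ B.strip x = i := by
  simp [BlockStructure.rows]

/-- The position of a place in its strip. -/
def BlockStructure.pos (B : BlockStructure P) (x : P) : ℕ := posIn (B.rows (B.strip x)) x

/-- The relations between places determined by a block structure. -/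
def BlockStructure.strips (B : BlockStructure P) : Strips P where
  same x y := B.strip x = B.strip y
  lt x y := B.strip x < B.strip y
  corr x y := B.equiv (B.strip x) (B.strip y) ∧ B.pos x = B.pos y

theorem BlockStructure.mem_rows_strip (B : BlockStructure P) (x : P) :
    x ∈ B.rows (B.strip x) := B.mem_rows.2 rfl

theorem BlockStructure.pos_lt (B : BlockStructure P) (x : P) :
    B.pos x < (B.rows (B.strip x)).card := posIn_lt_card (B.mem_rows_strip x)

theorem BlockStructure.ext_pos (B : BlockStructure P) {x y : P} (h : B.strip x = B.strip y)
    (h' : B.pos x = B.pos y) : x = y := by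
  refine posIn_injOn (R := B.rows (B.strip x)) (B.mem_rows_strip x) (B.mem_rows.2 h.symm) ?_
  rw [BlockStructure.pos, BlockStructure.pos, ← h] at h'
  exact h'

theorem BlockStructure.exists_pos (B : BlockStructure P) {i : Fin B.t} {a : ℕ}
    (ha : a < (B.rows i).card) : ∃ x, B.strip x = i ∧ B.pos x = a := by
  have h := B.mem_rows.1 (Finset.orderEmbOfFin_mem (B.rows i) rfl ⟨a, ha⟩)
  refine ⟨(B.rows i).orderEmbOfFin rfl ⟨a, ha⟩, h, ?_⟩
  rw [BlockStructure.pos, h, posIn_orderEmbOfFin]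

theorem BlockStructure.block_pos (B : BlockStructure P) (A : Matrix P P k) (x y : P) :
    B.block A (B.strip x) (B.strip y) (B.pos x) (B.pos y) = A x y :=
  entryAt_posIn A (B.mem_rows_strip x) (B.mem_rows_strip y)

theorem BlockStructure.block_eq_zero (B : BlockStructure P) (A : Matrix P P k) {i j : Fin B.t}
    {a b : ℕ} (h : ¬ (a < (B.rows i).card ∧ b < (B.rows j).card)) : B.block A i j a b = 0 := by
  rw [BlockStructure.block, entryAt, dif_neg h]

theorem BlockStructure.block_eq_sum (B : BlockStructure P) (A : Matrix P P k) (i j : Fin B.t)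
    (a b : ℕ) : B.block A i j a b = ∑ z, ∑ w,
      if (B.strip z = i ∧ B.pos z = a) ∧ (B.strip w = j ∧ B.pos w = b) then A z w else 0 := by
  by_cases h : a < (B.rows i).card ∧ b < (B.rows j).card
  · obtain ⟨x, rfl, rfl⟩ := B.exists_pos h.1
    obtain ⟨y, rfl, rfl⟩ := B.exists_pos h.2
    rw [B.block_pos, Finset.sum_eq_single x, Finset.sum_eq_single y]
    · simp
    · intro w _ hw
      rw [if_neg]
      exact fun hh => hw (B.ext_pos hh.2.1 hh.2.2)
    · simp
    · intro z _ hz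
      refine Finset.sum_eq_zero fun w _ => ?_
      rw [if_neg]
      exact fun hh => hz (B.ext_pos hh.1.1 hh.1.2)
    · simp
  · rw [B.block_eq_zero _ h]
    symm
    refine Finset.sum_eq_zero fun z _ => Finset.sum_eq_zero fun w _ => ?_
    rw [if_neg]
    rintro ⟨⟨rfl, rfl⟩, rfl, rfl⟩
    exact h ⟨B.pos_lt z, B.pos_lt w⟩

/-- Block-diagonal matrices whose diagonal blocks at equivalent strips coincide. -/
def Strips.IsDiag (Q : Strips P) (D : Matrix P P k) : Prop :=
  (∀ x y, ¬ Q.same x y → D x y = 0) ∧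
  ∀ x y x' y', Q.same x y → Q.same x' y' → Q.corr x x' → Q.corr y y' → D x y = D x' y'

/-- An algebra of block-triangular matrices with equal diagonal blocks at equivalent strips that
contains all block-diagonal matrices of this form. -/
structure IsRed (Λ : Submodule k (Matrix P P k)) (Q : Strips P) : Prop where
  one : 1 ∈ Λ
  mul : ∀ S ∈ Λ, ∀ T ∈ Λ, S * T ∈ Λ
  upper : ∀ S ∈ Λ, ∀ x y, Q.lt y x → S x y = 0
  diag : ∀ S ∈ Λ, ∀ x y x' y', Q.same x y → Q.same x' y' → Q.corr x x' → Q.corr y y' →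
    S x y = S x' y'
  contains : ∀ D, Q.IsDiag D → D ∈ Λ

/-- Equivalent strips have the same size. -/
def BlockStructure.EqualSizes (B : BlockStructure P) : Prop :=
  ∀ i j, B.equiv i j → (B.rows i).card = (B.rows j).card

variable {Λ : Submodule k (Matrix P P k)} {B : BlockStructure P}

/-- The identity lies in `Λ`. Were one of two equivalent strips longer, the diagonal entry `1` at
its first excess position would have to equal the default value `0` of `block` beyond the shorter
strip. -/
theorem IsReducedAlgebra.equalSizes (h : IsReducedAlgebra Λ B) : B.EqualSizes := by
  obtain ⟨⟨h1, -⟩, q, c, hS⟩ := h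
  have key : ∀ i j, B.equiv i j → (B.rows i).card ≤ (B.rows j).card := by
    intro i j hij
    by_contra! hlt
    have := ((hS 1).1 h1).2.1 i j hij (B.rows j).card (B.rows j).card
    rw [B.block_eq_zero (i := j) 1 (by simp)] at this
    obtain ⟨x, hx, hp⟩ := B.exists_pos hlt
    rw [← hp, ← hx, B.block_pos] at this
    simp at this
  exact fun i j hij => le_antisymm (key i j hij) (key j i (B.equiv.symm hij))

/-- The linear equations involve only blocks strictly above the diagonal, so block-diagonal matrices
satisfy them trivially; this gives the field `contains`. -/
theorem IsReducedAlgebra.isRed (h : IsReducedAlgebra Λ B) : IsRed Λ B.strips := by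
  have hsz := h.equalSizes
  obtain ⟨⟨h1, h2⟩, q, c, hS⟩ := h
  refine ⟨h1, h2, fun S hs => ((hS S).1 hs).1, ?_, ?_⟩
  · intro S hs x y x' y' (hxy : B.strip x = B.strip y) (hxy' : B.strip x' = B.strip y') hx hy
    have := ((hS S).1 hs).2.1 _ _ hx.1 (B.pos x) (B.pos y)
    have e1 := B.block_pos S x y
    have e2 := B.block_pos S x' y'
    rw [← hxy] at e1
    rw [← hxy', ← hx.2, ← hy.2] at e2
    rw [← e1, ← e2, this]
  · rintro D ⟨hD1, hD2⟩
    refine (hS D).2 ⟨?_, ?_, ?_⟩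
    · intro x y hlt
      exact hD1 x y (fun h => by change B.strip x = B.strip y at h; rw [h] at hlt; exact hlt.ne rfl)
    · intro i j hij a b
      by_cases hab : a < (B.rows i).card ∧ b < (B.rows i).card
      · have hab' := hab
        rw [hsz i j hij] at hab'
        obtain ⟨x, hx, hxa⟩ := B.exists_pos hab.1
        obtain ⟨y, hy, hyb⟩ := B.exists_pos hab.2
        obtain ⟨x', hx', hxa'⟩ := B.exists_pos hab'.1
        obtain ⟨y', hy', hyb'⟩ := B.exists_pos hab'.2
        have e1 := B.block_pos D x y
        have e2 := B.block_pos D x' y'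
        rw [hx, hy, hxa, hyb] at e1
        rw [hx', hy', hxa', hyb'] at e2
        rw [e1, e2]
        refine hD2 x y x' y' (hx.trans hy.symm) (hx'.trans hy'.symm) ⟨?_, ?_⟩ ⟨?_, ?_⟩
        · rw [hx, hx']; exact hij
        · rw [hxa, hxa']
        · rw [hy, hy']; exact hij
        · rw [hyb, hyb']
      · rw [B.block_eq_zero _ hab]
        rw [hsz i j hij] at hab
        rw [B.block_eq_zero _ hab]
    · intro I J l a b
      refine Finset.sum_eq_zero fun i _ => Finset.sum_eq_zero fun j _ => ?_
      split_ifs with hc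
      · rw [B.block_eq_sum, Finset.sum_eq_zero, mul_zero]
        intro z _
        refine Finset.sum_eq_zero fun w _ => ?_
        split_ifs with h'
        · refine hD1 z w fun hzw => ?_
          change B.strip z = B.strip w at hzw
          rw [h'.1.1, h'.2.1] at hzw
          exact hc.2.ne hzw
        · rfl
      · rfl

/-- The block-diagonal part of a matrix. -/
def Strips.diagPart (Q : Strips P) (S : Matrix P P k) : Matrix P P k :=
  Matrix.of fun x y => if Q.same x y then S x y else 0

theorem Strips.diagPart_apply (Q : Strips P) (S : Matrix P P k) (x y : P) :
    Q.diagPart S x y = if Q.same x y then S x y else 0 := rfl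

theorem BlockStructure.diagPart_apply (B : BlockStructure P) (S : Matrix P P k) (x y : P) :
    B.strips.diagPart S x y = if B.strip x = B.strip y then S x y else 0 := by
  rw [Strips.diagPart_apply]
  congr

theorem Strips.isDiag_diagPart {Q : Strips P} {S : Matrix P P k}
    (h : ∀ x y x' y', Q.same x y → Q.same x' y' → Q.corr x x' → Q.corr y y' → S x y = S x' y') :
    Q.IsDiag (Q.diagPart S) := by
  refine ⟨fun x y hxy => if_neg hxy, fun x y x' y' h1 h2 h3 h4 => ?_⟩
  rw [Q.diagPart_apply, Q.diagPart_apply, if_pos h1, if_pos h2]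
  exact h x y x' y' h1 h2 h3 h4

theorem IsRed.isDiag_diagPart {Q : Strips P} (h : IsRed Λ Q) {S : Matrix P P k} (hS : S ∈ Λ) :
    Q.IsDiag (Q.diagPart S) := Strips.isDiag_diagPart (h.diag S hS)

theorem IsRed.diagPart_mem {Q : Strips P} (h : IsRed Λ Q) {S : Matrix P P k} (hS : S ∈ Λ) :
    Q.diagPart S ∈ Λ := h.contains _ (h.isDiag_diagPart hS)

/-- The matrix with blocks `u_{ij}` multiplied by the matrix unit with index `(a, b)`. -/
def BlockStructure.slicedMatrix (B : BlockStructure P) (u : Matrix (Fin B.t) (Fin B.t) k)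
    (a b : ℕ) : Matrix P P k :=
  Matrix.of fun x y => if B.pos x = a ∧ B.pos y = b then u (B.strip x) (B.strip y) else 0

/-- The part of `u` over the diagonal at the strips from the classes `I` and `J`. -/
def BlockStructure.classPart (B : BlockStructure P) (I J : Quotient B.equiv)
    (u : Matrix (Fin B.t) (Fin B.t) k) : Matrix (Fin B.t) (Fin B.t) k :=
  Matrix.of fun i j =>
    if (Quotient.mk B.equiv i = I ∧ Quotient.mk B.equiv j = J) ∧ i < j then u i j else 0

/-- The matrix unit with index `(a, b)` repeated in the diagonal blocks from the class `I`. -/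
def BlockStructure.classUnit (B : BlockStructure P) (k : Type*) [Field k] (I : Quotient B.equiv)
    (a b : ℕ) : Matrix P P k :=
  Matrix.of fun x y => if (B.strip x = B.strip y ∧ Quotient.mk B.equiv (B.strip x) = I) ∧
    B.pos x = a ∧ B.pos y = b then 1 else 0

theorem BlockStructure.isDiag_classUnit (B : BlockStructure P) (I : Quotient B.equiv)
    (a b : ℕ) : B.strips.IsDiag (B.classUnit k I a b) := by
  refine ⟨fun x y h => if_neg fun h' => h h'.1.1, ?_⟩
  intro x y x' y' (h : B.strip x = B.strip y) (h' : B.strip x' = B.strip y') hx hy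
  have hI : Quotient.mk B.equiv (B.strip x) = Quotient.mk B.equiv (B.strip x') :=
    Quotient.sound hx.1
  simp only [BlockStructure.classUnit, Matrix.of_apply, hx.2, hy.2, h, h', true_and] at hI ⊢
  rw [hI]

/-- Multiplication by repeated matrix units on both sides cuts out the `(a, b)` entries of the
blocks from the classes `I`, `J` and moves them to the place `(a', b')`. The last summand, from
below the diagonal, vanishes for `S` in a reduced algebra. -/
theorem BlockStructure.classUnit_mul_mul (B : BlockStructure P) (S : Matrix P P k)
    (I J : Quotient B.equiv) (a b a' b' : ℕ) :
    B.classUnit k I a' a * (S - B.strips.diagPart S) * B.classUnit k J b b' =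
      B.slicedMatrix (B.classPart I J (Matrix.of fun i j =>
        if i < j then B.block S i j a b else 0)) a' b' +
      B.classUnit k I a' a * Matrix.of (fun x y => if B.strip y < B.strip x then S x y else 0) *
        B.classUnit k J b b' := by
  have : S - B.strips.diagPart S = Matrix.of (fun x y => if B.strip x < B.strip y then S x y else 0)
      + Matrix.of (fun x y => if B.strip y < B.strip x then S x y else 0) := by
    ext x y
    simp only [Matrix.sub_apply, Matrix.add_apply, Matrix.of_apply, B.diagPart_apply]
    rcases lt_trichotomy (B.strip x) (B.strip y) with h | h | h
    · simp [h, h.ne, h.not_gt]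
    · simp [h]
    · simp [h, h.ne', h.not_gt]
  rw [this, mul_add, add_mul]
  congr 1
  ext x y
  simp only [Matrix.mul_apply, BlockStructure.slicedMatrix, BlockStructure.classPart,
    Matrix.of_apply, B.block_eq_sum, BlockStructure.classUnit, Finset.sum_mul]
  rw [Finset.sum_comm]
  by_cases h1 : B.pos x = a' ∧ B.pos y = b'
  · by_cases h2 : (Quotient.mk B.equiv (B.strip x) = I ∧ Quotient.mk B.equiv (B.strip y) = J) ∧
      B.strip x < B.strip y
    · rw [if_pos h1, if_pos h2, if_pos h2.2]
      refine Finset.sum_congr rfl fun z _ => Finset.sum_congr rfl fun w _ => ?_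
      by_cases hz : B.strip z = B.strip x ∧ B.pos z = a
      · by_cases hw : B.strip w = B.strip y ∧ B.pos w = b
        · simp [hz, hw, h1, h2]
        · rw [if_neg (c := (_ ∧ _) ∧ (_ ∧ B.pos w = b)) (fun h => hw h.2),
            if_neg (c := _ ∧ (B.pos w = b ∧ _)) (fun h => hw ⟨h.1.1, h.2.1⟩), mul_zero]
      · rw [if_neg (c := (_ ∧ _) ∧ (_ ∧ B.pos w = b)) (fun h => hz h.1),
          if_neg (c := _ ∧ (_ ∧ B.pos z = a)) (fun h => hz ⟨h.1.1.symm, h.2.2⟩), zero_mul, zero_mul]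
    · rw [if_pos h1, if_neg h2]
      refine Finset.sum_eq_zero fun z _ => Finset.sum_eq_zero fun w _ => ?_
      by_contra hne
      simp only [mul_eq_zero, not_or, ite_eq_right_iff, Classical.not_imp] at hne
      obtain ⟨⟨⟨hx, -⟩, hzw, -⟩, hy, -⟩ := hne
      refine h2 ⟨⟨hx.1.2, ?_⟩, ?_⟩
      · rw [← hy.1.1]; exact hy.1.2
      · rw [hx.1.1, ← hy.1.1]; exact hzw
  · rw [if_neg h1]
    refine Finset.sum_eq_zero fun z _ => Finset.sum_eq_zero fun w _ => ?_
    by_contra hne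
    simp only [mul_eq_zero, not_or, ite_eq_right_iff, Classical.not_imp] at hne
    obtain ⟨⟨⟨hx, -⟩, hzw, -⟩, hy, -⟩ := hne
    exact h1 ⟨hx.2.1, hy.2.2⟩

/-- The subspace of the coefficients of the slices of `Λ` at the classes `I` and `J`. -/
def BlockStructure.coefficients (B : BlockStructure P) (Λ : Submodule k (Matrix P P k))
    (I J : Quotient B.equiv) : Submodule k (Matrix (Fin B.t) (Fin B.t) k) where
  carrier := {u | ∀ a b, B.slicedMatrix (B.classPart I J u) a b ∈ Λ}
  add_mem' := by
    intro u v hu hv a b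
    convert Λ.add_mem (hu a b) (hv a b) using 1
    ext x y
    simp only [BlockStructure.slicedMatrix, BlockStructure.classPart, Matrix.of_apply,
      Matrix.add_apply]
    split_ifs <;> simp
  zero_mem' := by
    intro a b
    convert Λ.zero_mem using 1
    ext x y
    simp [BlockStructure.slicedMatrix, BlockStructure.classPart]
  smul_mem' := by
    intro c u hu a b
    convert Λ.smul_mem c (hu a b) using 1
    ext x y
    simp only [BlockStructure.slicedMatrix, BlockStructure.classPart, Matrix.of_apply,
      Matrix.smul_apply]
    split_ifs <;> simp

theorem BlockStructure.classPart_classPart (B : BlockStructure P) (I J : Quotient B.equiv)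
    (u : Matrix (Fin B.t) (Fin B.t) k) :
    B.classPart I J (B.classPart I J u) = B.classPart I J u := by
  ext i j
  simp only [BlockStructure.classPart, Matrix.of_apply]
  split_ifs <;> rfl

theorem BlockStructure.sum_slicedMatrix (B : BlockStructure P) (S : Matrix P P k) :
    ∑ I, ∑ J, ∑ a ∈ Finset.range (Fintype.card P), ∑ b ∈ Finset.range (Fintype.card P),
      B.slicedMatrix (B.classPart I J (Matrix.of fun i j => B.block S i j a b)) a b =
    Matrix.of fun x y => if B.strip x < B.strip y then S x y else 0 := by
  have hlt : ∀ x, B.pos x < Fintype.card P := fun x =>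
    (B.pos_lt x).trans_le (Finset.card_le_univ _)
  ext x y
  simp only [Matrix.sum_apply, BlockStructure.slicedMatrix, BlockStructure.classPart,
    Matrix.of_apply]
  rw [Finset.sum_eq_single (Quotient.mk B.equiv (B.strip x)),
    Finset.sum_eq_single (Quotient.mk B.equiv (B.strip y)),
    Finset.sum_eq_single (B.pos x), Finset.sum_eq_single (B.pos y)]
  · simp [B.block_pos]
  · intro b _ hb
    rw [if_neg fun h => hb h.2.symm]
  · intro h; exact absurd (Finset.mem_range.2 (hlt y)) h
  · intro a _ ha
    refine Finset.sum_eq_zero fun b _ => ?_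
    rw [if_neg fun h => ha h.1.symm]
  · intro h; exact absurd (Finset.mem_range.2 (hlt x)) h
  · intro J _ hJ
    refine Finset.sum_eq_zero fun a _ => Finset.sum_eq_zero fun b _ => ?_
    rw [if_neg (c := _ ∧ _ < _) fun h => hJ h.1.2.symm, ite_self]
  · simp
  · intro I _ hI
    refine Finset.sum_eq_zero fun J _ => Finset.sum_eq_zero fun a _ =>
      Finset.sum_eq_zero fun b _ => ?_
    rw [if_neg (c := _ ∧ _ < _) fun h => hI h.1.1.symm, ite_self]
  · simp

/-- The equations for the classes `I`, `J` are those of the subspace `coefficients`. Multiplying by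
`classUnit` on both sides keeps a matrix in `Λ` and isolates its slices, so all slices satisfy these
equations, the same at every position. Conversely, a matrix is its diagonal part plus its slices
(`sum_slicedMatrix`), each of which lies in `Λ`. -/
theorem IsRed.isReducedAlgebra (h : IsRed Λ B.strips) (hsz : B.EqualSizes) :
    IsReducedAlgebra Λ B := by
  refine ⟨⟨h.one, h.mul⟩, ?_⟩
  choose q φ hφ using fun I J => exists_equations (B.coefficients Λ I J)
  refine ⟨q, fun I J l i j => φ I J l (Matrix.single i j 1), fun S => ?_⟩
  have hsum : ∀ I J (l : Fin (q I J)) (a b : ℕ), ∑ i : Fin B.t, ∑ j : Fin B.t,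
      (if (Quotient.mk B.equiv i = I ∧ Quotient.mk B.equiv j = J) ∧ i < j then
        φ I J l (Matrix.single i j 1) * B.block S i j a b else 0) =
      φ I J l (B.classPart I J (Matrix.of fun i j => B.block S i j a b)) := by
    intro I J l a b
    rw [linearMap_apply_eq_sum]
    simp only [BlockStructure.classPart, Matrix.of_apply, mul_ite, mul_zero]
  simp only [hsum]
  constructor
  · intro hS
    refine ⟨h.upper S hS, ?_, ?_⟩
    · intro i j hij a b
      by_cases hab : a < (B.rows i).card ∧ b < (B.rows i).card
      · have hab' := hab
        rw [hsz i j hij] at hab'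
        obtain ⟨x, hx, hxa⟩ := B.exists_pos hab.1
        obtain ⟨y, hy, hyb⟩ := B.exists_pos hab.2
        obtain ⟨x', hx', hxa'⟩ := B.exists_pos hab'.1
        obtain ⟨y', hy', hyb'⟩ := B.exists_pos hab'.2
        have e1 := B.block_pos S x y
        have e2 := B.block_pos S x' y'
        rw [hx, hy, hxa, hyb] at e1
        rw [hx', hy', hxa', hyb'] at e2
        rw [e1, e2]
        refine h.diag S hS x y x' y' (hx.trans hy.symm) (hx'.trans hy'.symm) ⟨?_, ?_⟩ ⟨?_, ?_⟩
        · rw [hx, hx']; exact hij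
        · rw [hxa, hxa']
        · rw [hy, hy']; exact hij
        · rw [hyb, hyb']
      · rw [B.block_eq_zero _ hab]
        rw [hsz i j hij] at hab
        rw [B.block_eq_zero _ hab]
    · intro I J l a b
      refine (hφ I J _).1 ?_ l
      intro a' b'
      rw [B.classPart_classPart]
      have h1 : S - B.strips.diagPart S ∈ Λ := Λ.sub_mem hS (h.diagPart_mem hS)
      have h2 := h.mul _ (h.mul _ (h.contains _ (B.isDiag_classUnit I a' a)) _ h1) _
        (h.contains _ (B.isDiag_classUnit J b b'))
      rw [B.classUnit_mul_mul] at h2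
      have h3 : (Matrix.of fun x y => if B.strip y < B.strip x then S x y else 0 : Matrix P P k)
          = 0 := by
        ext x y
        simp only [Matrix.of_apply, Matrix.zero_apply, ite_eq_right_iff]
        exact h.upper S hS x y
      rw [h3, mul_zero, zero_mul, add_zero] at h2
      convert h2 using 2
      ext i j
      simp only [BlockStructure.classPart, Matrix.of_apply]
      split_ifs with hh hh'
      · rfl
      · exact absurd hh.2 hh'
      · rfl
  · rintro ⟨h1, h2, h3⟩
    have hdec : S = B.strips.diagPart S +
        Matrix.of fun x y => if B.strip x < B.strip y then S x y else 0 := by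
      ext x y
      simp only [Matrix.add_apply, Matrix.of_apply, B.diagPart_apply]
      rcases lt_trichotomy (B.strip x) (B.strip y) with hh | hh | hh
      · simp [hh, hh.ne]
      · simp [hh]
      · simp [hh.ne', hh.not_gt, h1 x y hh]
    rw [hdec]
    refine Λ.add_mem (h.contains _ (Strips.isDiag_diagPart ?_)) ?_
    · intro x y x' y' (hxy : B.strip x = B.strip y) (hxy' : B.strip x' = B.strip y') hx hy
      have := h2 _ _ hx.1 (B.pos x) (B.pos y)
      have e1 := B.block_pos S x y
      have e2 := B.block_pos S x' y'
      rw [← hxy] at e1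
      rw [← hxy', ← hx.2, ← hy.2] at e2
      rw [← e1, ← e2, this]
    · rw [← B.sum_slicedMatrix]
      refine Λ.sum_mem fun I _ => Λ.sum_mem fun J _ => Λ.sum_mem fun a _ => Λ.sum_mem fun b _ => ?_
      have := (hφ I J _).2 (fun l => h3 I J l a b) a b
      rwa [B.classPart_classPart] at this

end Reduced

/-! ### Strips and inverses in a reduced algebra -/

section Strips

variable {P : Type*} [LinearOrder P] [Fintype P] {k : Type*} [Field k]

theorem BlockStructure.lt_iff (B : BlockStructure P) {x y : P} :
    B.strips.lt x y ↔ x < y ∧ ¬ B.strips.same x y := by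
  change B.strip x < B.strip y ↔ x < y ∧ ¬ B.strip x = B.strip y
  constructor
  · intro h
    refine ⟨?_, h.ne⟩
    by_contra! hle
    exact absurd (B.strip_mono hle) (not_le.2 h)
  · rintro ⟨h, h'⟩
    exact lt_of_le_of_ne (B.strip_mono h.le) h'

theorem BlockStructure.corr_refl (B : BlockStructure P) (x : P) : B.strips.corr x x :=
  ⟨B.equiv.refl _, rfl⟩

theorem BlockStructure.corr_symm {B : BlockStructure P} {x y : P} (h : B.strips.corr x y) :
    B.strips.corr y x :=
  ⟨B.equiv.symm h.1, h.2.symm⟩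

theorem BlockStructure.corr_trans {B : BlockStructure P} {x y z : P} (h : B.strips.corr x y)
    (h' : B.strips.corr y z) : B.strips.corr x z :=
  ⟨B.equiv.trans h.1 h'.1, h.2.trans h'.2⟩

/-- The matrix unit with index `(x, y)` repeated in the equivalent diagonal blocks. -/
def Strips.unit (Q : Strips P) (k : Type*) [Field k] (x y : P) : Matrix P P k :=
  Matrix.of fun u v => if Q.same u v ∧ Q.corr x u ∧ Q.corr y v then 1 else 0

theorem BlockStructure.isDiag_unit (B : BlockStructure P) (x y : P) :
    B.strips.IsDiag (B.strips.unit k x y) := by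
  refine ⟨fun u v h => if_neg fun h' => h h'.1, fun u v u' v' h h' hu hv => ?_⟩
  have e1 : B.strips.corr x u ↔ B.strips.corr x u' :=
    ⟨fun h => B.corr_trans h hu, fun h => B.corr_trans h (B.corr_symm hu)⟩
  have e2 : B.strips.corr y v ↔ B.strips.corr y v' :=
    ⟨fun h => B.corr_trans h hv, fun h => B.corr_trans h (B.corr_symm hv)⟩
  simp only [Strips.unit, Matrix.of_apply, h, h', e1, e2]

theorem BlockStructure.unit_self (B : BlockStructure P) {x y : P} (h : B.strips.same x y) :
    B.strips.unit k x y x y = 1 := if_pos ⟨h, B.corr_refl x, B.corr_refl y⟩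

/-- Block-triangular matrices with equal diagonal blocks at equivalent strips. -/
def Strips.IsUpper (Q : Strips P) (S : Matrix P P k) : Prop :=
  (∀ x y, Q.lt y x → S x y = 0) ∧
  ∀ x y x' y', Q.same x y → Q.same x' y' → Q.corr x x' → Q.corr y y' → S x y = S x' y'

theorem IsRed.isUpper {Λ : Submodule k (Matrix P P k)} {Q : Strips P} (h : IsRed Λ Q)
    {S : Matrix P P k} (hS : S ∈ Λ) : Q.IsUpper S := ⟨h.upper S hS, h.diag S hS⟩

/-- The repeated matrix units at `(x, y)` and at `(y, x)` are block-diagonal for `B`, hence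
block-triangular for `B'`, so neither of `x`, `y` can lie in an earlier strip of `B'` than the
other. -/
theorem BlockStructure.same_of_isDiag {B B' : BlockStructure P}
    (h : ∀ D : Matrix P P k, B.strips.IsDiag D → B'.strips.IsUpper D) {x y : P}
    (hxy : B.strips.same x y) : B'.strips.same x y := by
  have key : ∀ {x y : P}, B.strips.same x y → ¬ B'.strips.lt y x := by
    intro x y hxy hlt
    have := (h _ (B.isDiag_unit x y)).1 x y hlt
    rw [B.unit_self hxy] at this
    exact one_ne_zero this
  exact le_antisymm (not_lt.1 (key hxy)) (not_lt.1 (key hxy.symm))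

/-- The repeated diagonal unit at `x` has entry `1` there; equality of diagonal blocks for `B'`
forces entry `1` at `y` as well, so `y` is one of the places where the unit is repeated. -/
theorem BlockStructure.corr_of_isDiag {B B' : BlockStructure P}
    (h : ∀ D : Matrix P P k, B.strips.IsDiag D → B'.strips.IsUpper D) {x y : P}
    (hxy : B'.strips.corr x y) : B.strips.corr x y := by
  have := (h _ (B.isDiag_unit x x)).2 x x y y rfl rfl hxy hxy
  rw [B.unit_self rfl] at this
  by_contra hc
  rw [Strips.unit, Matrix.of_apply, if_neg fun h => hc h.2.1] at this
  exact one_ne_zero this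

theorem BlockStructure.strips_eq_of_isDiag {B B' : BlockStructure P}
    (h : ∀ D : Matrix P P k, B.strips.IsDiag D → B'.strips.IsUpper D)
    (h' : ∀ D : Matrix P P k, B'.strips.IsDiag D → B.strips.IsUpper D) :
    B.strips = B'.strips := by
  have hs : ∀ x y, B.strips.same x y ↔ B'.strips.same x y := fun x y =>
    ⟨B.same_of_isDiag h, B'.same_of_isDiag h'⟩
  ext x y
  · exact hs x y
  · rw [B.lt_iff, B'.lt_iff, hs]
  · exact ⟨B'.corr_of_isDiag h', B.corr_of_isDiag h⟩

variable {Λ Λ' : Submodule k (Matrix P P k)} {B B' : BlockStructure P}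

/-- A reduced algebra does not determine its `BlockStructure`, since empty strips may be inserted,
but it determines the relations between places. This is why runs are recorded with `Strips`. -/
theorem IsRed.strips_eq (h : IsRed Λ B.strips) (h' : IsRed Λ B'.strips) : B.strips = B'.strips :=
  BlockStructure.strips_eq_of_isDiag (fun D hD => h'.isUpper (h.contains D hD))
    (fun D hD => h.isUpper (h'.contains D hD))

theorem IsRed.same_of_le (h : IsRed Λ B.strips) (h' : IsRed Λ' B'.strips) (hle : Λ' ≤ Λ) {x y : P}
    (hxy : B'.strips.same x y) : B.strips.same x y :=
  BlockStructure.same_of_isDiag (fun D hD => h.isUpper (hle (h'.contains D hD))) hxy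

theorem IsRed.lt_of_le (h : IsRed Λ B.strips) (h' : IsRed Λ' B'.strips) (hle : Λ' ≤ Λ) {x y : P}
    (hxy : B.strips.lt x y) : B'.strips.lt x y := by
  rw [BlockStructure.lt_iff] at hxy ⊢
  exact ⟨hxy.1, fun h1 => hxy.2 (h.same_of_le h' hle h1)⟩

/-- Left multiplication by `S` is an injective endomorphism of the finite-dimensional space `Λ`,
hence it reaches `1`. -/
theorem IsRed.inv_mem {Q : Strips P} (h : IsRed Λ Q) {S : Matrix P P k} (hS : S ∈ Λ)
    (hu : IsUnit S) : S⁻¹ ∈ Λ := by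
  let f : Λ →ₗ[k] Λ :=
    { toFun := fun T => ⟨S * T, h.mul S hS T T.2⟩
      map_add' := fun T T' => Subtype.ext (mul_add _ _ _)
      map_smul' := fun c T => Subtype.ext (mul_smul_comm _ _ _) }
  have hf : Function.Injective f := by
    intro T T' hTT
    have : S * (T : Matrix P P k) = S * T' := congrArg Subtype.val hTT
    exact Subtype.ext (hu.mul_left_cancel this)
  obtain ⟨T, hT⟩ := LinearMap.surjective_of_injective hf ⟨1, h.one⟩
  have : S * (T : Matrix P P k) = 1 := congrArg Subtype.val hT
  rw [Matrix.inv_eq_right_inv this]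
  exact T.2

/-- Any `c` that is not one of the finitely many roots of the characteristic polynomial of `-S` will
do. -/
theorem exists_isUnit_add_smul [Infinite k] (S : Matrix P P k) :
    ∃ c : k, IsUnit (S + c • (1 : Matrix P P k)) := by
  obtain ⟨c, hc⟩ := Set.Infinite.nonempty (Set.Finite.infinite_compl
    ((Matrix.charpoly (-S)).rootSet_finite k))
  have hc' : (Matrix.charpoly (-S)).eval c ≠ 0 := by
    intro h0
    apply hc
    rw [Polynomial.mem_rootSet]
    exact ⟨(Matrix.charpoly_monic _).ne_zero, by simpa using h0⟩
  refine ⟨c, ?_⟩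
  rw [Matrix.isUnit_iff_isUnit_det, isUnit_iff_ne_zero]
  rw [Matrix.eval_charpoly] at hc'
  convert hc' using 2
  rw [sub_neg_eq_add, add_comm]
  congr 1
  ext i j
  simp [Matrix.one_apply, Matrix.diagonal_apply]

/-! ### Sets of places closed under going down and to the left -/

/-- With each place the set contains the places of the strips below and to the left of it. -/
structure Strips.IsLower (Q : Strips P) (W : P → P → Prop) : Prop where
  down : ∀ x x' y, W x y → ¬ Q.lt x' x → W x' y
  left : ∀ x y y', W x y → ¬ Q.lt y y' → W x y'

/-- Left multiplication by a block-triangular matrix brings to a place only entries from its own row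
strip and those below it; right multiplication, only from its own column strip and those to the
left. So vanishing on a lower set persists. -/
theorem Strips.IsLower.mul_left {Q : Strips P} {W : P → P → Prop} (hW : Q.IsLower W)
    {S Y : Matrix P P k} (hS : ∀ x y, Q.lt y x → S x y = 0) (hY : ∀ x y, W x y → Y x y = 0)
    (x y : P) (h : W x y) : (S * Y) x y = 0 := by
  rw [Matrix.mul_apply]
  refine Finset.sum_eq_zero fun z _ => ?_
  by_cases hz : Q.lt z x
  · rw [hS _ _ hz, zero_mul]
  · rw [hY _ _ (hW.down _ _ _ h hz), mul_zero]

theorem Strips.IsLower.mul_right {Q : Strips P} {W : P → P → Prop} (hW : Q.IsLower W)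
    {S Y : Matrix P P k} (hS : ∀ x y, Q.lt y x → S x y = 0) (hY : ∀ x y, W x y → Y x y = 0)
    (x y : P) (h : W x y) : (Y * S) x y = 0 := by
  rw [Matrix.mul_apply]
  refine Finset.sum_eq_zero fun z _ => ?_
  by_cases hz : Q.lt y z
  · rw [hS _ _ hz, mul_zero]
  · rw [hY _ _ (hW.left _ _ _ h hz), zero_mul]

/-- `(x, y)` lies in a block that precedes the block of `(x₀, y₀)`. -/
def Strips.before (Q : Strips P) (x₀ y₀ x y : P) : Prop :=
  Q.lt x₀ x ∨ (Q.same x x₀ ∧ Q.lt y y₀)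

/-- `(x, y)` lies in the block of `(x₀, y₀)`. -/
def Strips.block (Q : Strips P) (x₀ y₀ x y : P) : Prop :=
  Q.same x x₀ ∧ Q.same y y₀

/-- `(x, y)` lies in a block that does not exceed the block of `(x₀, y₀)`. -/
def Strips.upTo (Q : Strips P) (x₀ y₀ x y : P) : Prop :=
  Q.before x₀ y₀ x y ∨ Q.block x₀ y₀ x y

theorem BlockStructure.isLower_before (B : BlockStructure P) (x₀ y₀ : P) :
    B.strips.IsLower (B.strips.before x₀ y₀) := by
  constructor
  · intro x x' y h h'
    simp only [Strips.before, BlockStructure.strips] at *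
    grind
  · intro x y y' h h'
    simp only [Strips.before, BlockStructure.strips] at *
    grind

theorem BlockStructure.isLower_upTo (B : BlockStructure P) (x₀ y₀ : P) :
    B.strips.IsLower (B.strips.upTo x₀ y₀) := by
  constructor
  · intro x x' y h h'
    simp only [Strips.upTo, Strips.block, Strips.before, BlockStructure.strips] at *
    grind
  · intro x y y' h h'
    simp only [Strips.upTo, Strips.block, Strips.before, BlockStructure.strips] at *
    grind

theorem BlockStructure.before_of_upTo (B : BlockStructure P) {x₀ y₀ x y u v : P}
    (h : B.strips.upTo x₀ y₀ x y) (h' : B.strips.before x y u v) : B.strips.before x₀ y₀ u v := by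
  simp only [Strips.upTo, Strips.block, Strips.before, BlockStructure.strips] at *
  grind

theorem commutantOn_mono {A : Matrix P P k} {U W : P → P → Prop} (h : ∀ x y, W x y → U x y) :
    commutantOn A U ≤ commutantOn A W := fun _ hS x y hxy => hS x y (h x y hxy)

theorem mem_commutantOn_upTo {A : Matrix P P k} {Q : Strips P} {x₀ y₀ : P} {S : Matrix P P k} :
    S ∈ commutantOn A (Q.upTo x₀ y₀) ↔
      S ∈ commutantOn A (Q.before x₀ y₀) ∧ S ∈ commutantOn A (Q.block x₀ y₀) := by
  simp only [mem_commutantOn, Strips.upTo, or_imp, forall_and]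

/-! ### Stability as a linear condition -/

section Stability

variable {M : Matrix P P k} {W : P → P → Prop}

theorem conj_mul_cancel {S M : Matrix P P k} (hu : IsUnit S) : S * (S⁻¹ * M * S) = M * S := by
  rw [← mul_assoc, ← mul_assoc, Matrix.mul_nonsing_inv _ ((Matrix.isUnit_iff_isUnit_det _).1 hu),
    one_mul]

theorem conj_sub {S M : Matrix P P k} (hu : IsUnit S) :
    S⁻¹ * M * S - M = S⁻¹ * (M * S - S * M) := by
  rw [mul_sub, ← mul_assoc, ← mul_assoc,
    Matrix.nonsing_inv_mul _ ((Matrix.isUnit_iff_isUnit_det _).1 hu), one_mul]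

theorem conj_conj_inv {S M : Matrix P P k} (hu : IsUnit S) :
    S⁻¹⁻¹ * (S⁻¹ * M * S) * S⁻¹ = M := by
  have h := (Matrix.isUnit_iff_isUnit_det _).1 hu
  rw [Matrix.nonsing_inv_nonsing_inv _ h, conj_mul_cancel hu, mul_assoc,
    Matrix.mul_nonsing_inv _ h, mul_one]

/-- Transformations that commute with `M` on a lower set do not change `M` there. -/
theorem conj_apply_of_mem (hΛ : IsRed Λ B.strips) (hW : B.strips.IsLower W) {S : Matrix P P k}
    (hS : S ∈ Λ) (hu : IsUnit S) (h : S ∈ commutantOn M W) (x y : P) (hxy : W x y) :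
    (S⁻¹ * M * S) x y = M x y := by
  rw [← sub_eq_zero, ← Matrix.sub_apply, conj_sub hu]
  refine hW.mul_left (hΛ.upper _ (hΛ.inv_mem hS hu)) (fun x y hxy => ?_) x y hxy
  have := h x y hxy
  rw [← neg_sub, Matrix.neg_apply, neg_eq_zero]
  exact this

/-- The commutator with `M` is unchanged when a scalar is added to `S`, and the shift can be chosen
invertible; for an invertible `T` the commutator is `T * (M - T⁻¹ * M * T)`. Lower sets are needed
in order to remove or insert the factor `T`. -/
theorem stable_iff [Infinite k] (hΛ : IsRed Λ B.strips) (hW : B.strips.IsLower W) :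
    (∀ S ∈ Λ, IsUnit S → ∀ x y, W x y → (S⁻¹ * M * S) x y = M x y) ↔ Λ ≤ commutantOn M W := by
  constructor
  · intro h S hS
    obtain ⟨c, hc⟩ := exists_isUnit_add_smul S
    set T := S + c • (1 : Matrix P P k)
    have hT : T ∈ Λ := Λ.add_mem hS (Λ.smul_mem c hΛ.one)
    have hST : S * M - M * S = T * (M - T⁻¹ * M * T) := by
      rw [mul_sub, conj_mul_cancel hc]
      simp [T, add_mul, mul_add]
    intro x y hxy
    rw [hST]
    refine hW.mul_left (hΛ.upper T hT) (fun x y hxy => ?_) x y hxy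
    rw [Matrix.sub_apply, h T hT hc x y hxy, sub_self]
  · exact fun h S hS hu => conj_apply_of_mem hΛ hW hS hu (h hS)

theorem conj_comm {U M T : Matrix P P k} (hu : IsUnit U) :
    T * (U⁻¹ * M * U) - U⁻¹ * M * U * T =
      U⁻¹ * ((U * T * U⁻¹) * M - M * (U * T * U⁻¹)) * U := by
  have h := (Matrix.isUnit_iff_isUnit_det _).1 hu
  have h1 := Matrix.nonsing_inv_mul _ h
  simp only [mul_sub, sub_mul]
  congr 1
  · simp only [← mul_assoc, h1, one_mul]
  · simp only [mul_assoc, h1, mul_one]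

/-- By `conj_comm`, commutators with the transformed matrix are conjugates of commutators with `M`,
and conjugation by block-triangular matrices preserves vanishing on `W`. The space `R` is separate
from `Λ` so as to allow the strictly triangular part as well. -/
theorem le_commutantOn_conj (hΛ : IsRed Λ B.strips) (hW : B.strips.IsLower W) {U : Matrix P P k}
    (hU : U ∈ Λ) (hu : IsUnit U) {R : Submodule k (Matrix P P k)}
    (hR : ∀ T ∈ R, U * T * U⁻¹ ∈ R) (h : R ≤ commutantOn M W) :
    R ≤ commutantOn (U⁻¹ * M * U) W := by
  intro T hT x y hxy
  rw [conj_comm hu]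
  exact hW.mul_right (hΛ.upper U hU) (hW.mul_left (hΛ.upper _ (hΛ.inv_mem hU hu)) (h (hR T hT)))
    x y hxy

/-- The strictly block-triangular matrices. -/
def Strips.strict (Q : Strips P) (k : Type*) [Field k] : Submodule k (Matrix P P k) where
  carrier := {S | ∀ x y, ¬ Q.lt x y → S x y = 0}
  add_mem' := by
    intro S T hS hT x y h
    rw [Matrix.add_apply, hS x y h, hT x y h, add_zero]
  zero_mem' := fun _ _ _ => rfl
  smul_mem' := by
    intro c S hS x y h
    rw [Matrix.smul_apply, hS x y h, smul_zero]

theorem BlockStructure.strict_mul {S T : Matrix P P k} (hS : ∀ x y, B.strips.lt y x → S x y = 0)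
    (hT : T ∈ B.strips.strict k) : S * T ∈ B.strips.strict k := by
  intro x y hxy
  rw [Matrix.mul_apply]
  refine Finset.sum_eq_zero fun z _ => ?_
  by_cases hz : B.strips.lt z x
  · rw [hS _ _ hz, zero_mul]
  · rw [hT z y fun h => hxy (lt_of_le_of_lt (not_lt.1 hz) h), mul_zero]

theorem BlockStructure.mul_strict {S T : Matrix P P k} (hS : ∀ x y, B.strips.lt y x → S x y = 0)
    (hT : T ∈ B.strips.strict k) : T * S ∈ B.strips.strict k := by
  intro x y hxy
  rw [Matrix.mul_apply]
  refine Finset.sum_eq_zero fun z _ => ?_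
  by_cases hz : B.strips.lt y z
  · rw [hS _ _ hz, mul_zero]
  · rw [hT x z fun h => hxy (lt_of_lt_of_le h (not_lt.1 hz)), zero_mul]

theorem IsRed.conj_strict_mem (hΛ : IsRed Λ B.strips) {U : Matrix P P k} (hU : U ∈ Λ)
    (hu : IsUnit U) : ∀ T ∈ Λ ⊓ B.strips.strict k, U * T * U⁻¹ ∈ Λ ⊓ B.strips.strict k :=
  fun _ hT => ⟨hΛ.mul _ (hΛ.mul _ hU _ hT.1) _ (hΛ.inv_mem hU hu),
    B.mul_strict (hΛ.upper _ (hΛ.inv_mem hU hu)) (B.strict_mul (hΛ.upper U hU) hT.2)⟩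

theorem IsRed.conj_mem (hΛ : IsRed Λ B.strips) {U : Matrix P P k} (hU : U ∈ Λ)
    (hu : IsUnit U) : ∀ T ∈ Λ, U * T * U⁻¹ ∈ Λ :=
  fun _ hT => hΛ.mul _ (hΛ.mul _ hU _ hT) _ (hΛ.inv_mem hU hu)

end Stability

end Strips

/-! ### The run on a canonical matrix, where no transformation is applied -/

section CanonicalRun

variable {P : Type*} [LinearOrder P] [Fintype P] {k : Type*} [Field k]

/-- The places of the strip of `x`. -/
def Strips.rows (Q : Strips P) (x : P) : Finset P := Finset.univ.filter fun z => Q.same z x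

/-- The strips of `x` and `y` are equivalent. -/
def Strips.eqv (Q : Strips P) (x y : P) : Prop := ∃ y', Q.same y' y ∧ Q.corr x y'

/-- The block of `(x₀, y₀)` admits an addition from other blocks. -/
def Strips.HasAdd (Q : Strips P) (Λ : Submodule k (Matrix P P k)) (A : Matrix P P k)
    (x₀ y₀ : P) : Prop :=
  ¬ Λ ⊓ Q.strict k ≤ commutantOn A (Q.block x₀ y₀)

/-- The type of the box formed by the block of `(x, y)`. -/
def Strips.kind (Q : Strips P) (Λ : Submodule k (Matrix P P k)) (A : Matrix P P k) (x y : P) :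
    BoxKind :=
  if Q.HasAdd Λ A x y then .empty else if Q.eqv x y then .weyr else .corner

/-- The boxes formed by those blocks with property `q` that are not contained in old boxes. -/
def Strips.newBoxes (Q : Strips P) (Λ : Submodule k (Matrix P P k)) (A : Matrix P P k)
    (old : Set (Box P)) (q : P → P → Prop) : Set (Box P) :=
  {b | ∃ x y, q x y ∧ (¬ ∃ o ∈ old, Q.rows x ⊆ o.rows ∧ Q.rows y ⊆ o.cols) ∧
    b = ⟨Q.rows x, Q.rows y, Q.kind Λ A x y⟩}

variable {Λ : Submodule k (Matrix P P k)} {B : BlockStructure P} {M N : Matrix P P k}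

theorem BlockStructure.rows_strips (B : BlockStructure P) (x : P) :
    B.strips.rows x = B.rows (B.strip x) := by
  ext y
  simp only [Strips.rows, BlockStructure.rows, Finset.mem_filter]
  rfl

theorem Strips.mem_rows {Q : Strips P} {x z : P} : z ∈ Q.rows x ↔ Q.same z x := by
  simp [Strips.rows]

theorem BlockStructure.EqualSizes.eqv_iff (h : B.EqualSizes) {x y : P} :
    B.strips.eqv x y ↔ B.equiv (B.strip x) (B.strip y) := by
  constructor
  · rintro ⟨y', hy, hc⟩
    have := hc.1
    change B.strip y' = B.strip y at hy
    rwa [hy] at this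
  · intro he
    obtain ⟨y', hy, hp⟩ := B.exists_pos (i := B.strip y) (a := B.pos x)
      ((h _ _ he) ▸ B.pos_lt x)
    refine ⟨y', hy, ?_, hp.symm⟩
    rw [hy]
    exact he

theorem restrict_eq (Λ : Submodule k (Matrix P P k)) (M : Matrix P P k) (x y : P) :
    restrict Λ M (B.rows (B.strip x)) (B.rows (B.strip y)) =
      Λ ⊓ commutantOn M (B.strips.block x y) := by
  ext S
  change (S ∈ Λ ∧ _) ↔ (S ∈ Λ ∧ _)
  refine and_congr_right fun _ => ?_
  simp only [B.mem_rows]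
  exact ⟨fun h u v huv => sub_eq_zero.2 (h u huv.1 v huv.2),
    fun h u hu v hv => sub_eq_zero.1 (h u v ⟨hu, hv⟩)⟩

theorem IsRed.sub_diagPart_mem (hΛ : IsRed Λ B.strips) {S : Matrix P P k} (hS : S ∈ Λ) :
    S - B.strips.diagPart S ∈ Λ ⊓ B.strips.strict k := by
  refine ⟨Λ.sub_mem hS (hΛ.diagPart_mem hS), fun x y hxy => ?_⟩
  rw [Matrix.sub_apply, B.diagPart_apply]
  split_ifs with h
  · rw [sub_self]
  · rw [hΛ.upper S hS x y (lt_of_le_of_ne (not_lt.1 hxy) (Ne.symm h)), sub_zero]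

/-- The two sums in Case I are entries of the products of `M` with `S - B.strips.diagPart S`, and
these differences exhaust the strictly block-triangular part of `Λ`. -/
theorem IsRed.hasAddition_iff (hΛ : IsRed Λ B.strips) (x₀ y₀ : P) :
    HasAddition Λ B M (B.strip x₀) (B.strip y₀) ↔ B.strips.HasAdd Λ M x₀ y₀ := by
  have key : ∀ S : Matrix P P k, (∀ x y, B.strip y < B.strip x → S x y = 0) →
      ∀ x y, B.strip x = B.strip x₀ → B.strip y = B.strip y₀ →
      (∑ z ∈ Finset.univ.filter (fun z => B.strip z < B.strip y₀), M x z * S z y =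
          (M * (S - B.strips.diagPart S)) x y) ∧
        ∑ z ∈ Finset.univ.filter (fun z => B.strip x₀ < B.strip z), S x z * M z y =
          ((S - B.strips.diagPart S) * M) x y := by
    intro S hS x y hx hy
    rw [Matrix.mul_apply, Matrix.mul_apply, Finset.sum_filter, Finset.sum_filter]
    constructor
    · refine Finset.sum_congr rfl fun z _ => ?_
      rw [Matrix.sub_apply, B.diagPart_apply, ← hy]
      rcases lt_trichotomy (B.strip z) (B.strip y) with h | h | h
      · rw [if_pos h, if_neg h.ne, sub_zero]
      · rw [if_neg h.not_lt, if_pos h, sub_self, mul_zero]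
      · rw [if_neg h.not_gt, if_neg h.ne', sub_zero, hS _ _ h, mul_zero]
    · refine Finset.sum_congr rfl fun z _ => ?_
      rw [Matrix.sub_apply, B.diagPart_apply, ← hx]
      rcases lt_trichotomy (B.strip x) (B.strip z) with h | h | h
      · rw [if_pos h, if_neg h.ne, sub_zero]
      · rw [if_neg h.not_lt, if_pos h, sub_self, zero_mul]
      · rw [if_neg h.not_gt, if_neg h.ne', sub_zero, hS _ _ h, zero_mul]
  constructor
  · rintro ⟨S, hS, x, hx, y, hy, hne⟩ hle
    rw [B.mem_rows] at hx hy
    obtain ⟨h1, h2⟩ := key S (hΛ.upper S hS) x y hx hy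
    rw [h1, h2] at hne
    have := hle (hΛ.sub_diagPart_mem hS) x y ⟨hx, hy⟩
    rw [Matrix.sub_apply, sub_eq_zero] at this
    exact hne this.symm
  · intro h
    obtain ⟨T, hT, hTc⟩ := SetLike.not_le_iff_exists.1 h
    simp only [mem_commutantOn, not_forall] at hTc
    obtain ⟨x, y, ⟨hx, hy⟩, hne⟩ := hTc
    refine ⟨T, hT.1, x, B.mem_rows.2 hx, y, B.mem_rows.2 hy, ?_⟩
    obtain ⟨h1, h2⟩ := key T (hΛ.upper T hT.1) x y hx hy
    have h0 : T - B.strips.diagPart T = T := by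
      ext u v
      rw [Matrix.sub_apply, B.diagPart_apply]
      split_ifs with huv
      · rw [hT.2 u v (fun hlt => (ne_of_lt hlt) huv), sub_zero]
      · rw [sub_zero]
    rw [h1, h2, h0]
    rw [Matrix.sub_apply, sub_eq_zero] at hne
    exact fun h => hne h.symm

theorem IsRed.blockKind_eq (hΛ : IsRed Λ B.strips) (hsz : B.EqualSizes) (x y : P) :
    blockKind Λ B M (B.strip x) (B.strip y) = B.strips.kind Λ M x y := by
  simp only [blockKind, Strips.kind, hΛ.hasAddition_iff, hsz.eqv_iff]

theorem IsRed.newBoxes_eq (hΛ : IsRed Λ B.strips) (hsz : B.EqualSizes) (old : Set (Box P))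
    (q : Fin B.t → Fin B.t → Prop) :
    newBoxes Λ B M old q = B.strips.newBoxes Λ M old fun x y => q (B.strip x) (B.strip y) := by
  ext b
  simp only [newBoxes, Strips.newBoxes, B.rows_strips]
  constructor
  · rintro ⟨i, j, hq, ⟨x, hx⟩, ⟨y, hy⟩, ho, rfl⟩
    rw [B.mem_rows] at hx hy
    subst hx hy
    exact ⟨x, y, hq, ho, by rw [hΛ.blockKind_eq hsz]⟩
  · rintro ⟨x, y, hq, ho, rfl⟩
    exact ⟨_, _, hq, ⟨x, B.mem_rows_strip x⟩, ⟨y, B.mem_rows_strip y⟩, ho,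
      by rw [hΛ.blockKind_eq hsz]⟩

theorem stable_block_iff {i j : Fin B.t} : IsStable Λ B M i j ↔
    ∀ S ∈ Λ, IsUnit S → ∀ x y, B.strip x = i → B.strip y = j → (S⁻¹ * M * S) x y = M x y := by
  simp only [IsStable, B.mem_rows]
  exact ⟨fun h S hS hu x y hx hy => h S hS hu x hx y hy,
    fun h S hS hu x hx y hy => h S hS hu x y hx hy⟩

theorem all_stable_iff [Infinite k] (hΛ : IsRed Λ B.strips) :
    (∀ i j, IsStable Λ B M i j) ↔ Λ ≤ commutantOn M fun _ _ => True := by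
  rw [← stable_iff hΛ ⟨fun _ _ _ _ _ => trivial, fun _ _ _ _ _ => trivial⟩]
  simp only [stable_block_iff]
  exact ⟨fun h S hS hu x y _ => h _ _ S hS hu x y rfl rfl,
    fun h i j S hS hu x y _ _ => h S hS hu x y trivial⟩

theorem before_stable_iff [Infinite k] (hΛ : IsRed Λ B.strips) (x₀ y₀ : P) :
    (∀ i j, BlockLT i j (B.strip x₀) (B.strip y₀) → IsStable Λ B M i j) ↔
      Λ ≤ commutantOn M (B.strips.before x₀ y₀) := by
  rw [← stable_iff hΛ (B.isLower_before x₀ y₀)]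
  simp only [stable_block_iff]
  refine ⟨fun h S hS hu x y hxy => h _ _ hxy S hS hu x y rfl rfl, ?_⟩
  rintro h i j hij S hS hu x y rfl rfl
  exact h S hS hu x y hij

/-- A single block is not a lower set, so `stable_iff` does not apply to it directly. It does apply
to the block together with the preceding ones, which are stable on both sides of the equivalence. -/
theorem firstNonstable_iff [Infinite k] (hΛ : IsRed Λ B.strips) (x₀ y₀ : P) :
    IsFirstNonstable Λ B M (B.strip x₀) (B.strip y₀) ↔
      Λ ≤ commutantOn M (B.strips.before x₀ y₀) ∧ ¬ Λ ≤ commutantOn M (B.strips.block x₀ y₀) := by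
  rw [IsFirstNonstable, before_stable_iff hΛ, and_comm]
  refine and_congr_right fun hb => not_congr ?_
  constructor
  · intro hst S hS
    have hup : Λ ≤ commutantOn M (B.strips.upTo x₀ y₀) := by
      rw [← stable_iff hΛ (B.isLower_upTo x₀ y₀)]
      rintro S hS hu x y (hxy | hxy)
      · exact (stable_iff hΛ (B.isLower_before x₀ y₀)).2 hb S hS hu x y hxy
      · exact stable_block_iff.1 hst S hS hu x y hxy.1 hxy.2
    exact (mem_commutantOn_upTo.1 (hup hS)).2
  · intro h
    have hup : Λ ≤ commutantOn M (B.strips.upTo x₀ y₀) :=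
      fun S hS => mem_commutantOn_upTo.2 ⟨hb hS, h hS⟩
    rw [stable_block_iff]
    intro S hS hu x y hx hy
    exact (stable_iff hΛ (B.isLower_upTo x₀ y₀)).2 hup S hS hu x y (Or.inr ⟨hx, hy⟩)

/-- The type of a block is invariant if the preceding blocks are stable. -/
theorem kind_conj (hΛ : IsRed Λ B.strips) {U : Matrix P P k} (hU : U ∈ Λ)
    (hu : IsUnit U) {x y : P} (hb : Λ ≤ commutantOn M (B.strips.before x y)) :
    B.strips.kind Λ (U⁻¹ * M * U) x y = B.strips.kind Λ M x y := by
  have key : ∀ {M U : Matrix P P k}, U ∈ Λ → IsUnit U → Λ ≤ commutantOn M (B.strips.before x y) →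
      B.strips.HasAdd Λ (U⁻¹ * M * U) x y → B.strips.HasAdd Λ M x y := by
    intro M U hU hu hb h hM
    refine h fun T hT => ?_
    have hup : Λ ⊓ B.strips.strict k ≤ commutantOn M (B.strips.upTo x y) :=
      fun S hS => mem_commutantOn_upTo.2 ⟨hb hS.1, hM hS⟩
    exact (mem_commutantOn_upTo.1 (le_commutantOn_conj hΛ (B.isLower_upTo x y) hU hu
      (hΛ.conj_strict_mem hU hu) hup hT)).2
  have : B.strips.HasAdd Λ (U⁻¹ * M * U) x y ↔ B.strips.HasAdd Λ M x y := by
    refine ⟨key hU hu hb, fun h => ?_⟩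
    refine key (U := U⁻¹) (hΛ.inv_mem hU hu) (Matrix.isUnit_nonsing_inv_iff.2 hu)
      (le_commutantOn_conj hΛ (B.isLower_before x y) hU hu (hΛ.conj_mem hU hu) hb) ?_
    rwa [conj_conj_inv hu]
  simp only [Strips.kind, this]

theorem Strips.newBoxes_congr {Q : Strips P} {Λ Λ' : Submodule k (Matrix P P k)}
    {A A' : Matrix P P k} {old : Set (Box P)} {q : P → P → Prop}
    (h : ∀ x y, q x y → Q.kind Λ A x y = Q.kind Λ' A' x y) :
    Q.newBoxes Λ A old q = Q.newBoxes Λ' A' old q := by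
  ext b
  constructor
  · rintro ⟨x, y, hq, ho, rfl⟩
    exact ⟨x, y, hq, ho, by rw [h x y hq]⟩
  · rintro ⟨x, y, hq, ho, rfl⟩
    exact ⟨x, y, hq, ho, by rw [h x y hq]⟩

theorem entryAt_congr {A A' : Matrix P P k} {R C : Finset P}
    (h : ∀ x ∈ R, ∀ y ∈ C, A x y = A' x y) : entryAt A R C = entryAt A' R C := by
  funext a b
  rw [entryAt, entryAt]
  split_ifs
  · exact h _ (Finset.orderEmbOfFin_mem _ _ _) _ (Finset.orderEmbOfFin_mem _ _ _)
  · rfl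

theorem squarePart_congr {A A' : Matrix P P k} {R C : Finset P}
    (h : ∀ x ∈ R, ∀ y ∈ C, A x y = A' x y) : squarePart A R C = squarePart A' R C := by
  rw [squarePart, squarePart, entryAt_congr h]

theorem IsCornerPart.congr {A A' : Matrix P P k} {R C : Finset P}
    (h : ∀ x ∈ R, ∀ y ∈ C, A x y = A' x y) (hA : IsCornerPart A R C) : IsCornerPart A' R C := by
  rwa [IsCornerPart, entryAt_congr h] at hA

variable [LinearOrder k]

/-- The part of `A` with rows `R` and columns `C` is reduced to the form of the given type. -/
def IsReducedPart (A : Matrix P P k) (R C : Finset P) : BoxKind → Prop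
  | .empty => ∀ x ∈ R, ∀ y ∈ C, A x y = 0
  | .corner => IsCornerPart A R C
  | .weyr => IsWeyr (squarePart A R C)

/-- The run of the algorithm on a canonical matrix `A`, which is not changed at any step. -/
inductive CRun (A : Matrix P P k) : Submodule k (Matrix P P k) → Strips P → Set (Box P) →
    Set (Box P) → Prop
  | finish (Λ : Submodule k (Matrix P P k)) (Q : Strips P) (old : Set (Box P))
      (h : Λ ≤ commutantOn A fun _ _ => True) :
      CRun A Λ Q old (old ∪ Q.newBoxes Λ A old fun _ _ => True)
  | step (Λ : Submodule k (Matrix P P k)) (Q : Strips P) (old : Set (Box P)) (x₀ y₀ : P)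
      (B' : BlockStructure P) (boxes : Set (Box P))
      (hbefore : Λ ≤ commutantOn A (Q.before x₀ y₀))
      (hblock : ¬ Λ ≤ commutantOn A (Q.block x₀ y₀))
      (hA : IsReducedPart A (Q.rows x₀) (Q.rows y₀) (Q.kind Λ A x₀ y₀))
      (hB : IsReducedAlgebra (Λ ⊓ commutantOn A (Q.block x₀ y₀)) B')
      (hrun : CRun A (Λ ⊓ commutantOn A (Q.block x₀ y₀)) B'.strips
        (old ∪ Q.newBoxes Λ A old (Q.upTo x₀ y₀)) boxes) :
      CRun A Λ Q old boxes

theorem IsReducedPart.congr {A A' : Matrix P P k} {R C : Finset P} {κ : BoxKind}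
    (h : ∀ x ∈ R, ∀ y ∈ C, A x y = A' x y) (hA : IsReducedPart A R C κ) :
    IsReducedPart A' R C κ := by
  cases κ with
  | empty => exact fun x hx y hy => (h x hx y hy).symm.trans (hA x hx y hy)
  | corner => exact IsCornerPart.congr h hA
  | weyr => rwa [IsReducedPart, squarePart_congr h] at hA

theorem IsReduction.isReducedPart {l r : Fin B.t} {M' : Matrix P P k}
    (h : IsReduction Λ B M l r M') :
    IsReducedPart M' (B.rows l) (B.rows r) (blockKind Λ B M l r) := by
  obtain ⟨S, -, -, -, h⟩ := h
  cases hk : blockKind Λ B M l r with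
  | empty => rw [hk] at h; exact h.2
  | corner => rw [hk] at h; exact h
  | weyr => rw [hk] at h; exact h

theorem isReduction_self (hΛ : IsRed Λ B.strips) {l r : Fin B.t}
    (h : IsReducedPart M (B.rows l) (B.rows r) (blockKind Λ B M l r)) :
    IsReduction Λ B M l r M := by
  refine ⟨1, hΛ.one, isUnit_one, by simp, ?_⟩
  cases hk : blockKind Λ B M l r with
  | empty => rw [hk] at h; exact ⟨fun _ _ _ => rfl, h⟩
  | corner => rw [hk] at h; exact h
  | weyr => rw [hk] at h; exact h

theorem CRun.run [Infinite k] {Q : Strips P} {old boxes : Set (Box P)}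
    (h : CRun M Λ Q old boxes) : ∀ B : BlockStructure P, IsReducedAlgebra Λ B → Q = B.strips →
      Run Λ B M old M boxes := by
  induction h with
  | finish Λ Q old h =>
    rintro B hB rfl
    have := Run.finish Λ B M old ((all_stable_iff hB.isRed).2 h)
    rwa [hB.isRed.newBoxes_eq hB.equalSizes] at this
  | step Λ Q old x₀ y₀ B' boxes hbefore hblock hA hB' hrun ih =>
    rintro B hB rfl
    rw [← restrict_eq] at hB' ih
    rw [B.rows_strips, B.rows_strips, ← hB.isRed.blockKind_eq hB.equalSizes] at hA
    refine Run.step Λ B M old (B.strip x₀) (B.strip y₀) M B' M boxes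
      ((firstNonstable_iff hB.isRed _ _).2 ⟨hbefore, hblock⟩) (isReduction_self hB.isRed hA) hB' ?_
    have := ih B' hB' rfl
    rw [hB.isRed.newBoxes_eq hB.equalSizes]
    exact this

/-- The later transformations lie in the restricted algebra, so they commute with `M'` on all blocks
up to the reduced one and leave these blocks as they are. Hence the final matrix `N` already has the
reduced block at this step and yields the same restricted algebra and the same types of boxes: the
run can be replayed on `N` with nothing moving. -/
theorem Run.cRun [Infinite k] {old boxes : Set (Box P)} (h : Run Λ B M old N boxes) :
    IsReducedAlgebra Λ B →
      (∃ T ∈ Λ, IsUnit T ∧ N = T⁻¹ * M * T) ∧ CRun N Λ B.strips old boxes := by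
  induction h with
  | finish Λ B M old h =>
    intro hB
    refine ⟨⟨1, hB.isRed.one, isUnit_one, by simp⟩, ?_⟩
    rw [hB.isRed.newBoxes_eq hB.equalSizes]
    exact CRun.finish Λ B.strips old ((all_stable_iff hB.isRed).1 h)
  | step Λ B M old l r M' B' N boxes h hM hB' hrun ih =>
    intro hB
    have hΛ := hB.isRed
    obtain ⟨⟨T, hT, hTu, hN⟩, hrun'⟩ := ih hB'
    obtain ⟨x₀, rfl⟩ : ∃ x₀, B.strip x₀ = l := by
      by_contra hne
      exact h.1 fun S hS hu x hx => absurd ⟨x, B.mem_rows.1 hx⟩ hne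
    obtain ⟨y₀, rfl⟩ : ∃ y₀, B.strip y₀ = r := by
      by_contra hne
      exact h.1 fun S hS hu x hx y hy => absurd ⟨y, B.mem_rows.1 hy⟩ hne
    have hpart := hM.isReducedPart
    obtain ⟨S, hS, hSu, hM', -⟩ := hM
    obtain ⟨hbefore, hblock⟩ := (firstNonstable_iff hΛ _ _).1 h
    rw [restrict_eq] at hT hB' hrun'
    have hlow := B.isLower_upTo x₀ y₀
    have hNM : N = (S * T)⁻¹ * M * (S * T) := by
      rw [hN, hM', Matrix.mul_inv_rev]
      simp only [mul_assoc]
    have hST : S * T ∈ Λ := hΛ.mul _ hS _ hT.1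
    have hSTu : IsUnit (S * T) := hSu.mul hTu
    have hbM' : Λ ≤ commutantOn M' (B.strips.before x₀ y₀) := by
      rw [hM']
      exact le_commutantOn_conj hΛ (B.isLower_before x₀ y₀) hS hSu (hΛ.conj_mem hS hSu) hbefore
    have hbN : Λ ≤ commutantOn N (B.strips.before x₀ y₀) := by
      rw [hNM]
      exact le_commutantOn_conj hΛ (B.isLower_before x₀ y₀) hST hSTu (hΛ.conj_mem hST hSTu) hbefore
    have hagree : ∀ x y, B.strips.upTo x₀ y₀ x y → N x y = M' x y := by
      rw [hN]
      exact conj_apply_of_mem hΛ hlow hT.1 hTu (mem_commutantOn_upTo.2 ⟨hbM' hT.1, hT.2⟩)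
    -- `N - M'` vanishes on the lower set `upTo`, so products with block-triangular matrices vanish
    -- there too, and the commutators with `M'` and with `N` agree on the block.
    have hres : Λ ⊓ commutantOn M' (B.strips.block x₀ y₀) =
        Λ ⊓ commutantOn N (B.strips.block x₀ y₀) := by
      have hcomm : ∀ R ∈ Λ, ∀ x y, B.strips.upTo x₀ y₀ x y →
          (R * M' - M' * R) x y = (R * N - N * R) x y := by
        intro R hR x y hxy
        have h1 := hlow.mul_left (Y := N - M') (hΛ.upper R hR)
          (fun x y hxy => by rw [Matrix.sub_apply, hagree x y hxy, sub_self]) x y hxy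
        have h2 := hlow.mul_right (Y := N - M') (hΛ.upper R hR)
          (fun x y hxy => by rw [Matrix.sub_apply, hagree x y hxy, sub_self]) x y hxy
        rw [mul_sub, Matrix.sub_apply, sub_eq_zero] at h1
        rw [sub_mul, Matrix.sub_apply, sub_eq_zero] at h2
        rw [Matrix.sub_apply, Matrix.sub_apply, h1, h2]
      ext R
      refine and_congr_right fun hR => forall_congr' fun x => forall_congr' fun y =>
        forall_congr' fun hxy => ?_
      rw [hcomm R hR x y (Or.inr hxy)]
    have hkind : ∀ x y, B.strips.upTo x₀ y₀ x y →
        B.strips.kind Λ M x y = B.strips.kind Λ N x y := by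
      intro x y hxy
      rw [hNM, kind_conj hΛ hST hSTu]
      exact hbefore.trans (commutantOn_mono fun u v huv => B.before_of_upTo hxy huv)
    refine ⟨⟨S * T, hST, hSTu, hNM⟩, ?_⟩
    refine CRun.step Λ B.strips old x₀ y₀ B' boxes hbN ?_ ?_ (hres ▸ hB') ?_
    -- If the block were stable for `N`, conjugating back by `(S * T)⁻¹` would make it stable for
    -- `M`.
    · intro hle
      have hup : Λ ≤ commutantOn N (B.strips.upTo x₀ y₀) :=
        fun R hR => mem_commutantOn_upTo.2 ⟨hbN hR, hle hR⟩
      have := le_commutantOn_conj hΛ hlow (hΛ.inv_mem hST hSTu)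
        (Matrix.isUnit_nonsing_inv_iff.2 hSTu)
        (hΛ.conj_mem (hΛ.inv_mem hST hSTu) (Matrix.isUnit_nonsing_inv_iff.2 hSTu)) hup
      rw [hNM, conj_conj_inv hSTu] at this
      exact hblock fun R hR => (mem_commutantOn_upTo.1 (this hR)).2
    · rw [B.rows_strips, B.rows_strips, ← hkind x₀ y₀ (Or.inr ⟨rfl, rfl⟩),
        ← hΛ.blockKind_eq hB.equalSizes]
      refine hpart.congr fun x hx y hy => (hagree x y (Or.inr ⟨?_, ?_⟩)).symm
      · exact B.mem_rows.1 hx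
      · exact B.mem_rows.1 hy
    · rw [← hres, ← Strips.newBoxes_congr hkind]
      rw [hΛ.newBoxes_eq hB.equalSizes] at hrun'
      exact hrun'

theorem isStructuredCanonical_iff [Infinite k] (hB : IsReducedAlgebra Λ B)
    {boxes : Set (Box P)} :
    IsStructuredCanonical Λ B M boxes ↔ CRun M Λ B.strips ∅ boxes :=
  ⟨fun h => (Run.cRun h hB).2, fun h => h.run B hB rfl⟩

end CanonicalRun

/-! ### Weyr matrices -/

section Weyr

/-- A matrix that commutes with a triangular matrix `W`, the nonzero entries of which off the
diagonal join indices with equal diagonal entries, respects the classes of these indices. -/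
theorem apply_eq_zero_of_commute {k : Type*} [Field k] {m : ℕ} {ι : Type*}
    {W X : Matrix (Fin m) (Fin m) k} {c : Fin m → ι} {ev : ι → k} (hev : Function.Injective ev)
    (hup : ∀ x y, y < x → W x y = 0) (hdiag : ∀ x, W x x = ev (c x))
    (hoff : ∀ x y, x ≠ y → W x y ≠ 0 → c x = c y) (hX : X * W = W * X) :
    ∀ x y, c x ≠ c y → X x y = 0 := by
  -- Induction from the lower left corner: in the two products, an entry of `X` at a place of
  -- different classes meets only itself and entries of `X` further left or further down.
  suffices h : ∀ (N : ℕ) (x y : Fin m), m - (x : ℕ) + y ≤ N → c x ≠ c y → X x y = 0 from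
    fun x y => h _ x y le_rfl
  intro N
  induction N with
  | zero => intro x y h; omega
  | succ N ih =>
    intro x y h hc
    have h1 : (X * W) x y = X x y * ev (c y) := by
      rw [Matrix.mul_apply, Finset.sum_eq_single y, hdiag]
      · intro z _ hz
        by_cases h0 : W z y = 0
        · rw [h0, mul_zero]
        · have hcz := hoff z y hz h0
          have hlt : z < y := by
            refine lt_of_le_of_ne (not_lt.1 fun hlt => h0 (hup _ _ hlt)) hz
          rw [ih x z (by omega) (by rwa [hcz]), zero_mul]
      · simp
    have h2 : (W * X) x y = ev (c x) * X x y := by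
      rw [Matrix.mul_apply, Finset.sum_eq_single x, hdiag]
      · intro z _ hz
        by_cases h0 : W x z = 0
        · rw [h0, zero_mul]
        · have hcz := hoff x z hz.symm h0
          have hlt : x < z := by
            refine lt_of_le_of_ne (not_lt.1 fun hlt => h0 (hup _ _ hlt)) hz.symm
          rw [ih z y (by omega) (by rwa [← hcz]), mul_zero]
      · simp
    -- Only the diagonal terms are left: `X x y` times the eigenvalue of `y` equals `X x y` times
    -- that of `x`, and these eigenvalues differ.
    rw [hX, h2, mul_comm] at h1
    by_contra hne
    exact hc (hev (mul_left_cancel₀ hne h1))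

/-- The centralizer does not change if the diagonal entries are replaced. -/
theorem commute_of_commute {k : Type*} [Field k] {m : ℕ} {ι : Type*}
    {W W' X : Matrix (Fin m) (Fin m) k} {c : Fin m → ι} {ev ev' : ι → k}
    (hev : Function.Injective ev)
    (hup : ∀ x y, y < x → W x y = 0) (hdiag : ∀ x, W x x = ev (c x))
    (hoff : ∀ x y, x ≠ y → W x y ≠ 0 → c x = c y) (hdiag' : ∀ x, W' x x = ev' (c x))
    (hoff' : ∀ x y, x ≠ y → W' x y = W x y) (hX : X * W = W * X) : X * W' = W' * X := by
  have h0 := apply_eq_zero_of_commute hev hup hdiag hoff hX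
  -- The change is a diagonal matrix that is constant on classes, and `X`, which vanishes between
  -- distinct classes, commutes with it.
  have hW' : W' = W + Matrix.diagonal fun x => ev' (c x) - ev (c x) := by
    ext x y
    rw [Matrix.add_apply]
    by_cases h : x = y
    · subst h
      rw [Matrix.diagonal_apply_eq, hdiag, hdiag']
      ring
    · rw [Matrix.diagonal_apply_ne _ h, hoff' x y h, add_zero]
  rw [hW', mul_add, add_mul, hX]
  congr 1
  ext x y
  rw [Matrix.mul_diagonal, Matrix.diagonal_mul]
  by_cases hc : c x = c y
  · rw [hc, mul_comm]
  · rw [h0 x y hc, zero_mul, mul_zero]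

variable {k : Type*} [Field k] [LinearOrder k] {m : ℕ}

/-- The shape of a Weyr matrix. -/
theorem IsWeyr.exists_classes {W : Matrix (Fin m) (Fin m) k} (hW : IsWeyr W) :
    ∃ (r : ℕ) (c : Fin m → Fin r) (ev : Fin r → k), StrictMono ev ∧ Function.Surjective c ∧
      (∀ x y, y < x → W x y = 0) ∧ (∀ x, W x x = ev (c x)) ∧
      (∀ x y, x ≠ y → W x y ≠ 0 → c x = c y) ∧
      ∀ (ev' : Fin r → k) (W' : Matrix (Fin m) (Fin m) k), StrictMono ev' →
        (∀ x, W' x x = ev' (c x)) → (∀ x y, x ≠ y → W' x y = W x y) → IsWeyr W' := by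
  obtain ⟨D, e, h⟩ := hW
  have hne : ∀ x y : D.Index, x ≠ y → ¬ (((ofLex x).1 = (ofLex y).1 ∧
      ((ofLex (ofLex x).2).2 : ℕ) = ((ofLex (ofLex y).2).2 : ℕ)) ∧
      ((ofLex (ofLex x).2).1 : ℕ) = ((ofLex (ofLex y).2).1 : ℕ)) := by
    rintro ⟨i, j, a⟩ ⟨i', j', a'⟩ hxy ⟨⟨h1, h2⟩, h3⟩
    apply hxy
    change i = i' at h1
    subst h1
    change (j : ℕ) = (j' : ℕ) at h3
    obtain rfl := Fin.ext h3
    change (a : ℕ) = (a' : ℕ) at h2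
    obtain rfl := Fin.ext h2
    rfl
  have hdiag : ∀ x : D.Index, D.entry x x = D.eigenvalue (ofLex x).1 := by
    intro x
    simp [WeyrData.entry]
  -- The class of a row is the number of its eigenvalue, so new increasing eigenvalues fit into the
  -- same `WeyrData`.
  refine ⟨D.r, fun x => (ofLex (e x)).1, D.eigenvalue, D.eigenvalue_strictMono, ?_, ?_, ?_, ?_, ?_⟩
  · intro i
    refine ⟨e.symm (toLex ⟨i, toLex ⟨⟨0, D.len_pos i⟩, ⟨0, D.size_pos i _⟩⟩⟩), ?_⟩
    simp
  · intro x y hxy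
    rw [h]
    have hlt : e y < e x := e.lt_iff_lt.2 hxy
    by_contra h0
    unfold WeyrData.entry at h0
    split_ifs at h0 with h1 h2 h3
    · exact hne _ _ hlt.ne' ⟨h1, h2⟩
    · revert hlt h1 h3
      generalize e x = u
      generalize e y = v
      obtain ⟨i, j, a⟩ := u
      obtain ⟨i', j', a'⟩ := v
      rintro hlt ⟨h1, -⟩ h3
      change i = i' at h1
      subst h1
      change (j : ℕ) + 1 = (j' : ℕ) at h3
      rcases Sigma.Lex.lt_def.1 hlt with h4 | ⟨_, h4⟩
      · exact h4.ne rfl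
      · rcases Sigma.Lex.lt_def.1 h4 with h5 | ⟨h5, -⟩
        · change (j' : ℕ) < (j : ℕ) at h5
          omega
        · change j' = j at h5
          subst h5
          omega
    · exact h0 rfl
    · exact h0 rfl
  · intro x
    rw [h, hdiag]
  · intro x y hxy h0
    rw [h] at h0
    by_contra hc
    exact h0 (if_neg fun h => hc h.1)
  · intro ev' W' hev' hd ho
    refine ⟨{ D with eigenvalue := ev', eigenvalue_strictMono := hev' }, e, fun x y => ?_⟩
    by_cases hxy : x = y
    · subst hxy
      rw [hd]
      simp [WeyrData.entry]
    · rw [ho x y hxy, h]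
      have := hne (e x) (e y) (fun h => hxy (e.injective h))
      unfold WeyrData.entry
      split_ifs with h1 h2
      · exact absurd ⟨h1, h2⟩ this
      · rfl
      · rfl
      · rfl

theorem isWeyr_scalar (hm : 0 < m) (c : k) : IsWeyr (Matrix.scalar (Fin m) c) := by
  let D : WeyrData k :=
    { r := 1
      eigenvalue := fun _ => c
      eigenvalue_strictMono := Subsingleton.strictMono _
      len := fun _ => 1
      len_pos := fun _ => one_pos
      size := fun _ _ => m
      size_antitone := fun _ _ _ _ => le_rfl
      size_pos := fun _ _ => hm }
  let f : Fin m → D.Index := fun a => toLex ⟨(0 : Fin 1), toLex ⟨(0 : Fin 1), a⟩⟩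
  have hf : StrictMono f := by
    intro a b hab
    refine Sigma.Lex.lt_def.2 (Or.inr ⟨rfl, ?_⟩)
    exact Sigma.Lex.lt_def.2 (Or.inr ⟨rfl, hab⟩)
  have hs : Function.Surjective f := by
    rintro ⟨i, j, a⟩
    obtain rfl : i = (0 : Fin 1) := Subsingleton.elim (α := Fin 1) _ _
    obtain rfl : j = (0 : Fin 1) := Subsingleton.elim (α := Fin 1) _ _
    exact ⟨a, rfl⟩
  refine ⟨D, hf.orderIsoOfSurjective f hs, fun x y => ?_⟩
  change _ = D.entry (f x) (f y)
  by_cases hxy : x = y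
  · subst hxy
    simp [WeyrData.entry, D]
  · have : ¬ (x : ℕ) = y := fun h => hxy (Fin.ext h)
    simp [WeyrData.entry, f, hxy, this]

end Weyr

/-! ### Diagonal transformations of a block with equivalent strips -/

section DiagonalBlocks

variable {P : Type*} [LinearOrder P] [Fintype P] {k : Type*} [Field k]

theorem sum_eq_sum_orderEmbOfFin (R : Finset P) (f : P → k) (hf : ∀ z, z ∉ R → f z = 0) :
    ∑ z, f z = ∑ c : Fin R.card, f (R.orderEmbOfFin rfl c) := by
  rw [← Finset.sum_subset (Finset.subset_univ R) fun z _ hz => hf z hz, ← Finset.sum_coe_sort]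
  exact (Fintype.sum_equiv (R.orderIsoOfFin rfl).toEquiv _ _ fun c => rfl).symm

theorem BlockStructure.strip_orderEmbOfFin (B : BlockStructure P) (i : Fin B.t)
    (a : Fin (B.rows i).card) : B.strip ((B.rows i).orderEmbOfFin rfl a) = i :=
  B.mem_rows.1 (Finset.orderEmbOfFin_mem _ _ _)

theorem BlockStructure.pos_orderEmbOfFin (B : BlockStructure P) (i : Fin B.t)
    (a : Fin (B.rows i).card) : B.pos ((B.rows i).orderEmbOfFin rfl a) = a := by
  rw [BlockStructure.pos, B.strip_orderEmbOfFin, posIn_orderEmbOfFin]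

theorem squarePart_apply {A : Matrix P P k} {R C : Finset P} (hc : R.card = C.card)
    (a b : Fin R.card) : squarePart A R C a b =
      A (R.orderEmbOfFin rfl a) (C.orderEmbOfFin rfl (Fin.cast hc b)) := by
  rw [squarePart, Matrix.of_apply, entryAt, dif_pos ⟨a.2, hc ▸ b.2⟩]
  rfl

/-- The diagonal blocks of `D` at the two equivalent strips are one and the same square matrix, so
commuting with `A` on the block means that this matrix commutes with the block of `A`. -/
theorem BlockStructure.comm_apply (B : BlockStructure P) {i j : Fin B.t} (hij : B.equiv i j)
    (hc : (B.rows i).card = (B.rows j).card) {D : Matrix P P k} (hD : B.strips.IsDiag D)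
    (A : Matrix P P k) (a b : Fin (B.rows i).card) :
    (D * A - A * D) ((B.rows i).orderEmbOfFin rfl a)
        ((B.rows j).orderEmbOfFin rfl (Fin.cast hc b)) =
      (squarePart D (B.rows i) (B.rows i) * squarePart A (B.rows i) (B.rows j) -
        squarePart A (B.rows i) (B.rows j) * squarePart D (B.rows i) (B.rows i)) a b := by
  rw [Matrix.sub_apply, Matrix.sub_apply, Matrix.mul_apply, Matrix.mul_apply, Matrix.mul_apply,
    Matrix.mul_apply]
  congr 1
  · rw [sum_eq_sum_orderEmbOfFin (B.rows i)]
    · refine Finset.sum_congr rfl fun c _ => ?_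
      rw [squarePart_apply rfl, squarePart_apply hc]
      rfl
    · intro z hz
      rw [hD.1, zero_mul]
      intro h
      change B.strip _ = B.strip z at h
      rw [B.strip_orderEmbOfFin] at h
      exact hz (B.mem_rows.2 h.symm)
  · rw [sum_eq_sum_orderEmbOfFin (B.rows j), ← (finCongr hc).sum_comp]
    · refine Finset.sum_congr rfl fun c _ => ?_
      rw [squarePart_apply rfl, squarePart_apply hc]
      congr 1
      refine hD.2 _ _ _ _ ?_ ?_ ⟨?_, ?_⟩ ⟨?_, ?_⟩
      · exact (B.strip_orderEmbOfFin _ _).trans (B.strip_orderEmbOfFin _ _).symm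
      · exact (B.strip_orderEmbOfFin _ _).trans (B.strip_orderEmbOfFin _ _).symm
      · rw [B.strip_orderEmbOfFin, B.strip_orderEmbOfFin]
        exact B.equiv.symm hij
      · rw [B.pos_orderEmbOfFin, B.pos_orderEmbOfFin]
        rfl
      · rw [B.strip_orderEmbOfFin, B.strip_orderEmbOfFin]
        exact B.equiv.symm hij
      · rw [B.pos_orderEmbOfFin, B.pos_orderEmbOfFin]
        rfl
    · intro z hz
      rw [hD.1, mul_zero]
      intro h
      change B.strip z = B.strip _ at h
      rw [B.strip_orderEmbOfFin] at h
      exact hz (B.mem_rows.2 h)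

theorem BlockStructure.mem_commutantOn_block_iff (B : BlockStructure P) {x₀ y₀ : P}
    (hij : B.equiv (B.strip x₀) (B.strip y₀))
    (hc : (B.rows (B.strip x₀)).card = (B.rows (B.strip y₀)).card) {D : Matrix P P k}
    (hD : B.strips.IsDiag D) (A : Matrix P P k) :
    D ∈ commutantOn A (B.strips.block x₀ y₀) ↔
      squarePart D (B.rows (B.strip x₀)) (B.rows (B.strip x₀)) *
        squarePart A (B.rows (B.strip x₀)) (B.rows (B.strip y₀)) =
      squarePart A (B.rows (B.strip x₀)) (B.rows (B.strip y₀)) *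
        squarePart D (B.rows (B.strip x₀)) (B.rows (B.strip x₀)) := by
  rw [← sub_eq_zero]
  constructor
  · intro h
    ext a b
    rw [← B.comm_apply hij hc hD]
    exact h _ _ ⟨B.strip_orderEmbOfFin _ _, B.strip_orderEmbOfFin _ _⟩
  · rintro h x y ⟨hx, hy⟩
    obtain ⟨a, rfl⟩ := exists_orderEmbOfFin_eq (B.mem_rows.2 hx)
    obtain ⟨b, rfl⟩ := exists_orderEmbOfFin_eq (B.mem_rows.2 hy)
    have := B.comm_apply hij hc hD A a (Fin.cast hc.symm b)
    rw [h] at this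
    exact this

theorem BlockStructure.squarePart_unit (B : BlockStructure P) {x : P}
    (a b : Fin (B.rows (B.strip x)).card) :
    squarePart (B.strips.unit k ((B.rows (B.strip x)).orderEmbOfFin rfl a)
      ((B.rows (B.strip x)).orderEmbOfFin rfl b)) (B.rows (B.strip x)) (B.rows (B.strip x)) =
      Matrix.single a b 1 := by
  ext c d
  rw [squarePart_apply rfl, Strips.unit, Matrix.of_apply, Matrix.single_apply]
  congr 1
  have key : ∀ a c : Fin (B.rows (B.strip x)).card, B.strips.corr
      ((B.rows (B.strip x)).orderEmbOfFin rfl a)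
      ((B.rows (B.strip x)).orderEmbOfFin rfl c) ↔ a = c := by
    intro a c
    constructor
    · intro h
      have := h.2
      rw [B.pos_orderEmbOfFin, B.pos_orderEmbOfFin] at this
      exact Fin.ext this
    · rintro rfl
      exact B.corr_refl _
  rw [key a c, eq_iff_iff]
  change _ ∧ _ ∧ B.strips.corr _ ((B.rows (B.strip x)).orderEmbOfFin rfl d) ↔ _
  rw [key b d]
  exact ⟨fun h => h.2, fun h => ⟨(B.strip_orderEmbOfFin _ _).trans (B.strip_orderEmbOfFin _ _).symm,
    h⟩⟩

variable {Λ : Submodule k (Matrix P P k)} {B : BlockStructure P}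

/-- A stable block with equivalent strips is a scalar matrix. -/
theorem exists_squarePart_eq_scalar (hB : IsReducedAlgebra Λ B) {A : Matrix P P k} {x y : P}
    (he : B.equiv (B.strip x) (B.strip y)) (h : Λ ≤ commutantOn A (B.strips.block x y)) :
    ∃ c, squarePart A (B.rows (B.strip x)) (B.rows (B.strip y)) = Matrix.scalar _ c := by
  have : squarePart A (B.rows (B.strip x)) (B.rows (B.strip y)) ∈
      Set.range (Matrix.scalar (α := k) (Fin (B.rows (B.strip x)).card)) := by
    rw [Matrix.mem_range_scalar_iff_commute_single]
    intro a b _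
    -- The repeated matrix units lie in `Λ`, so a stable block commutes with every off-diagonal
    -- matrix unit and is scalar.
    have hD := B.isDiag_unit (k := k) ((B.rows (B.strip x)).orderEmbOfFin rfl a)
      ((B.rows (B.strip x)).orderEmbOfFin rfl b)
    have := (B.mem_commutantOn_block_iff he (hB.equalSizes _ _ he) hD A).1
      (h (hB.isRed.contains _ hD))
    rw [B.squarePart_unit] at this
    exact this
  obtain ⟨c, hc⟩ := this
  exact ⟨c, hc.symm⟩

end DiagonalBlocks

/-! ### The boxes of a canonical matrix -/

section Boxes

variable {P : Type*} [LinearOrder P] [Fintype P] {k : Type*} [Field k]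

/-- Distinct boxes have no common places. -/
def DisjointBoxes (s : Set (Box P)) : Prop :=
  ∀ b ∈ s, ∀ b' ∈ s, ∀ x y, x ∈ b.rows → y ∈ b.cols → x ∈ b'.rows → y ∈ b'.cols → b = b'

/-- The boxes consist of whole blocks. -/
def Saturated (s : Set (Box P)) (Q : Strips P) : Prop :=
  ∀ b ∈ s, ∀ x x', Q.same x x' → (x ∈ b.rows → x' ∈ b.rows) ∧ (x ∈ b.cols → x' ∈ b.cols)

theorem BlockStructure.rows_eq_of_same (B : BlockStructure P) {x x' : P}
    (h : B.strips.same x x') : B.strips.rows x = B.strips.rows x' := by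
  rw [B.rows_strips, B.rows_strips]
  exact congrArg B.rows h

theorem BlockStructure.mem_strips_rows (B : BlockStructure P) (x : P) : x ∈ B.strips.rows x :=
  Strips.mem_rows.2 rfl

theorem BlockStructure.EqualSizes.kind_congr {B : BlockStructure P} (hsz : B.EqualSizes)
    (Λ : Submodule k (Matrix P P k)) (A : Matrix P P k) {x x' y y' : P}
    (hx : B.strips.same x x') (hy : B.strips.same y y') :
    B.strips.kind Λ A x y = B.strips.kind Λ A x' y' := by
  have hx' : B.strip x = B.strip x' := hx
  have hy' : B.strip y = B.strip y' := hy
  have h1 : B.strips.block x y = B.strips.block x' y' := by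
    funext u v
    change (B.strip u = B.strip x ∧ B.strip v = B.strip y) =
      (B.strip u = B.strip x' ∧ B.strip v = B.strip y')
    rw [hx', hy']
  have h2 : B.strips.eqv x y ↔ B.strips.eqv x' y' := by
    rw [hsz.eqv_iff, hsz.eqv_iff, hx', hy']
  have h3 : B.strips.HasAdd Λ A x y ↔ B.strips.HasAdd Λ A x' y' := by
    rw [Strips.HasAdd, Strips.HasAdd, h1]
  simp only [Strips.kind, h2, h3]

theorem Strips.kind_eq_weyr_iff {Q : Strips P} {Λ : Submodule k (Matrix P P k)}
    {A : Matrix P P k} {x y : P} :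
    Q.kind Λ A x y = .weyr ↔ ¬ Q.HasAdd Λ A x y ∧ Q.eqv x y := by
  by_cases h1 : Q.HasAdd Λ A x y <;> by_cases h2 : Q.eqv x y <;> simp [Strips.kind, h1, h2]

theorem Strips.kind_eq_empty_iff {Q : Strips P} {Λ : Submodule k (Matrix P P k)}
    {A : Matrix P P k} {x y : P} : Q.kind Λ A x y = .empty ↔ Q.HasAdd Λ A x y := by
  by_cases h1 : Q.HasAdd Λ A x y <;> by_cases h2 : Q.eqv x y <;> simp [Strips.kind, h1, h2]

variable {Λ : Submodule k (Matrix P P k)} {B : BlockStructure P} {A : Matrix P P k}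
  {old : Set (Box P)} {q : P → P → Prop}

/-- Old boxes consist of whole blocks, so a block that meets an old box is contained in it and is
not added. -/
theorem DisjointBoxes.union_newBoxes (h : DisjointBoxes old) (hs : Saturated old B.strips)
    (hsz : B.EqualSizes) : DisjointBoxes (old ∪ B.strips.newBoxes Λ A old q) := by
  have key : ∀ b ∈ old, ∀ b' ∈ B.strips.newBoxes Λ A old q, ∀ x y, x ∈ b.rows → y ∈ b.cols →
      x ∈ b'.rows → y ∈ b'.cols → False := by
    rintro b hb _ ⟨u, v, -, ho, rfl⟩ x y hx hy (hxu : x ∈ B.strips.rows u)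
      (hyv : y ∈ B.strips.rows v)
    rw [Strips.mem_rows] at hxu hyv
    refine ho ⟨b, hb, fun z hz => ?_, fun z hz => ?_⟩
    · rw [Strips.mem_rows] at hz
      exact (hs b hb x z (hxu.trans hz.symm)).1 hx
    · rw [Strips.mem_rows] at hz
      exact (hs b hb y z (hyv.trans hz.symm)).2 hy
  rintro b (hb | hb) b' (hb' | hb') x y h1 h2 h3 h4
  · exact h b hb b' hb' x y h1 h2 h3 h4
  · exact (key b hb b' hb' x y h1 h2 h3 h4).elim
  · exact (key b' hb' b hb x y h3 h4 h1 h2).elim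
  · obtain ⟨u, v, -, -, rfl⟩ := hb
    obtain ⟨u', v', -, -, rfl⟩ := hb'
    have hu : B.strips.same u u' := (Strips.mem_rows.1 h1).symm.trans (Strips.mem_rows.1 h3)
    have hv : B.strips.same v v' := (Strips.mem_rows.1 h2).symm.trans (Strips.mem_rows.1 h4)
    rw [B.rows_eq_of_same hu, B.rows_eq_of_same hv, hsz.kind_congr Λ A hu hv]

theorem Saturated.union_newBoxes (hs : Saturated old B.strips) :
    Saturated (old ∪ B.strips.newBoxes Λ A old q) B.strips := by
  rintro b (hb | ⟨u, v, -, -, rfl⟩) x x' hx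
  · exact hs b hb x x' hx
  · simp only [Strips.mem_rows]
    exact ⟨fun h => hx.symm.trans h, fun h => hx.symm.trans h⟩

theorem Saturated.refine {Q Q' : Strips P} (hs : Saturated old Q)
    (h : ∀ x y, Q'.same x y → Q.same x y) : Saturated old Q' :=
  fun b hb x x' hx => hs b hb x x' (h x x' hx)

variable [LinearOrder k]

/-- The box is square and `A` is a Weyr matrix there. -/
def IsWeyrBox (A : Matrix P P k) (b : Box P) : Prop :=
  b.rows.card = b.cols.card ∧ IsWeyr (squarePart A b.rows b.cols)

theorem isWeyrBox_of_stable (hB : IsReducedAlgebra Λ B) {x y : P} (he : B.strips.eqv x y)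
    (h : Λ ≤ commutantOn A (B.strips.block x y)) (κ : BoxKind) :
    IsWeyrBox A ⟨B.strips.rows x, B.strips.rows y, κ⟩ := by
  rw [hB.equalSizes.eqv_iff] at he
  obtain ⟨c, hc⟩ := exists_squarePart_eq_scalar hB he h
  rw [IsWeyrBox]
  dsimp only
  rw [B.rows_strips, B.rows_strips, hc]
  exact ⟨hB.equalSizes _ _ he, isWeyr_scalar (Finset.card_pos.2 ⟨x, B.mem_rows_strip x⟩) c⟩

/-- A new box of type `weyr` is either the block reduced at this step, where `A` is a Weyr matrix by
the run, or a stable block with equivalent strips, which is scalar and thus a Weyr matrix with one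
eigenvalue. -/
theorem CRun.boxes_properties {Q : Strips P} {boxes : Set (Box P)} (h : CRun A Λ Q old boxes) :
    ∀ B : BlockStructure P, IsReducedAlgebra Λ B → Q = B.strips →
      old ⊆ boxes ∧ (DisjointBoxes old → Saturated old Q → DisjointBoxes boxes) ∧
      ((∀ b ∈ old, b.kind = .weyr → IsWeyrBox A b) →
        ∀ b ∈ boxes, b.kind = .weyr → IsWeyrBox A b) := by
  induction h with
  | finish Λ Q old h =>
    rintro B hB rfl
    refine ⟨Set.subset_union_left, fun h1 h2 => h1.union_newBoxes h2 hB.equalSizes, ?_⟩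
    rintro hold b (hb | ⟨x, y, -, -, rfl⟩) hk
    · exact hold b hb hk
    · exact isWeyrBox_of_stable hB (Strips.kind_eq_weyr_iff.1 hk).2
        (h.trans (commutantOn_mono fun _ _ _ => trivial)) _
  | step Λ Q old x₀ y₀ B' boxes hbefore hblock hA hB' hrun ih =>
    rintro B hB rfl
    obtain ⟨h1, h2, h3⟩ := ih B' hB' rfl
    refine ⟨Set.subset_union_left.trans h1, fun hd hs => h2 (hd.union_newBoxes hs hB.equalSizes)
      (hs.union_newBoxes.refine fun x y => hB.isRed.same_of_le hB'.isRed inf_le_left),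
      fun hold => h3 ?_⟩
    rintro b (hb | ⟨x, y, hxy | ⟨hx, hy⟩, -, rfl⟩) hk
    · exact hold b hb hk
    · refine isWeyrBox_of_stable hB (Strips.kind_eq_weyr_iff.1 hk).2
        (hbefore.trans (commutantOn_mono ?_)) _
      rintro u v ⟨hu, hv⟩
      change BlockLT _ _ _ _
      change BlockLT _ _ _ _ at hxy
      rwa [show B.strip u = B.strip x from hu, show B.strip v = B.strip y from hv]
    · change B.strips.kind Λ A x y = _ at hk
      rw [hB.equalSizes.kind_congr Λ A hx hy] at hk ⊢
      have he := hB.equalSizes.eqv_iff.1 (Strips.kind_eq_weyr_iff.1 hk).2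
      rw [hk] at hA ⊢
      rw [B.rows_eq_of_same hx, B.rows_eq_of_same hy]
      refine ⟨?_, hA⟩
      dsimp only
      rw [B.rows_strips, B.rows_strips]
      exact hB.equalSizes _ _ he

end Boxes

/-! ### The algebra of the matrix problem; dependent and free blocks -/

section BlowUp

variable {P : Type*} [LinearOrder P] [Fintype P] {k : Type*} [Field k]

/-- The inner sum may run up to `Fintype.card P` for strips of every size, since entries beyond a
strip are `0` by convention. -/
theorem BlockStructure.block_mul (B : BlockStructure P) (S T : Matrix P P k) (i j : Fin B.t)
    (a b : ℕ) : B.block (S * T) i j a b = ∑ l, ∑ c ∈ Finset.range (Fintype.card P),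
      B.block S i l a c * B.block T l j c b := by
  by_cases h : a < (B.rows i).card ∧ b < (B.rows j).card
  · obtain ⟨x, rfl, rfl⟩ := B.exists_pos h.1
    obtain ⟨y, rfl, rfl⟩ := B.exists_pos h.2
    rw [B.block_pos, Matrix.mul_apply, ← Finset.sum_product']
    have hlt : ∀ x, B.pos x < Fintype.card P := fun x =>
      (B.pos_lt x).trans_le (Finset.card_le_univ _)
    refine (Finset.sum_of_injOn (fun z => (B.strip z, B.pos z)) ?_ ?_ ?_ ?_)
    · intro z _ w _ hzw
      exact B.ext_pos (congrArg Prod.fst hzw) (congrArg Prod.snd hzw)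
    · intro z _
      simp [hlt z]
    · rintro ⟨l, c⟩ - hlc
      dsimp only
      by_cases hc : c < (B.rows l).card
      · obtain ⟨z, rfl, rfl⟩ := B.exists_pos hc
        exact absurd ⟨z, by simp, rfl⟩ hlc
      · rw [B.block_eq_zero _ (fun h => hc h.2), zero_mul]
    · intro z _
      rw [B.block_pos, B.block_pos]
  · rw [B.block_eq_zero _ h]
    symm
    refine Finset.sum_eq_zero fun l _ => Finset.sum_eq_zero fun c _ => ?_
    by_cases ha : a < (B.rows i).card
    · rw [B.block_eq_zero T (fun h' => h ⟨ha, h'.2⟩), mul_zero]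
    · rw [B.block_eq_zero S (fun h' => ha h'.1), zero_mul]

variable {t : ℕ} {Γ : Subalgebra k (Matrix (Fin t) (Fin t) k)}
  {V : Submodule k (Matrix (Fin t) (Fin t) k)} {n : Fin t → ℕ}

theorem slice_mul (S T : Matrix (Place n) (Place n) k) (a b : ℕ) :
    (Matrix.of fun i j : Fin t => (initialStructure Γ n).block (S * T) i j a b) =
      ∑ c ∈ Finset.range (Fintype.card (Place n)),
        (Matrix.of fun i j : Fin t => (initialStructure Γ n).block S i j a c) *
        (Matrix.of fun i j : Fin t => (initialStructure Γ n).block T i j c b) := by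
  ext i j
  rw [Matrix.of_apply, Matrix.sum_apply]
  refine ((initialStructure Γ n).block_mul S T i j a b).trans ?_
  rw [Finset.sum_comm]
  rfl

theorem mul_mem_blowUp (hV : ∀ X ∈ Γ, ∀ Y ∈ V, X * Y ∈ V ∧ Y * X ∈ V)
    {S A : Matrix (Place n) (Place n) k} (hS : S ∈ blowUpAlgebra Γ n) (hA : A ∈ blowUp Γ V n) :
    S * A ∈ blowUp Γ V n ∧ A * S ∈ blowUp Γ V n := by
  constructor
  · intro a b
    rw [slice_mul]
    exact V.sum_mem fun c _ => (hV _ (hS a c) _ (hA c b)).1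
  · intro a b
    rw [slice_mul]
    exact V.sum_mem fun c _ => (hV _ (hS c b) _ (hA a c)).2

theorem comm_mem_blowUp (hV : ∀ X ∈ Γ, ∀ Y ∈ V, X * Y ∈ V ∧ Y * X ∈ V)
    {S A : Matrix (Place n) (Place n) k} (hS : S ∈ blowUpAlgebra Γ n) (hA : A ∈ blowUp Γ V n) :
    S * A - A * S ∈ blowUp Γ V n :=
  Submodule.sub_mem _ (mul_mem_blowUp hV hS hA).1 (mul_mem_blowUp hV hS hA).2

theorem card_rows_initialStructure (Γ : Subalgebra k (Matrix (Fin t) (Fin t) k)) (i : Fin t) :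
    ((initialStructure Γ n).rows i).card = n i := by
  let f : Fin (n i) ↪ Place n := ⟨fun a => toLex ⟨i, a⟩, fun a b h => by
    have : (⟨i, a⟩ : Σ i, Fin (n i)) = ⟨i, b⟩ := h
    simpa using this⟩
  have : (initialStructure Γ n).rows i = Finset.univ.map f := by
    ext x
    refine (initialStructure Γ n).mem_rows.trans ?_
    rw [Finset.mem_map]
    constructor
    · obtain ⟨j, a⟩ := x
      rintro (rfl : j = i)
      exact ⟨a, Finset.mem_univ _, rfl⟩
    · rintro ⟨a, -, rfl⟩
      rfl
  rw [this, Finset.card_map, Finset.card_univ, Fintype.card_fin]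

/-- The diagonals of `Γ` form a subalgebra `Δ` of `k^t`. Products of functions that separate one
index from another give, for each class, its indicator function, and these span all functions
constant on classes. -/
theorem diagonal_mem (hΓ : IsBasic Γ) (d : Fin t → k)
    (hd : ∀ i j, diagEquiv Γ i j → d i = d j) : Matrix.diagonal d ∈ Γ := by
  let Δ : Subalgebra k (Fin t → k) := Γ.comap (Matrix.diagonalAlgHom k)
  have hΔ : ∀ e ∈ Δ, ∀ i j, diagEquiv Γ i j → e i = e j := by
    intro e he i j hij
    have := hij _ he
    simpa using this
  have hsep : ∀ i j, ¬ diagEquiv Γ i j → ∃ e ∈ Δ, e i = 1 ∧ e j = 0 := by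
    intro i j hij
    obtain ⟨X, hX, hne⟩ : ∃ X ∈ Γ, X i i ≠ X j j := by
      by_contra! h
      exact hij h
    have hmem : (fun l => X l l) ∈ Δ := (hΓ X hX).2
    -- The affine function of the diagonal of `X` that takes the value `1` at `i` and `0` at `j`.
    refine ⟨(X i i - X j j)⁻¹ • ((fun l => X l l) - algebraMap k (Fin t → k) (X j j)),
      Δ.smul_mem (Δ.sub_mem hmem (Δ.algebraMap_mem _)) _, ?_, ?_⟩
    · simp [inv_mul_cancel₀ (sub_ne_zero.2 hne)]
    · simp
  have hidem : ∀ i, ∃ e ∈ Δ, e i = 1 ∧ ∀ j, ¬ diagEquiv Γ i j → e j = 0 := by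
    intro i
    have : ∀ j, ∃ e ∈ Δ, e i = 1 ∧ (¬ diagEquiv Γ i j → e j = 0) := by
      intro j
      by_cases hij : diagEquiv Γ i j
      · exact ⟨1, Δ.one_mem, rfl, fun h => absurd hij h⟩
      · obtain ⟨e, he, h1, h2⟩ := hsep i j hij
        exact ⟨e, he, h1, fun _ => h2⟩
    choose e he h1 h2 using this
    refine ⟨∏ j, e j, Δ.prod_mem fun j _ => he j, ?_, fun j hij => ?_⟩
    · rw [Finset.prod_apply]
      exact Finset.prod_eq_one fun j _ => h1 j
    · rw [Finset.prod_apply]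
      exact Finset.prod_eq_zero (Finset.mem_univ j) (h2 j hij)
  choose e he h1 h2 using hidem
  have hsum : d = ∑ I : Quotient (diagEquiv Γ), d I.out • e I.out := by
    funext j
    rw [Finset.sum_apply, Finset.sum_eq_single (Quotient.mk _ j)]
    · have hj : diagEquiv Γ (Quotient.mk (diagEquiv Γ) j).out j := Quotient.mk_out j
      rw [Pi.smul_apply, ← hΔ _ (he _) _ _ hj, h1, hd _ _ hj, smul_eq_mul, mul_one]
    · intro I _ hI
      rw [Pi.smul_apply, h2, smul_zero]
      intro h
      apply hI
      rw [← Quotient.out_eq I]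
      exact Quotient.sound h
    · simp
  have : d ∈ Δ := by
    rw [hsum]
    exact Δ.sum_mem fun I _ => Δ.smul_mem (he _) _
  exact this

theorem BlockStructure.block_isDiag (B : BlockStructure P) (hsz : B.EqualSizes)
    {D : Matrix P P k} (hD : B.strips.IsDiag D) (a b : ℕ) :
    (∀ i j, i ≠ j → B.block D i j a b = 0) ∧
      ∀ i j, B.equiv i j → B.block D i i a b = B.block D j j a b := by
  constructor
  · intro i j hij
    by_cases h : a < (B.rows i).card ∧ b < (B.rows j).card
    · obtain ⟨x, rfl, rfl⟩ := B.exists_pos h.1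
      obtain ⟨y, rfl, rfl⟩ := B.exists_pos h.2
      rw [B.block_pos]
      exact hD.1 _ _ hij
    · exact B.block_eq_zero _ h
  · intro i j hij
    by_cases h : a < (B.rows i).card ∧ b < (B.rows i).card
    · have h' := h
      rw [hsz i j hij] at h'
      obtain ⟨x, hx, hxa⟩ := B.exists_pos h.1
      obtain ⟨y, hy, hyb⟩ := B.exists_pos h.2
      obtain ⟨x', hx', hxa'⟩ := B.exists_pos h'.1
      obtain ⟨y', hy', hyb'⟩ := B.exists_pos h'.2
      have e1 := B.block_pos D x y
      have e2 := B.block_pos D x' y'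
      rw [hx, hy, hxa, hyb] at e1
      rw [hx', hy', hxa', hyb'] at e2
      rw [e1, e2]
      refine hD.2 x y x' y' (hx.trans hy.symm) (hx'.trans hy'.symm) ⟨?_, ?_⟩ ⟨?_, ?_⟩
      · rw [hx, hx']; exact hij
      · rw [hxa, hxa']
      · rw [hy, hy']; exact hij
      · rw [hyb, hyb']
    · rw [B.block_eq_zero _ h]
      rw [hsz i j hij] at h
      rw [B.block_eq_zero _ h]

theorem isReducedAlgebra_blowUpAlgebra (hΓ : IsBasic Γ) (hn : IsStepSequence Γ n) :
    IsReducedAlgebra (blowUpAlgebra Γ n) (initialStructure Γ n) := by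
  have hsz : (initialStructure Γ n).EqualSizes := by
    intro i j hij
    exact (card_rows_initialStructure Γ i).trans
      ((hn i j hij).trans (card_rows_initialStructure Γ j).symm)
  have hdiag : ∀ D : Matrix (Place n) (Place n) k, (initialStructure Γ n).strips.IsDiag D →
      D ∈ blowUpAlgebra Γ n := by
    intro D hD a b
    obtain ⟨h1, h2⟩ := (initialStructure Γ n).block_isDiag hsz hD a b
    have : (Matrix.of fun i j : Fin t => (initialStructure Γ n).block D i j a b) =
        Matrix.diagonal fun i : Fin t => (initialStructure Γ n).block D i i a b := by
      ext i j
      by_cases hij : i = j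
      · subst hij; simp
      · rw [Matrix.diagonal_apply_ne _ hij, Matrix.of_apply]
        exact h1 i j hij
    rw [this]
    exact diagonal_mem hΓ _ h2
  refine IsRed.isReducedAlgebra ⟨hdiag 1 ⟨?_, ?_⟩, ?_, ?_, ?_, hdiag⟩ hsz
  · intro x y hxy
    exact Matrix.one_apply_ne fun h => hxy (h ▸ rfl)
  · intro x y x' y' hxy hxy' hx hy
    rw [Matrix.one_apply, Matrix.one_apply]
    congr 1
    rw [eq_iff_iff]
    constructor
    · rintro rfl
      exact (initialStructure Γ n).ext_pos hxy' (hx.2.symm.trans hy.2)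
    · rintro rfl
      exact (initialStructure Γ n).ext_pos hxy (hx.2.trans hy.2.symm)
  · intro S hS T hT
    exact (mul_mem_blowUp (fun X hX Y hY => ⟨Γ.mul_mem hX hY, Γ.mul_mem hY hX⟩) hS hT).1
  · intro S hS x y hxy
    rw [← (initialStructure Γ n).block_pos S x y]
    exact (hΓ _ (hS _ _)).1 _ _ hxy
  · intro S hS x y x' y' hxy hxy' hx hy
    have h1 := (initialStructure Γ n).block_pos S x y
    have h2 := (initialStructure Γ n).block_pos S x' y'
    rw [← show (initialStructure Γ n).strip x = _ from hxy] at h1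
    rw [← show (initialStructure Γ n).strip x' = _ from hxy', ← hx.2, ← hy.2] at h2
    rw [← h1, ← h2]
    exact hx.1 _ (hS ((initialStructure Γ n).pos x) ((initialStructure Γ n).pos y))

/-- An entry of a dependent block vanishes if the corresponding entries of the preceding blocks
vanish. -/
theorem apply_eq_zero_of_dependent {Y : Matrix (Place n) (Place n) k} (hY : Y ∈ blowUp Γ V n)
    {x y : Place n} (hxy : ¬ IsFreePlace V x y)
    (h : ∀ x' y' : Place n, ((ofLex x).1 < (ofLex x').1 ∨
      (x' = x ∧ (ofLex y').1 < (ofLex y).1)) → Y x' y' = 0) : Y x y = 0 := by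
  obtain ⟨c, hc, hX⟩ := not_not.1 hxy
  have := hX _ (hY ((initialStructure Γ n).pos x) ((initialStructure Γ n).pos y))
  rw [Matrix.of_apply] at this
  rw [← (initialStructure Γ n).block_pos Y x y]
  refine this.trans (Finset.sum_eq_zero fun i _ => Finset.sum_eq_zero fun j _ => ?_)
  by_cases h0 : c i j = 0
  · rw [h0, zero_mul]
  · rw [Matrix.of_apply]
    by_cases hab : (initialStructure Γ n).pos x < ((initialStructure Γ n).rows i).card ∧
      (initialStructure Γ n).pos y < ((initialStructure Γ n).rows j).card
    · obtain ⟨x', hx', hxp⟩ := (initialStructure Γ n).exists_pos hab.1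
      obtain ⟨y', hy', hyp⟩ := (initialStructure Γ n).exists_pos hab.2
      have e := (initialStructure Γ n).block_pos Y x' y'
      rw [hx', hy', hxp, hyp] at e
      rw [e, h x' y', mul_zero]
      rcases hc i j h0 with hlt | ⟨hi, hj⟩
      · left
        have : (ofLex x').1 = i := hx'
        rwa [this]
      · right
        -- The relations compare entries at one fixed position of the blocks, so within the same
        -- strip the row is `x` itself.
        refine ⟨(initialStructure Γ n).ext_pos (hx'.trans hi) hxp, ?_⟩
        have : (ofLex y').1 = j := hy'
        rwa [this]
    · rw [BlockStructure.block_eq_zero _ _ hab, mul_zero]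

/-- A matrix of the problem is determined by its free blocks. -/
theorem eq_zero_of_free_eq_zero {Y : Matrix (Place n) (Place n) k} (hY : Y ∈ blowUp Γ V n)
    (h : ∀ x y, IsFreePlace V x y → Y x y = 0) : Y = 0 := by
  -- Double induction along the order of blocks: strips from the bottom up, then columns from left
  -- to right.
  have key : ∀ (N : ℕ) (N' : ℕ) (x y : Place n), t - ((ofLex x).1 : ℕ) = N →
      ((ofLex y).1 : ℕ) = N' → Y x y = 0 := by
    intro N
    induction N using Nat.strong_induction_on with
    | _ N ih =>
      intro N'
      induction N' using Nat.strong_induction_on with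
      | _ N' ih' =>
        intro x y hx hy
        by_cases hf : IsFreePlace V x y
        · exact h x y hf
        · refine apply_eq_zero_of_dependent hY hf ?_
          rintro x' y' (hlt | ⟨rfl, hlt⟩)
          · refine ih (t - ((ofLex x').1 : ℕ)) ?_ _ x' y' rfl rfl
            have := (ofLex x').1.2
            have : ((ofLex x).1 : ℕ) < (ofLex x').1 := hlt
            omega
          · exact ih' _ (hy ▸ hlt) _ y' hx rfl
  ext x y
  exact key _ _ x y rfl rfl

/-- Nonstable blocks lie in free blocks. -/
theorem isFreePlace_of_nonstable (hV : ∀ X ∈ Γ, ∀ Y ∈ V, X * Y ∈ V ∧ Y * X ∈ V)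
    (h0 : IsRed (blowUpAlgebra Γ n) (initialStructure Γ n).strips)
    {Λ : Submodule k (Matrix (Place n) (Place n) k)} {B : BlockStructure (Place n)}
    (hΛ : IsRed Λ B.strips) (hle : Λ ≤ blowUpAlgebra Γ n) {A : Matrix (Place n) (Place n) k}
    (hA : A ∈ blowUp Γ V n) {x₀ y₀ : Place n}
    (hbefore : Λ ≤ commutantOn A (B.strips.before x₀ y₀))
    (hblock : ¬ Λ ≤ commutantOn A (B.strips.block x₀ y₀)) :
    ∀ x y, B.strips.block x₀ y₀ x y → IsFreePlace V x y := by
  obtain ⟨S, hS, hSc⟩ := SetLike.not_le_iff_exists.1 hblock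
  simp only [mem_commutantOn, not_forall] at hSc
  obtain ⟨u, v, ⟨hu, hv⟩, hne⟩ := hSc
  rintro x y ⟨hx, hy⟩
  have hxu : (ofLex x).1 = (ofLex u).1 := h0.same_of_le hΛ hle (hx.trans hu.symm)
  have hyv : (ofLex y).1 = (ofLex v).1 := h0.same_of_le hΛ hle (hy.trans hv.symm)
  -- The commutator of `S` and `A` lies again in the space of the problem. In a dependent block its
  -- entry would be a combination of entries of preceding blocks of the initial partition; these
  -- precede in the finer partition too, so they vanish by `hbefore`.
  by_contra hf
  rw [IsFreePlace, hxu, hyv] at hf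
  refine hne (apply_eq_zero_of_dependent (comm_mem_blowUp hV (hle hS) hA) hf ?_)
  rintro x' y' (hlt | ⟨rfl, hlt⟩)
  · have h1 : B.strip u < B.strip x' := h0.lt_of_le hΛ hle (x := u) (y := x') hlt
    refine hbefore hS x' y' (Or.inl ?_)
    change B.strip x₀ < B.strip x'
    rwa [← show B.strip u = B.strip x₀ from hu]
  · have h1 : B.strip y' < B.strip v := h0.lt_of_le hΛ hle (x := y') (y := v) hlt
    refine hbefore hS x' y' (Or.inr ⟨hu, ?_⟩)
    change B.strip y' < B.strip y₀
    rwa [← show B.strip v = B.strip y₀ from hv]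

/-! ### The matrix `M(a)` as a polynomial in the parameters -/

variable {p : ℕ}

theorem PolyDefinable.imp {K : Set (Fin p → k)} (q : Prop) (h : q → PolyDefinable K) :
    PolyDefinable {a | q → a ∈ K} := by
  by_cases hq : q
  · simpa [hq] using h hq
  · convert PolyDefinable.univ (k := k) (p := p) using 1
    ext a
    simp [hq]

theorem polyDefinable_mem (U : Submodule k (Matrix P P k))
    (F : P → P → MvPolynomial (Fin p) k) :
    PolyDefinable {a : Fin p → k | (Matrix.of fun x y => MvPolynomial.eval a (F x y)) ∈ U} := by
  obtain ⟨m, φ, h⟩ := exists_equations U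
  convert polyDefinable_forall_eq_zero (fun i : Fin m =>
    ∑ x, ∑ y, MvPolynomial.C (φ i (Matrix.single x y 1)) * F x y) using 1
  ext a
  simp only [Set.mem_ofPred_eq, h, map_sum, map_mul, MvPolynomial.eval_C]
  refine forall_congr' fun i => ?_
  rw [linearMap_apply_eq_sum]
  rfl

theorem polyDefinable_eq (F G : MvPolynomial (Fin p) k) :
    PolyDefinable {a : Fin p → k | MvPolynomial.eval a F = MvPolynomial.eval a G} := by
  convert polyDefinable_forall_eq_zero (fun _ : Unit => F - G) using 1
  ext a
  simp [sub_eq_zero]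

variable {M : Matrix (Place n) (Place n) k} {boxOf : Fin p → Box (Place n)} {lam : Fin p → k}

/-- A matrix of the problem is recovered from its free entries by a linear map `σ`, and the free
entries of `M(a)` are parameters or constants. The polynomials are defined for all `a`; only for
those `a` at which `M(a)` exists are they claimed to give it. -/
theorem exists_polynomial_entries
    (hdiag : ∀ x y, IsFreePlace V x y →
      (∃ i, IsDiagonalPlace (boxOf i).rows (boxOf i).cols x y) →
      ∃ j, IsDiagonalPlace (boxOf j).rows (boxOf j).cols x y ∧ M x y = lam j) :
    ∃ F : Place n → Place n → MvPolynomial (Fin p) k, ∀ a A,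
      IsValueAt Γ V M boxOf lam a A → A = Matrix.of fun x y => MvPolynomial.eval a (F x y) := by
  let ρ : blowUp Γ V n →ₗ[k] Matrix (Place n) (Place n) k :=
    { toFun := fun A => Matrix.of fun x y => if IsFreePlace V x y then A.1 x y else 0
      map_add' := by
        intro A A'
        ext x y
        by_cases h : IsFreePlace V x y <;> simp [h]
      map_smul' := by
        intro c A
        ext x y
        by_cases h : IsFreePlace V x y <;> simp [h] }
  have hρ : LinearMap.ker ρ = ⊥ := by
    rw [LinearMap.ker_eq_bot']
    intro A hA
    refine Subtype.ext (eq_zero_of_free_eq_zero A.2 fun x y hxy => ?_)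
    have : ρ A x y = 0 := by rw [hA]; rfl
    change (if IsFreePlace V x y then A.1 x y else 0) = 0 at this
    rwa [if_pos hxy] at this
  obtain ⟨σ, hσ⟩ := ρ.exists_leftInverse_of_injective hρ
  have hdiag' : ∀ x y, ∃ j : Option (Fin p), IsFreePlace V x y →
      (∃ i, IsDiagonalPlace (boxOf i).rows (boxOf i).cols x y) →
      ∃ i, j = some i ∧ IsDiagonalPlace (boxOf i).rows (boxOf i).cols x y ∧ M x y = lam i := by
    intro x y
    by_cases h : IsFreePlace V x y ∧ ∃ i, IsDiagonalPlace (boxOf i).rows (boxOf i).cols x y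
    · obtain ⟨j, hj⟩ := hdiag x y h.1 h.2
      exact ⟨some j, fun _ _ => ⟨j, rfl, hj⟩⟩
    · exact ⟨none, fun h1 h2 => absurd ⟨h1, h2⟩ h⟩
  choose j hj using hdiag'
  let q : Place n → Place n → MvPolynomial (Fin p) k := fun x y =>
    if IsFreePlace V x y then
      -- In this branch `j x y` is the number of a parameter, by `hj`; the default `0` is never
      -- taken.
      if ∃ i, IsDiagonalPlace (boxOf i).rows (boxOf i).cols x y then (j x y).elim 0 MvPolynomial.X
      else MvPolynomial.C (M x y)
    else 0
  refine ⟨fun x y => ∑ u, ∑ v, MvPolynomial.C ((σ (Matrix.single u v 1)).1 x y) * q u v,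
    fun a A hA => ?_⟩
  obtain ⟨hmem, hd, hf⟩ := hA
  have hq : ∀ u v, MvPolynomial.eval a (q u v) = ρ ⟨A, hmem⟩ u v := by
    intro u v
    change _ = if IsFreePlace V u v then A u v else 0
    simp only [q]
    split_ifs with h1 h2
    · obtain ⟨i, hi, hi1, hi2⟩ := hj u v h1 h2
      rw [hi, Option.elim_some, MvPolynomial.eval_X]
      exact (hd _ u v hi1 hi2).symm
    · rw [MvPolynomial.eval_C]
      exact (hf u v h1 h2).symm
    · simp
  ext x y
  have h1 : (σ (ρ ⟨A, hmem⟩)).1 = A := by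
    have := LinearMap.congr_fun hσ ⟨A, hmem⟩
    exact congrArg Subtype.val this
  conv_lhs => rw [← h1]
  let ev : blowUp Γ V n →ₗ[k] k :=
    { toFun := fun A => A.1 x y
      map_add' := fun _ _ => rfl
      map_smul' := fun _ _ => rfl }
  have h2 := linearMap_apply_eq_sum (ev.comp σ) (ρ ⟨A, hmem⟩)
  refine h2.trans ?_
  simp only [Matrix.of_apply, map_sum, map_mul, MvPolynomial.eval_C, hq]
  rfl

/-- Makes a separate existence proof for `M(a)` unnecessary: that the evaluated polynomials form
`M(a)` is itself a polynomial condition on `a` and joins the system. -/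
theorem polyDefinable_isValueAt (F : Place n → Place n → MvPolynomial (Fin p) k) :
    PolyDefinable {a : Fin p → k | IsValueAt Γ V M boxOf lam a
      (Matrix.of fun x y => MvPolynomial.eval a (F x y))} := by
  have h2 : PolyDefinable {a : Fin p → k | ∀ i x y,
      IsDiagonalPlace (boxOf i).rows (boxOf i).cols x y → M x y = lam i →
        MvPolynomial.eval a (F x y) = a i} := by
    refine PolyDefinable.forall fun i => PolyDefinable.forall fun x => PolyDefinable.forall fun y =>
      PolyDefinable.imp _ fun _ => PolyDefinable.imp _ fun _ => ?_
    have := polyDefinable_eq (F x y) (MvPolynomial.X i)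
    simp only [MvPolynomial.eval_X] at this
    exact this
  have h3 : PolyDefinable {a : Fin p → k | ∀ x y, IsFreePlace V x y →
      (¬ ∃ i, IsDiagonalPlace (boxOf i).rows (boxOf i).cols x y) →
        MvPolynomial.eval a (F x y) = M x y} := by
    refine PolyDefinable.forall fun x => PolyDefinable.forall fun y =>
      PolyDefinable.imp _ fun _ => PolyDefinable.imp _ fun _ => ?_
    have := polyDefinable_eq (F x y) (MvPolynomial.C (M x y))
    simp only [MvPolynomial.eval_C] at this
    exact this
  exact (polyDefinable_mem (blowUp Γ V n) F).inter (h2.inter h3)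

end BlowUp

/-! ### One step of the algorithm compared for two matrices -/

section Comparison

variable {P : Type*} [LinearOrder P] [Fintype P] {k : Type*} [Field k]

theorem BlockStructure.strips_block_eq (B : BlockStructure P) {x y x' y' : P}
    (hx : B.strips.same x x') (hy : B.strips.same y y') :
    B.strips.block x y = B.strips.block x' y' := by
  funext u v
  change (B.strip u = B.strip x ∧ B.strip v = B.strip y) =
    (B.strip u = B.strip x' ∧ B.strip v = B.strip y')
  rw [show B.strip x = B.strip x' from hx, show B.strip y = B.strip y' from hy]

theorem BlockStructure.strips_before_eq (B : BlockStructure P) {x y x' y' : P}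
    (hx : B.strips.same x x') (hy : B.strips.same y y') :
    B.strips.before x y = B.strips.before x' y' := by
  funext u v
  change BlockLT (B.strip u) (B.strip v) (B.strip x) (B.strip y) =
    BlockLT (B.strip u) (B.strip v) (B.strip x') (B.strip y')
  rw [show B.strip x = B.strip x' from hx, show B.strip y = B.strip y' from hy]

theorem BlockStructure.block_of_before (B : BlockStructure P) {x₀ y₀ x y u v : P}
    (h : B.strips.before x₀ y₀ x y) (h' : B.strips.block x y u v) :
    B.strips.before x₀ y₀ u v := by
  change BlockLT (B.strip u) (B.strip v) _ _
  rw [show B.strip u = B.strip x from h'.1, show B.strip v = B.strip y from h'.2]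
  exact h

theorem BlockStructure.before_trichotomy (B : BlockStructure P) (x₀ y₀ x y : P) :
    B.strips.before x₀ y₀ x y ∨ (B.strips.same x x₀ ∧ B.strips.same y y₀) ∨
      B.strips.before x y x₀ y₀ := by
  simp only [Strips.before, BlockStructure.strips]
  grind

variable {Λ Λ' : Submodule k (Matrix P P k)} {B B' : BlockStructure P} {A M : Matrix P P k}

theorem Strips.IsDiag.mul_apply_congr {D A A' : Matrix P P k} (hD : B.strips.IsDiag D) {x y : P}
    (h : ∀ u v, B.strips.block x y u v → A u v = A' u v) :
    D ∈ commutantOn A (B.strips.block x y) → D ∈ commutantOn A' (B.strips.block x y) := by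
  intro hc u v huv
  rw [← hc u v huv, Matrix.sub_apply, Matrix.sub_apply, Matrix.mul_apply, Matrix.mul_apply,
    Matrix.mul_apply, Matrix.mul_apply]
  congr 1
  · refine Finset.sum_congr rfl fun z _ => ?_
    by_cases hz : B.strips.same u z
    · rw [h z v ⟨hz.symm.trans huv.1, huv.2⟩]
    · rw [hD.1 u z hz, zero_mul, zero_mul]
  · refine Finset.sum_congr rfl fun z _ => ?_
    by_cases hz : B.strips.same z v
    · rw [h u z ⟨huv.1, Eq.trans hz huv.2⟩]
    · rw [hD.1 z v hz, mul_zero, mul_zero]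

/-- Outside Case I the strictly block-triangular part of `S` commutes with `A` on the block
automatically, so only the diagonal part is constrained. -/
theorem IsRed.diagPart_mem_commutantOn_iff (hΛ : IsRed Λ B.strips) {x y : P}
    (hadd : ¬ B.strips.HasAdd Λ A x y) {S : Matrix P P k} (hS : S ∈ Λ) :
    B.strips.diagPart S ∈ commutantOn A (B.strips.block x y) ↔
      S ∈ commutantOn A (B.strips.block x y) := by
  have h := not_not.1 hadd (hΛ.sub_diagPart_mem hS)
  constructor
  · intro hd
    have := Submodule.add_mem _ h hd
    rwa [sub_add_cancel] at this
  · intro hs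
    have := Submodule.sub_mem _ hs h
    rwa [sub_sub_cancel] at this

theorem not_hasAdd_of_le {Q : Strips P} {x y : P} (h : Λ ≤ commutantOn A (Q.block x y)) :
    ¬ Q.HasAdd Λ A x y := fun h' => h' (inf_le_left.trans h)

theorem Strips.kind_congr_of_hasAdd {Q : Strips P} {x y : P}
    (h : Q.HasAdd Λ A x y ↔ Q.HasAdd Λ' M x y) : Q.kind Λ A x y = Q.kind Λ' M x y := by
  simp only [Strips.kind, h]

/-- The matrices of an algebra that commute with `A` on a block form an algebra if they commute
with `A` on the preceding blocks. -/
theorem IsRed.mul_mem_inf (hΛ : IsRed Λ B.strips) {x y : P}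
    (hb : Λ ≤ commutantOn A (B.strips.before x y)) :
    ∀ S ∈ Λ ⊓ commutantOn A (B.strips.block x y), ∀ T ∈ Λ ⊓ commutantOn A (B.strips.block x y),
      S * T ∈ Λ ⊓ commutantOn A (B.strips.block x y) := by
  intro S hS T hT
  refine ⟨hΛ.mul S hS.1 T hT.1, fun u v huv => ?_⟩
  have hlow := B.isLower_upTo x y
  have h1 := hlow.mul_left (hΛ.upper S hS.1)
    (mem_commutantOn_upTo.2 ⟨hb hT.1, hT.2⟩) u v (Or.inr huv)
  have h2 := hlow.mul_right (hΛ.upper T hT.1)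
    (mem_commutantOn_upTo.2 ⟨hb hS.1, hS.2⟩) u v (Or.inr huv)
  have : S * T * A - A * (S * T) = S * (T * A - A * T) + (S * A - A * S) * T := by
    simp only [mul_sub, sub_mul, mul_assoc]
    abel
  rw [this, Matrix.add_apply, h1, h2, add_zero]

/-- The algebra obtained at the next step from `A` is reduced for the same partition as the one
obtained from `M` if `A` and `M` have the same type of the block and the same diagonal
transformations preserving the block. -/
theorem isReducedAlgebra_next (hM : IsReducedAlgebra Λ B) (hA : IsReducedAlgebra Λ' B) {x y : P}
    (hbM : Λ ≤ commutantOn M (B.strips.before x y))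
    (hbA : Λ' ≤ commutantOn A (B.strips.before x y))
    (hdiag : ∀ D, B.strips.IsDiag D →
      (D ∈ commutantOn M (B.strips.block x y) ↔ D ∈ commutantOn A (B.strips.block x y)))
    (hadd : B.strips.HasAdd Λ' A x y ↔ B.strips.HasAdd Λ M x y)
    (hzero : B.strips.HasAdd Λ M x y →
      ∀ D, B.strips.IsDiag D → D ∈ commutantOn M (B.strips.block x y))
    (hB' : IsReducedAlgebra (Λ ⊓ commutantOn M (B.strips.block x y)) B') :
    IsReducedAlgebra (Λ' ⊓ commutantOn A (B.strips.block x y)) B' := by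
  have hmul := hA.isRed.mul_mem_inf hbA
  by_cases hM' : B.strips.HasAdd Λ M x y
  -- Case I: the block-diagonal matrices all survive, so the partition is not refined and `B'` has
  -- the relations of `B`.
  · have hs : B.strips = B'.strips := by
      refine IsRed.strips_eq (Λ := Λ ⊓ commutantOn M (B.strips.block x y)) ?_ hB'.isRed
      exact ⟨hB'.isRed.one, hM.isRed.mul_mem_inf hbM, fun S hS => hM.isRed.upper S hS.1,
        fun S hS => hM.isRed.diag S hS.1, fun D hD => ⟨hM.isRed.contains D hD, hzero hM' D hD⟩⟩
    refine IsRed.isReducedAlgebra ?_ hB'.equalSizes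
    rw [← hs]
    exact ⟨⟨hA.isRed.one, fun u v _ => by simp⟩, hmul, fun S hS => hA.isRed.upper S hS.1,
        fun S hS => hA.isRed.diag S hS.1,
        fun D hD => ⟨hA.isRed.contains D hD, (hdiag D hD).1 (hzero hM' D hD)⟩⟩
  · have hA' : ¬ B.strips.HasAdd Λ' A x y := fun h => hM' (hadd.1 h)
    have hsame : ∀ {u v}, B'.strips.same u v → B.strips.same u v :=
      fun h => hM.isRed.same_of_le hB'.isRed inf_le_left h
    -- Cases II and III: the diagonal part of a matrix of one next algebra lies in the other, so the
    -- relations of `B'` inside the diagonal blocks of `B` carry over; outside these blocks the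
    -- relations of `B` suffice.
    have hD : ∀ S ∈ Λ' ⊓ commutantOn A (B.strips.block x y),
        B.strips.diagPart S ∈ Λ ⊓ commutantOn M (B.strips.block x y) := by
      intro S hS
      have h1 := hA.isRed.isDiag_diagPart hS.1
      exact ⟨hM.isRed.contains _ h1,
        (hdiag _ h1).2 ((hA.isRed.diagPart_mem_commutantOn_iff hA' hS.1).2 hS.2)⟩
    have happ : ∀ (S : Matrix P P k) {u v}, B.strips.same u v →
        B.strips.diagPart S u v = S u v := fun S u v h => if_pos h
    refine IsRed.isReducedAlgebra ⟨⟨hA.isRed.one, fun u v _ => by simp⟩, hmul, ?_, ?_, ?_⟩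
      hB'.equalSizes
    · intro S hS u v huv
      by_cases hs : B.strips.same u v
      · rw [← happ S hs]
        exact hB'.isRed.upper _ (hD S hS) u v huv
      · refine hA.isRed.upper S hS.1 u v ?_
        rw [B.lt_iff]
        exact ⟨(B'.lt_iff.1 huv).1, fun h => hs h.symm⟩
    · intro S hS u v u' v' h1 h2 h3 h4
      rw [← happ S (hsame h1), ← happ S (hsame h2)]
      exact hB'.isRed.diag _ (hD S hS) u v u' v' h1 h2 h3 h4
    · intro D hD'
      have h1 := hB'.isRed.contains D hD'
      have h2 : B.strips.IsDiag D :=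
        ⟨fun u v huv => hD'.1 u v fun h => huv (hsame h), hM.isRed.diag D h1.1⟩
      exact ⟨hA.isRed.contains D h2, (hdiag D h2).1 h1.2⟩

/-! ### Dimensions -/

/-- The block-diagonal matrices whose diagonal blocks at equivalent strips coincide. -/
def Strips.diagSubmodule (Q : Strips P) (k : Type*) [Field k] : Submodule k (Matrix P P k) where
  carrier := {D | Q.IsDiag D}
  add_mem' := by
    rintro D E ⟨h1, h2⟩ ⟨h3, h4⟩
    refine ⟨fun x y h => ?_, fun x y x' y' e1 e2 e3 e4 => ?_⟩
    · rw [Matrix.add_apply, h1 x y h, h3 x y h, add_zero]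
    · rw [Matrix.add_apply, Matrix.add_apply, h2 x y x' y' e1 e2 e3 e4, h4 x y x' y' e1 e2 e3 e4]
  zero_mem' := ⟨fun _ _ _ => rfl, fun _ _ _ _ _ _ _ _ => rfl⟩
  smul_mem' := by
    rintro c D ⟨h1, h2⟩
    refine ⟨fun x y h => ?_, fun x y x' y' e1 e2 e3 e4 => ?_⟩
    · rw [Matrix.smul_apply, h1 x y h, smul_zero]
    · rw [Matrix.smul_apply, Matrix.smul_apply, h2 x y x' y' e1 e2 e3 e4]

theorem BlockStructure.strict_inf_diagSubmodule (B : BlockStructure P) :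
    B.strips.strict k ⊓ B.strips.diagSubmodule k = ⊥ := by
  rw [eq_bot_iff]
  rintro S ⟨h1, h2⟩
  rw [Submodule.mem_bot]
  ext x y
  by_cases h : B.strips.same x y
  · exact h1 x y fun hlt => (ne_of_lt hlt) h
  · exact h2.1 x y h

/-- A reduced algebra is the direct sum of its strict part and all block-diagonal matrices. The
second summand depends on the strips alone, so the dimension of `Λ` determines that of its strict
part. -/
theorem IsRed.finrank_eq (hΛ : IsRed Λ B.strips) :
    Module.finrank k Λ = Module.finrank k (Λ ⊓ B.strips.strict k : Submodule k _) +
      Module.finrank k (B.strips.diagSubmodule k) := by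
  have h1 : Λ ⊓ B.strips.strict k ⊔ B.strips.diagSubmodule k = Λ := by
    refine le_antisymm (sup_le inf_le_left fun D hD => hΛ.contains D hD) fun S hS => ?_
    rw [← sub_add_cancel S (B.strips.diagPart S)]
    exact Submodule.add_mem_sup (hΛ.sub_diagPart_mem hS) (hΛ.isDiag_diagPart hS)
  have h2 : Λ ⊓ B.strips.strict k ⊓ B.strips.diagSubmodule k = ⊥ := by
    rw [inf_assoc, B.strict_inf_diagSubmodule, inf_bot_eq]
  have := Submodule.finrank_sup_add_finrank_inf_eq (Λ ⊓ B.strips.strict k)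
    (B.strips.diagSubmodule k)
  rwa [h1, h2, finrank_bot, add_zero] at this

/-- Outside Case I the whole strict part survives the restriction, and the diagonal part is cut
independently of it. -/
theorem IsRed.finrank_inf_of_not_hasAdd (hΛ : IsRed Λ B.strips) {x y : P}
    (hadd : ¬ B.strips.HasAdd Λ A x y) :
    Module.finrank k (Λ ⊓ commutantOn A (B.strips.block x y) : Submodule k _) =
      Module.finrank k (Λ ⊓ B.strips.strict k : Submodule k _) +
      Module.finrank k (B.strips.diagSubmodule k ⊓ commutantOn A (B.strips.block x y) :
        Submodule k _) := by
  have h1 : Λ ⊓ B.strips.strict k ⊔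
      B.strips.diagSubmodule k ⊓ commutantOn A (B.strips.block x y) =
      Λ ⊓ commutantOn A (B.strips.block x y) := by
    refine le_antisymm (sup_le (le_inf inf_le_left (not_not.1 hadd))
      (inf_le_inf_right _ fun D hD => hΛ.contains D hD)) fun S hS => ?_
    rw [← sub_add_cancel S (B.strips.diagPart S)]
    exact Submodule.add_mem_sup (hΛ.sub_diagPart_mem hS.1) ⟨hΛ.isDiag_diagPart hS.1,
      (hΛ.diagPart_mem_commutantOn_iff hadd hS.1).2 hS.2⟩
  have h2 : Λ ⊓ B.strips.strict k ⊓
      (B.strips.diagSubmodule k ⊓ commutantOn A (B.strips.block x y)) = ⊥ := by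
    rw [eq_bot_iff, ← B.strict_inf_diagSubmodule]
    exact inf_le_inf inf_le_right inf_le_left
  have := Submodule.finrank_sup_add_finrank_inf_eq (Λ ⊓ B.strips.strict k)
    (B.strips.diagSubmodule k ⊓ commutantOn A (B.strips.block x y))
  rwa [h1, h2, finrank_bot, add_zero] at this

theorem BlockStructure.unit_apply_left (B : BlockStructure P) {x u x' z : P}
    (hx : B.strips.same x' x) (hu : B.strips.same u x) :
    B.strips.unit k x u x' z = if x' = x ∧ z = u then 1 else 0 := by
  rw [Strips.unit, Matrix.of_apply]
  congr 1
  rw [eq_iff_iff]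
  constructor
  · rintro ⟨h1, h2, h3⟩
    exact ⟨B.ext_pos hx h2.2.symm, B.ext_pos (h1.symm.trans (hx.trans hu.symm)) h3.2.symm⟩
  · rintro ⟨rfl, rfl⟩
    exact ⟨hu.symm, B.corr_refl _, B.corr_refl _⟩

theorem BlockStructure.unit_apply_right (B : BlockStructure P) {v y w y' : P}
    (hy : B.strips.same y' y) (hv : B.strips.same v y) :
    B.strips.unit k v y w y' = if w = v ∧ y' = y then 1 else 0 := by
  rw [Strips.unit, Matrix.of_apply]
  congr 1
  rw [eq_iff_iff]
  constructor
  · rintro ⟨h1, h2, h3⟩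
    exact ⟨B.ext_pos (h1.trans (hy.trans hv.symm)) h2.2.symm, B.ext_pos hy h3.2.symm⟩
  · rintro ⟨rfl, rfl⟩
    exact ⟨hv, B.corr_refl _, B.corr_refl _⟩

/-- If a block admits a nonzero addition and the diagonal transformations preserve the block,
then an arbitrary matrix can be added to it. -/
theorem IsRed.finrank_inf_of_hasAdd (hΛ : IsRed Λ B.strips) {x₀ y₀ : P}
    (hb : Λ ≤ commutantOn A (B.strips.before x₀ y₀)) (hadd : B.strips.HasAdd Λ A x₀ y₀)
    (hzero : ∀ D, B.strips.IsDiag D → D ∈ commutantOn A (B.strips.block x₀ y₀)) :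
    Module.finrank k (Λ ⊓ commutantOn A (B.strips.block x₀ y₀) : Submodule k _) +
      Fintype.card ({x // x ∈ B.strips.rows x₀} × {y // y ∈ B.strips.rows y₀}) =
      Module.finrank k Λ := by
  let φ : Matrix P P k →ₗ[k] ({x // x ∈ B.strips.rows x₀} × {y // y ∈ B.strips.rows y₀} → k) :=
    { toFun := fun S z => (S * A - A * S) z.1 z.2
      map_add' := by
        intro S T
        funext z
        simp only [add_mul, mul_add, Matrix.sub_apply, Matrix.add_apply, Pi.add_apply]
        ring
      map_smul' := by
        intro c S
        funext z
        simp [mul_sub] }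
  have hker : Λ ⊓ commutantOn A (B.strips.block x₀ y₀) =
      (LinearMap.ker (φ.comp Λ.subtype)).map Λ.subtype := by
    ext S
    constructor
    · rintro ⟨h1, h2⟩
      refine ⟨⟨S, h1⟩, ?_, rfl⟩
      rw [SetLike.mem_coe, LinearMap.mem_ker]
      funext z
      exact h2 _ _ ⟨Strips.mem_rows.1 z.1.2, Strips.mem_rows.1 z.2.2⟩
    · rintro ⟨⟨S, h1⟩, h2, rfl⟩
      rw [SetLike.mem_coe, LinearMap.mem_ker] at h2
      refine ⟨h1, fun u v huv => ?_⟩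
      exact congrFun h2 (⟨u, Strips.mem_rows.2 huv.1⟩, ⟨v, Strips.mem_rows.2 huv.2⟩)
  -- Some strict `T` has a commutator with a nonzero entry at a place `(u, v)` of the block.
  -- Multiplying `T` by repeated matrix units moves this entry to any place of the block, so the
  -- commutators fill the block and the dimension drops by its number of entries.
  have hrange : LinearMap.range (φ.comp Λ.subtype) = ⊤ := by
    obtain ⟨T, hT, hTc⟩ := SetLike.not_le_iff_exists.1 hadd
    simp only [mem_commutantOn, not_forall] at hTc
    obtain ⟨u, v, ⟨hu, hv⟩, hne⟩ := hTc
    rw [eq_top_iff, ← (Pi.basisFun k _).span_eq, Submodule.span_le]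
    rintro _ ⟨⟨⟨x, hx⟩, ⟨y, hy⟩⟩, rfl⟩
    rw [Strips.mem_rows] at hx hy
    have hlow := B.isLower_upTo x₀ y₀
    have hE := B.isDiag_unit (k := k) x u
    have hF := B.isDiag_unit (k := k) v y
    set E := B.strips.unit k x u
    set F := B.strips.unit k v y
    have hEΛ := hΛ.contains E hE
    have hFΛ := hΛ.contains F hF
    have hS : E * T * F ∈ Λ := hΛ.mul _ (hΛ.mul _ hEΛ _ hT.1) _ hFΛ
    have hcomm : ∀ x' y', B.strips.block x₀ y₀ x' y' →
        (E * T * F * A - A * (E * T * F)) x' y' =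
        if x' = x ∧ y' = y then (T * A - A * T) u v else 0 := by
      intro x' y' hxy
      -- The Leibniz rule. The commutators of `E` and `F` with `A` vanish up to the block, so on the
      -- block only the first term counts.
      have e1 : E * T * F * A - A * (E * T * F) = E * (T * A - A * T) * F +
          E * T * (F * A - A * F) + (E * A - A * E) * (T * F) := by
        simp only [mul_sub, sub_mul, mul_assoc]
        abel
      have e2 := hlow.mul_left (hΛ.upper _ (hΛ.mul _ hEΛ _ hT.1))
        (mem_commutantOn_upTo.2 ⟨hb hFΛ, hzero F hF⟩) x' y' (Or.inr hxy)
      have e3 := hlow.mul_right (hΛ.upper _ (hΛ.mul _ hT.1 _ hFΛ))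
        (mem_commutantOn_upTo.2 ⟨hb hEΛ, hzero E hE⟩) x' y' (Or.inr hxy)
      rw [e1, Matrix.add_apply, Matrix.add_apply, e2, e3, add_zero, add_zero, Matrix.mul_apply]
      have hF' : ∀ w, F w y' = if w = v ∧ y' = y then 1 else 0 := fun w =>
        B.unit_apply_right (Eq.trans hxy.2 hy.symm) (Eq.trans hv hy.symm)
      have hE' : ∀ z, E x' z = if x' = x ∧ z = u then 1 else 0 := fun z =>
        B.unit_apply_left (Eq.trans hxy.1 hx.symm) (Eq.trans hu hx.symm)
      simp only [Matrix.mul_apply (M := E), hF', hE']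
      by_cases h1 : x' = x
      · by_cases h2 : y' = y
        · simp [h1, h2]
        · simp [h2]
      · simp [h1]
    refine ⟨⟨((T * A - A * T) u v)⁻¹ • (E * T * F), Λ.smul_mem _ hS⟩, ?_⟩
    rw [LinearMap.comp_apply, Submodule.subtype_apply, map_smul]
    funext ⟨⟨x', hx'⟩, ⟨y', hy'⟩⟩
    rw [Strips.mem_rows] at hx' hy'
    change _ * (E * T * F * A - A * (E * T * F)) x' y' = _
    rw [hcomm x' y' ⟨hx', hy'⟩, Pi.basisFun_apply, Pi.single_apply]
    by_cases h1 : x' = x ∧ y' = y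
    · obtain ⟨rfl, rfl⟩ := h1
      rw [if_pos ⟨rfl, rfl⟩, if_pos rfl, inv_mul_cancel₀ hne]
    · rw [if_neg h1, if_neg, mul_zero]
      intro h
      simp only [Prod.mk.injEq, Subtype.mk.injEq] at h
      exact h1 h
  have h1 := LinearMap.finrank_range_add_finrank_ker (φ.comp Λ.subtype)
  rw [hrange, finrank_top, Module.finrank_fintype_fun_eq_card] at h1
  rw [hker, Submodule.finrank_map_subtype_eq, add_comm, h1]

end Comparison

/-! ### The run on `M(a)` against the run on `M` -/

section Induction

variable {P : Type*} [LinearOrder P] [Fintype P] {k : Type*} [Field k] [LinearOrder k]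

/-- The free boxes of `A` have the same form as those of `M`: they coincide except that
Weyr boxes may have other eigenvalues. -/
structure SameForm (free : P → P → Prop) (boxes : Set (Box P)) (M A : Matrix P P k) : Prop where
  eq_of_ne_weyr : ∀ b ∈ boxes, (∀ x ∈ b.rows, ∀ y ∈ b.cols, free x y) → b.kind ≠ .weyr →
    ∀ x ∈ b.rows, ∀ y ∈ b.cols, A x y = M x y
  isWeyr : ∀ b ∈ boxes, (∀ x ∈ b.rows, ∀ y ∈ b.cols, free x y) → b.kind = .weyr →
    IsWeyr (squarePart A b.rows b.cols)
  commute_iff : ∀ b ∈ boxes, (∀ x ∈ b.rows, ∀ y ∈ b.cols, free x y) → b.kind = .weyr →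
    ∀ X : Matrix (Fin b.rows.card) (Fin b.rows.card) k,
      X * squarePart M b.rows b.cols = squarePart M b.rows b.cols * X ↔
        X * squarePart A b.rows b.cols = squarePart A b.rows b.cols * X

variable {Λ Λ' : Submodule k (Matrix P P k)} {B : BlockStructure P} {A M : Matrix P P k}
  {free : P → P → Prop} {boxes old : Set (Box P)}

theorem free_of_block {x y : P} (hfree : ∀ u v, B.strips.block x y u v → free u v) :
    ∀ u ∈ B.strips.rows x, ∀ v ∈ B.strips.rows y, free u v :=
  fun u hu v hv => hfree u v ⟨Strips.mem_rows.1 hu, Strips.mem_rows.1 hv⟩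

/-- On a Weyr box, preservation by `D` is a centralizer condition, the same for both matrices; on
any other free box the two matrices have the same entries. -/
theorem SameForm.diag_iff (h : SameForm free boxes M A) (hsz : B.EqualSizes) {x y : P}
    {κ : BoxKind} (hb : ⟨B.strips.rows x, B.strips.rows y, κ⟩ ∈ boxes)
    (hfree : ∀ u v, B.strips.block x y u v → free u v)
    (hκ : κ = .weyr → B.strips.eqv x y) {D : Matrix P P k} (hD : B.strips.IsDiag D) :
    D ∈ commutantOn M (B.strips.block x y) ↔ D ∈ commutantOn A (B.strips.block x y) := by
  have hf := free_of_block hfree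
  by_cases hw : κ = .weyr
  · have he := hsz.eqv_iff.1 (hκ hw)
    rw [B.mem_commutantOn_block_iff he (hsz _ _ he) hD,
      B.mem_commutantOn_block_iff he (hsz _ _ he) hD]
    have := h.commute_iff _ hb hf hw
    rw [B.rows_strips, B.rows_strips] at this
    exact this _
  · have := h.eq_of_ne_weyr _ hb hf hw
    have hMA : ∀ u v, B.strips.block x y u v → A u v = M u v :=
      fun u v huv => this u (Strips.mem_rows.2 huv.1) v (Strips.mem_rows.2 huv.2)
    exact ⟨hD.mul_apply_congr fun u v huv => (hMA u v huv).symm, hD.mul_apply_congr hMA⟩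

/-- The transformations from `Λ` preserve the old boxes. -/
def PreservesBoxes (Λ : Submodule k (Matrix P P k)) (A : Matrix P P k) (old : Set (Box P)) :
    Prop :=
  ∀ o ∈ old, Λ ≤ commutantOn A fun x y => x ∈ o.rows ∧ y ∈ o.cols

/-- Ensures that a nonstable block is not inside an old box, hence becomes a box with its type
recorded. -/
theorem PreservesBoxes.not_contained (h : PreservesBoxes Λ A old) {x y : P}
    (hb : ¬ Λ ≤ commutantOn A (B.strips.block x y)) :
    ¬ ∃ o ∈ old, B.strips.rows x ⊆ o.rows ∧ B.strips.rows y ⊆ o.cols := by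
  rintro ⟨o, ho, h1, h2⟩
  exact hb ((h o ho).trans (commutantOn_mono fun u v huv =>
    ⟨h1 (Strips.mem_rows.2 huv.1), h2 (Strips.mem_rows.2 huv.2)⟩))

theorem PreservesBoxes.next (h : PreservesBoxes Λ A old) {x y : P}
    (hb : Λ ≤ commutantOn A (B.strips.before x y)) :
    PreservesBoxes (Λ ⊓ commutantOn A (B.strips.block x y)) A
      (old ∪ B.strips.newBoxes Λ' M old (B.strips.upTo x y)) := by
  rintro o (ho | ⟨u, v, huv, -, rfl⟩)
  · exact inf_le_left.trans (h o ho)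
  · intro S hS u' v' huv'
    have hb' : B.strips.block u v u' v' :=
      ⟨Strips.mem_rows.1 huv'.1, Strips.mem_rows.1 huv'.2⟩
    rcases huv with huv | huv
    · exact hb hS.1 u' v' (B.block_of_before huv hb')
    · rw [← B.strips_block_eq huv.1.symm huv.2.symm] at hb'
      exact hS.2 u' v' hb'

theorem Strips.mem_newBoxes {Q : Strips P} {q : P → P → Prop} {x y : P}
    (ho : ¬ ∃ o ∈ old, Q.rows x ⊆ o.rows ∧ Q.rows y ⊆ o.cols) (hq : q x y) :
    ⟨Q.rows x, Q.rows y, Q.kind Λ A x y⟩ ∈ old ∪ Q.newBoxes Λ A old q :=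
  Or.inr ⟨x, y, hq, ho, rfl⟩

theorem DisjointBoxes.kind_eq (h : DisjointBoxes boxes) {x y : P} {κ κ' : BoxKind}
    (hb : ⟨B.strips.rows x, B.strips.rows y, κ⟩ ∈ boxes)
    (hb' : ⟨B.strips.rows x, B.strips.rows y, κ'⟩ ∈ boxes) : κ = κ' := by
  have := h _ hb _ hb' x y (B.mem_strips_rows x) (B.mem_strips_rows y) (B.mem_strips_rows x)
    (B.mem_strips_rows y)
  injection this

/-- A block cannot be nonstable for one of two canonical matrices of the same form and stable
for the other. -/
theorem stable_of_stable (hΛ : IsReducedAlgebra Λ B) (hΛ' : IsReducedAlgebra Λ' B)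
    (hdisj : DisjointBoxes boxes) {x y : P}
    (hb : ⟨B.strips.rows x, B.strips.rows y, B.strips.kind Λ M x y⟩ ∈ boxes)
    (hb' : ⟨B.strips.rows x, B.strips.rows y, B.strips.kind Λ' A x y⟩ ∈ boxes)
    (hdiag : ∀ D, B.strips.IsDiag D →
      (D ∈ commutantOn M (B.strips.block x y) ↔ D ∈ commutantOn A (B.strips.block x y)))
    (hst : Λ' ≤ commutantOn A (B.strips.block x y)) :
    Λ ≤ commutantOn M (B.strips.block x y) := by
  -- Disjoint boxes with the same rows and columns have the same type. A stable block is not of type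
  -- `∅`, so Case I fails for `M` too, and then only diagonal transformations matter, which act
  -- alike on both matrices.
  have hk := hdisj.kind_eq hb hb'
  have hadd : ¬ B.strips.HasAdd Λ M x y := by
    rw [← Strips.kind_eq_empty_iff, hk, Strips.kind_eq_empty_iff]
    exact not_hasAdd_of_le hst
  intro S hS
  have hD := hΛ.isRed.isDiag_diagPart hS
  exact (hΛ.isRed.diagPart_mem_commutantOn_iff hadd hS).1
    ((hdiag _ hD).2 (hst (hΛ'.isRed.contains _ hD)))

theorem CRun.cases {Q : Strips P} (h : CRun A Λ Q old boxes) :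
    (Λ ≤ commutantOn A (fun _ _ => True) ∧
      boxes = old ∪ Q.newBoxes Λ A old fun _ _ => True) ∨
    ∃ (x₀ y₀ : P) (B' : BlockStructure P), Λ ≤ commutantOn A (Q.before x₀ y₀) ∧
      ¬ Λ ≤ commutantOn A (Q.block x₀ y₀) ∧
      IsReducedPart A (Q.rows x₀) (Q.rows y₀) (Q.kind Λ A x₀ y₀) ∧
      IsReducedAlgebra (Λ ⊓ commutantOn A (Q.block x₀ y₀)) B' ∧
      CRun A (Λ ⊓ commutantOn A (Q.block x₀ y₀)) B'.strips
        (old ∪ Q.newBoxes Λ A old (Q.upTo x₀ y₀)) boxes := by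
  cases h with
  | finish _ _ _ h => exact Or.inl ⟨h, rfl⟩
  | step _ _ _ x₀ y₀ B' _ h1 h2 h3 h4 h5 => exact Or.inr ⟨x₀, y₀, B', h1, h2, h3, h4, h5⟩

theorem CRun.subset {Q : Strips P} (h : CRun A Λ Q old boxes) (hB : IsReducedAlgebra Λ B)
    (hQ : Q = B.strips) : old ⊆ boxes := (h.boxes_properties B hB hQ).1

/-- Nonstable blocks of `A` are free. -/
def NonstableFree (Λ₀ : Submodule k (Matrix P P k)) (free : P → P → Prop) (A : Matrix P P k) :
    Prop :=
  ∀ (Λ : Submodule k (Matrix P P k)) (B : BlockStructure P), IsReducedAlgebra Λ B → Λ ≤ Λ₀ →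
    ∀ x₀ y₀, Λ ≤ commutantOn A (B.strips.before x₀ y₀) →
      ¬ Λ ≤ commutantOn A (B.strips.block x₀ y₀) →
      ∀ x y, B.strips.block x₀ y₀ x y → free x y

theorem hasAdd_isReducedPart_diag {x y : P} (hadd : B.strips.HasAdd Λ M x y)
    (hM : IsReducedPart M (B.strips.rows x) (B.strips.rows y) (B.strips.kind Λ M x y)) :
    ∀ D, B.strips.IsDiag D → D ∈ commutantOn M (B.strips.block x y) := by
  rw [Strips.kind_eq_empty_iff.2 hadd] at hM
  intro D hD
  refine hD.mul_apply_congr (A := 0) (fun u v huv => ?_) fun u v _ => by simp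
  exact (hM u (Strips.mem_rows.2 huv.1) v (Strips.mem_rows.2 huv.2)).symm

/-- A run on `A` follows the step of the run on `M` if the preceding blocks of `A` are stable and
the block has the same type. -/
theorem CRun.step_of_sameForm {Λ₀ : Submodule k (Matrix P P k)} {B' : BlockStructure P}
    (hform : SameForm free boxes M A) (hfree : NonstableFree Λ₀ free M)
    (hΛ : IsReducedAlgebra Λ B) (hΛ' : IsReducedAlgebra Λ' B) (hle : Λ ≤ Λ₀) {x y : P}
    (hbefore : Λ ≤ commutantOn M (B.strips.before x y))
    (hblock : ¬ Λ ≤ commutantOn M (B.strips.block x y))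
    (hM : IsReducedPart M (B.strips.rows x) (B.strips.rows y) (B.strips.kind Λ M x y))
    (hmem : ⟨B.strips.rows x, B.strips.rows y, B.strips.kind Λ M x y⟩ ∈ boxes)
    (hbefore' : Λ' ≤ commutantOn A (B.strips.before x y))
    (hadd : B.strips.HasAdd Λ' A x y ↔ B.strips.HasAdd Λ M x y)
    (hB' : IsReducedAlgebra (Λ' ⊓ commutantOn A (B.strips.block x y)) B')
    (hrun : CRun A (Λ' ⊓ commutantOn A (B.strips.block x y)) B'.strips
      (old ∪ B.strips.newBoxes Λ M old (B.strips.upTo x y)) boxes) :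
    CRun A Λ' B.strips old boxes := by
  have hf := hfree Λ B hΛ hle x y hbefore hblock
  have hk : B.strips.kind Λ' A x y = B.strips.kind Λ M x y := Strips.kind_congr_of_hasAdd hadd
  have hdiag : ∀ D, B.strips.IsDiag D →
      (D ∈ commutantOn M (B.strips.block x y) ↔ D ∈ commutantOn A (B.strips.block x y)) :=
    fun D hD => hform.diag_iff hΛ.equalSizes hmem hf
      (fun h => (Strips.kind_eq_weyr_iff.1 h).2) hD
  refine CRun.step Λ' B.strips old x y B' boxes hbefore' ?_ ?_ hB' ?_
  · intro hst
    have hadd' : ¬ B.strips.HasAdd Λ M x y := fun h => not_hasAdd_of_le hst (hadd.2 h)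
    refine hblock fun S hS => (hΛ.isRed.diagPart_mem_commutantOn_iff hadd' hS).1 ?_
    have hD := hΛ.isRed.isDiag_diagPart hS
    exact (hdiag _ hD).2 (hst (hΛ'.isRed.contains _ hD))
  · rw [hk]
    by_cases hw : B.strips.kind Λ M x y = .weyr
    · have := hform.isWeyr _ hmem (free_of_block hf) hw
      rw [hw]
      exact this
    · exact hM.congr fun u hu v hv =>
        (hform.eq_of_ne_weyr _ hmem (free_of_block hf) hw u hu v hv).symm
  · rwa [Strips.newBoxes_congr (Λ' := Λ) (A' := M)]
    rintro u v (huv | huv)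
    · refine Strips.kind_congr_of_hasAdd (iff_of_false ?_ ?_)
      · exact not_hasAdd_of_le (hbefore'.trans
          (commutantOn_mono fun u' v' h => B.block_of_before huv h))
      · exact not_hasAdd_of_le (hbefore.trans
          (commutantOn_mono fun u' v' h => B.block_of_before huv h))
    · rw [hΛ.equalSizes.kind_congr Λ' A huv.1 huv.2, hΛ.equalSizes.kind_congr Λ M huv.1 huv.2, hk]

/-- If the algorithm divides `A` into the same boxes as `M`, then its run on `A` follows the step
of its run on `M`. -/
theorem CRun.forced_step {Λ₀ : Submodule k (Matrix P P k)} {B' : BlockStructure P}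
    (hdisj : DisjointBoxes boxes)
    (hform : SameForm free boxes M A) (hfree : NonstableFree Λ₀ free M)
    (hfree' : NonstableFree Λ₀ free A)
    (hΛ : IsReducedAlgebra Λ B) (hΛ' : IsReducedAlgebra Λ' B) (hle : Λ ≤ Λ₀) (hle' : Λ' ≤ Λ₀)
    (hold : PreservesBoxes Λ M old) (hold' : PreservesBoxes Λ' A old) {x y : P}
    (hbefore : Λ ≤ commutantOn M (B.strips.before x y))
    (hblock : ¬ Λ ≤ commutantOn M (B.strips.block x y))
    (hM : IsReducedPart M (B.strips.rows x) (B.strips.rows y) (B.strips.kind Λ M x y))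
    (hB' : IsReducedAlgebra (Λ ⊓ commutantOn M (B.strips.block x y)) B')
    (hsub : old ∪ B.strips.newBoxes Λ M old (B.strips.upTo x y) ⊆ boxes)
    (hrun : CRun A Λ' B.strips old boxes) :
    Λ' ≤ commutantOn A (B.strips.before x y) ∧
      (B.strips.HasAdd Λ' A x y ↔ B.strips.HasAdd Λ M x y) ∧
      CRun A (Λ' ⊓ commutantOn A (B.strips.block x y)) B'.strips
        (old ∪ B.strips.newBoxes Λ M old (B.strips.upTo x y)) boxes := by
  have hf := hfree Λ B hΛ hle x y hbefore hblock
  have hnot := hold.not_contained hblock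
  have hmem := hsub (Strips.mem_newBoxes hnot (Or.inr ⟨rfl, rfl⟩))
  have hdiag : ∀ D, B.strips.IsDiag D →
      (D ∈ commutantOn M (B.strips.block x y) ↔ D ∈ commutantOn A (B.strips.block x y)) :=
    fun D hD => hform.diag_iff hΛ.equalSizes hmem hf
      (fun h => (Strips.kind_eq_weyr_iff.1 h).2) hD
  rcases hrun.cases with ⟨hst, rfl⟩ | ⟨x₁, y₁, B₁, hbefore₁, hblock₁, hA₁, hB₁, hrun₁⟩
  · exact (hblock (stable_of_stable hΛ hΛ' hdisj hmem (Strips.mem_newBoxes hnot trivial) hdiag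
      (hst.trans (commutantOn_mono fun _ _ _ => trivial)))).elim
  have hsub₁ := hrun₁.subset hB₁ rfl
  have hnot₁ := hold'.not_contained hblock₁
  have hmem₁ := hsub₁ (Strips.mem_newBoxes hnot₁ (Or.inr ⟨rfl, rfl⟩))
  -- If the first nonstable blocks of `A` and `M` differed, the earlier one would be nonstable for
  -- one matrix and stable for the other, though it is a box of one type in both; `stable_of_stable`
  -- excludes this.
  rcases B.before_trichotomy x y x₁ y₁ with hlt | ⟨hx, hy⟩ | hlt
  · have hmem' := hsub (Strips.mem_newBoxes hnot₁ (Or.inl hlt))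
    have hf₁ := hfree' Λ' B hΛ' hle' x₁ y₁ hbefore₁ hblock₁
    refine (hblock₁ (stable_of_stable hΛ' hΛ hdisj hmem₁ hmem' (fun D hD => ?_)
      (hbefore.trans (commutantOn_mono fun u v h => B.block_of_before hlt h)))).elim
    exact (hform.diag_iff hΛ.equalSizes hmem₁ hf₁ (fun h => (Strips.kind_eq_weyr_iff.1 h).2)
      hD).symm
  · have hkind : B.strips.kind Λ' A x y = B.strips.kind Λ M x y := by
      rw [B.rows_eq_of_same hx, B.rows_eq_of_same hy, hΛ.equalSizes.kind_congr Λ' A hx hy]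
        at hmem₁
      exact hdisj.kind_eq hmem₁ hmem
    have hadd : B.strips.HasAdd Λ' A x y ↔ B.strips.HasAdd Λ M x y := by
      rw [← Strips.kind_eq_empty_iff, ← Strips.kind_eq_empty_iff, hkind]
    have hbl := B.strips_block_eq hx hy
    have hbe := B.strips_before_eq hx hy
    have hup : B.strips.upTo x₁ y₁ = B.strips.upTo x y := by
      funext u v
      simp only [Strips.upTo, hbl, hbe]
    rw [hbe] at hbefore₁
    rw [hbl] at hB₁ hrun₁
    rw [hup] at hrun₁
    have hnext := isReducedAlgebra_next hΛ hΛ' hbefore hbefore₁ hdiag hadd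
      (fun h => hasAdd_isReducedPart_diag h hM) hB'
    refine ⟨hbefore₁, hadd, ?_⟩
    rw [hnext.isRed.strips_eq hB₁.isRed]
    rwa [Strips.newBoxes_congr (Λ' := Λ') (A' := A)]
    rintro u v (huv | huv)
    · refine Strips.kind_congr_of_hasAdd (iff_of_false ?_ ?_)
      · exact not_hasAdd_of_le (hbefore.trans
          (commutantOn_mono fun u' v' h => B.block_of_before huv h))
      · exact not_hasAdd_of_le (hbefore₁.trans
          (commutantOn_mono fun u' v' h => B.block_of_before huv h))
    · rw [hΛ.equalSizes.kind_congr Λ' A huv.1 huv.2, hΛ.equalSizes.kind_congr Λ M huv.1 huv.2,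
        hkind]
  · have hmem' := hsub₁ (Strips.mem_newBoxes hnot (Or.inl hlt))
    exact (hblock (stable_of_stable hΛ hΛ' hdisj hmem hmem' hdiag
      (hbefore₁.trans (commutantOn_mono fun u v h => B.block_of_before hlt h)))).elim

variable {p : ℕ}

/-- When the dimension of `R` is known, the inclusion becomes a lower bound for the dimension of an
intersection, which is a rank condition. -/
theorem le_iff_finrank_le (R S : Submodule k (Matrix P P k)) :
    R ≤ S ↔ Module.finrank k R ≤ Module.finrank k (R ⊓ S : Submodule k _) := by
  constructor
  · intro h
    rw [inf_eq_left.2 h]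
  · intro h
    rw [← inf_eq_left]
    exact Submodule.eq_of_le_of_finrank_le inf_le_left h

theorem inf_commutantOn_or (Λ₀ : Submodule k (Matrix P P k)) (A : Matrix P P k)
    (U W : P → P → Prop) :
    Λ₀ ⊓ commutantOn A (fun x y => U x y ∨ W x y) = Λ₀ ⊓ commutantOn A U ⊓ commutantOn A W := by
  ext S
  simp only [Submodule.mem_inf, mem_commutantOn, or_imp, forall_and, and_assoc]

/-- The conditions that the preceding blocks are stable and that the block has the given type. -/
theorem polyDefinable_step (Λ₀ : Submodule k (Matrix P P k))
    (F : P → P → MvPolynomial (Fin p) k) (U : P → P → Prop) (B : BlockStructure P) (x y : P)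
    (d : ℕ) (hasAdd : Prop) :
    ∃ K : Set (Fin p → k), PolyDefinable K ∧ ∀ a (A : Matrix P P k),
      A = Matrix.of (fun x y => MvPolynomial.eval a (F x y)) →
      IsReducedAlgebra (Λ₀ ⊓ commutantOn A U) B →
      Module.finrank k (Λ₀ ⊓ commutantOn A U : Submodule k _) = d →
      (a ∈ K ↔ Λ₀ ⊓ commutantOn A U ≤ commutantOn A (B.strips.before x y) ∧
        (B.strips.HasAdd (Λ₀ ⊓ commutantOn A U) A x y ↔ hasAdd)) := by
  have hfam := (isPolyFamily_const (p := p) Λ₀).inf (isPolyFamily_commutantOn F U)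
  have h1 := (hfam.inf (isPolyFamily_commutantOn F (B.strips.before x y))).polyDefinable_le_finrank
    d
  have hfam' := (hfam.inf (isPolyFamily_const (B.strips.strict k))).inf
    (isPolyFamily_commutantOn F (B.strips.block x y))
  -- The dimension of the strict part of an algebra of dimension `d` that is reduced for `B`.
  set e := d - Module.finrank k (B.strips.diagSubmodule k)
  have key : ∀ A : Matrix P P k, IsReducedAlgebra (Λ₀ ⊓ commutantOn A U) B →
      Module.finrank k (Λ₀ ⊓ commutantOn A U : Submodule k _) = d →
      (¬ B.strips.HasAdd (Λ₀ ⊓ commutantOn A U) A x y ↔ e ≤ Module.finrank k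
        (Λ₀ ⊓ commutantOn A U ⊓ B.strips.strict k ⊓ commutantOn A (B.strips.block x y) :
          Submodule k _)) := by
    intro A hA hd
    rw [Strips.HasAdd, not_not, le_iff_finrank_le]
    have := hA.isRed.finrank_eq
    rw [show Module.finrank k (Λ₀ ⊓ commutantOn A U ⊓ B.strips.strict k : Submodule k _) = e by
      omega]
  -- An addition exists when commutation on the block cuts the strict part to dimension less than
  -- `e`, a nonvanishing condition; its absence is given by equations.
  by_cases hh : hasAdd
  · refine ⟨_, h1.inter (hfam'.polyDefinable_finrank_lt e), ?_⟩
    rintro a A rfl hA hd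
    have hk := not_congr (key _ hA hd)
    rw [not_not, not_le] at hk
    rw [le_iff_finrank_le, hd, iff_true_right hh]
    exact and_congr_right fun _ => hk.symm
  · refine ⟨_, h1.inter (hfam'.polyDefinable_le_finrank e), ?_⟩
    rintro a A rfl hA hd
    rw [le_iff_finrank_le, hd, iff_false_right hh, key _ hA hd]
    rfl

/-- The matrices of a polynomial family that have the same form as a canonical matrix `M` and on
which the algorithm runs as on `M` are given by polynomial conditions. -/
theorem CRun.exists_polyDefinable {Λ₀ : Submodule k (Matrix P P k)}
    {F : P → P → MvPolynomial (Fin p) k} {N : (Fin p → k) → Matrix P P k}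
    (hN : ∀ a, N a = Matrix.of (fun x y => MvPolynomial.eval a (F x y)))
    {adm : Set (Fin p → k)} (hdisj : DisjointBoxes boxes)
    (hform : ∀ a ∈ adm, SameForm free boxes M (N a))
    (hfree : NonstableFree Λ₀ free M) (hfree' : ∀ a ∈ adm, NonstableFree Λ₀ free (N a))
    {Q : Strips P} (hrun : CRun M Λ Q old boxes) :
    ∀ B : BlockStructure P, IsReducedAlgebra Λ B → Q = B.strips → Λ ≤ Λ₀ →
      PreservesBoxes Λ M old → ∀ (U : P → P → Prop) (K : Set (Fin p → k)) (d : ℕ),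
      (∀ a ∈ adm, a ∈ K → IsReducedAlgebra (Λ₀ ⊓ commutantOn (N a) U) B ∧
        Module.finrank k (Λ₀ ⊓ commutantOn (N a) U : Submodule k _) = d ∧
        PreservesBoxes (Λ₀ ⊓ commutantOn (N a) U) (N a) old) →
      ∃ K' : Set (Fin p → k), PolyDefinable K' ∧ ∀ a ∈ adm, a ∈ K →
        (CRun (N a) (Λ₀ ⊓ commutantOn (N a) U) B.strips old boxes ↔ a ∈ K') := by
  induction hrun with
  | finish Λ Q old hst =>
    rintro B hB rfl hle hold U K d hK
    have hfam := ((isPolyFamily_const (p := p) Λ₀).inf (isPolyFamily_commutantOn F U)).inf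
      (isPolyFamily_commutantOn F fun _ _ => True)
    simp only [← hN] at hfam
    refine ⟨_, hfam.polyDefinable_le_finrank d, fun a ha haK => ?_⟩
    obtain ⟨hB', hd, hold'⟩ := hK a ha haK
    rw [Set.mem_ofPred_eq, ← hd, ← le_iff_finrank_le]
    constructor
    · intro h
      -- A further step on `N a` would have a first nonstable block, which is stable for `M` and is
      -- a box of the same type in both.
      rcases h.cases with ⟨h', -⟩ | ⟨x₁, y₁, B₁, hbefore₁, hblock₁, hA₁, hB₁, hrun₁⟩
      · exact h'
      have hnot₁ := hold'.not_contained hblock₁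
      have hmem₁ := hrun₁.subset hB₁ rfl (Strips.mem_newBoxes hnot₁ (Or.inr ⟨rfl, rfl⟩))
      have hf₁ := hfree' a ha _ B hB' inf_le_left x₁ y₁ hbefore₁ hblock₁
      refine (hblock₁ (stable_of_stable hB' hB hdisj hmem₁
        (Strips.mem_newBoxes hnot₁ trivial) (fun D hD => ?_)
        (hst.trans (commutantOn_mono fun _ _ _ => trivial)))).elim
      exact ((hform a ha).diag_iff hB.equalSizes hmem₁ hf₁
        (fun h => (Strips.kind_eq_weyr_iff.1 h).2) hD).symm
    · intro h
      have := CRun.finish _ B.strips old h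
      rwa [Strips.newBoxes_congr (Λ' := Λ) (A' := M)] at this
      intro x y _
      exact Strips.kind_congr_of_hasAdd (iff_of_false
        (not_hasAdd_of_le (h.trans (commutantOn_mono fun _ _ _ => trivial)))
        (not_hasAdd_of_le (hst.trans (commutantOn_mono fun _ _ _ => trivial))))
  | step Λ Q old x y B' boxes hbefore hblock hM hB' hrun ih =>
    rintro B hB rfl hle hold U K d hK
    have hsub := hrun.subset hB' rfl
    have hf := hfree Λ B hB hle x y hbefore hblock
    have hmem := hsub (Strips.mem_newBoxes (hold.not_contained hblock) (Or.inr ⟨rfl, rfl⟩))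
    have hdiag : ∀ a ∈ adm, ∀ D, B.strips.IsDiag D → (D ∈ commutantOn M (B.strips.block x y) ↔
        D ∈ commutantOn (N a) (B.strips.block x y)) := fun a ha D hD =>
      (hform a ha).diag_iff hB.equalSizes hmem hf (fun h => (Strips.kind_eq_weyr_iff.1 h).2) hD
    obtain ⟨K₁, hK₁, hstep⟩ := polyDefinable_step Λ₀ F U B x y d (B.strips.HasAdd Λ M x y)
    -- The set `U` collects the blocks already treated and `K` the conditions already imposed. The
    -- dimension of the next algebra does not depend on `a`: in Case I it drops by the number of
    -- entries of the block; otherwise the strict part is kept and the diagonal part is the one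
    -- found for `M`.
    obtain ⟨K₂, hK₂, hnext⟩ := ih hdisj hform B' hB' rfl (inf_le_left.trans hle)
      (hold.next hbefore) (fun u v => U u v ∨ B.strips.block x y u v) (K ∩ K₁)
      (if B.strips.HasAdd Λ M x y then
        d - Fintype.card ({u // u ∈ B.strips.rows x} × {v // v ∈ B.strips.rows y})
      else d - Module.finrank k (B.strips.diagSubmodule k) + Module.finrank k
        (B.strips.diagSubmodule k ⊓ commutantOn M (B.strips.block x y) : Submodule k _))
      (by
        rintro a ha ⟨haK, haK₁⟩
        obtain ⟨hB'', hd, hold'⟩ := hK a ha haK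
        obtain ⟨hbefore', hadd⟩ := (hstep a (N a) (hN a) hB'' hd).1 haK₁
        rw [inf_commutantOn_or]
        have hz := fun h => hasAdd_isReducedPart_diag (B := B) h hM
        refine ⟨isReducedAlgebra_next hB hB'' hbefore hbefore' (hdiag a ha) hadd hz hB', ?_,
          hold'.next hbefore'⟩
        split_ifs with h
        · have := hB''.isRed.finrank_inf_of_hasAdd hbefore' (hadd.2 h)
            fun D hD => (hdiag a ha D hD).1 (hz h D hD)
          omega
        · rw [hB''.isRed.finrank_inf_of_not_hasAdd fun h' => h (hadd.1 h')]
          have h1 := hB''.isRed.finrank_eq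
          have h2 : B.strips.diagSubmodule k ⊓ commutantOn (N a) (B.strips.block x y) =
              B.strips.diagSubmodule k ⊓ commutantOn M (B.strips.block x y) := by
            ext D
            exact and_congr_right fun hD => (hdiag a ha D hD).symm
          rw [h2]
          omega)
    refine ⟨K₁ ∩ K₂, hK₁.inter hK₂, fun a ha haK => ?_⟩
    obtain ⟨hB'', hd, hold'⟩ := hK a ha haK
    have hstep' := hstep a (N a) (hN a) hB'' hd
    constructor
    · intro h
      obtain ⟨h1, h2, h3⟩ := h.forced_step hdisj (hform a ha) hfree (hfree' a ha) hB hB'' hle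
        inf_le_left hold hold' hbefore hblock hM hB' hsub
      have haK₁ := hstep'.2 ⟨h1, h2⟩
      rw [← inf_commutantOn_or] at h3
      exact ⟨haK₁, (hnext a ha ⟨haK, haK₁⟩).1 h3⟩
    · rintro ⟨haK₁, haK₂⟩
      obtain ⟨h1, h2⟩ := hstep'.1 haK₁
      have h3 := (hnext a ha ⟨haK, haK₁⟩).2 haK₂
      rw [inf_commutantOn_or] at h3
      exact CRun.step_of_sameForm (hform a ha) hfree hB hB'' hle hbefore hblock hM hmem h1 h2
        (isReducedAlgebra_next hB hB'' hbefore h1 (hdiag a ha) h2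
          (fun h => hasAdd_isReducedPart_diag h hM) hB') h3

end Induction

/-! ### Parameters and the Weyr boxes of `M(a)` -/

section Parameters

theorem hasEigenvalue_iff_of_upper {k : Type*} [Field k] {m : ℕ} {W : Matrix (Fin m) (Fin m) k}
    (hup : ∀ x y, y < x → W x y = 0) (μ : k) :
    Module.End.HasEigenvalue (Matrix.toLin' W) μ ↔ ∃ x, W x x = μ := by
  have h : W.IsUpperTriangular := fun x y hxy => hup x y hxy
  rw [Module.End.hasEigenvalue_iff_isRoot_charpoly, Matrix.charpoly_toLin',
    Matrix.charpoly_of_isUpperTriangular _ h, Polynomial.IsRoot.def, Polynomial.eval_prod,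
    Finset.prod_eq_zero_iff]
  simp only [Finset.mem_univ, true_and, Polynomial.eval_sub, Polynomial.eval_X, Polynomial.eval_C,
    sub_eq_zero]
  exact exists_congr fun x => eq_comm

theorem Box.Before.irrefl {P : Type*} [LinearOrder P] {b : Box P} : ¬ b.Before b := by
  rintro (h | ⟨-, h⟩)
  · exact lt_irrefl _ h
  · exact lt_irrefl _ h

theorem Box.Before.asymm {P : Type*} [LinearOrder P] {b b' : Box P} (h : b.Before b') :
    ¬ b'.Before b := by
  rintro (h' | ⟨h1, h2⟩)
  · rcases h with h | ⟨h, -⟩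
    · exact lt_asymm h h'
    · exact h'.ne h
  · rcases h with h | ⟨-, h⟩
    · exact h.ne h1
    · exact lt_asymm h h2

theorem IsDiagonalPlace.mem {P : Type*} [LinearOrder P] {R C : Finset P} {x y : P}
    (h : IsDiagonalPlace R C x y) : x ∈ R ∧ y ∈ C := by
  obtain ⟨a, hR, hC, rfl, rfl⟩ := h
  exact ⟨Finset.orderEmbOfFin_mem _ _ _, Finset.orderEmbOfFin_mem _ _ _⟩

theorem isDiagonalPlace_iff {P : Type*} [LinearOrder P] {R C : Finset P} (hc : R.card = C.card)
    (a b : Fin R.card) : IsDiagonalPlace R C (R.orderEmbOfFin rfl a)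
      (C.orderEmbOfFin rfl (Fin.cast hc b)) ↔ a = b := by
  constructor
  · rintro ⟨i, hR, hC, h1, h2⟩
    have h1' := (R.orderEmbOfFin rfl).injective h1
    have h2' := (C.orderEmbOfFin rfl).injective h2
    rw [h1']
    ext
    have := congrArg Fin.val h2'
    exact this.symm
  · rintro rfl
    exact ⟨a, a.2, hc ▸ a.2, rfl, rfl⟩

variable {k : Type*} [Field k] [LinearOrder k] {t : ℕ}
  {Γ : Subalgebra k (Matrix (Fin t) (Fin t) k)} {V : Submodule k (Matrix (Fin t) (Fin t) k)}
  {n : Fin t → ℕ} {M A : Matrix (Place n) (Place n) k} {boxes : Set (Box (Place n))}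
  {p : ℕ} {boxOf : Fin p → Box (Place n)} {lam a : Fin p → k}

/-- The parameters of each box are in increasing order. -/
def IncreasingParameters (boxOf : Fin p → Box (Place n)) (a : Fin p → k) : Prop :=
  ∀ i j, i < j → boxOf i = boxOf j → a i < a j

theorem IsParameterSequence.increasing (h : IsParameterSequence V boxes M boxOf lam) :
    IncreasingParameters boxOf lam := by
  intro i j hij hb
  rcases h.2.1 i j hij with hlt | ⟨-, hlt⟩
  · rw [hb] at hlt
    exact (Box.Before.irrefl hlt).elim
  · exact hlt

theorem IsParameterSequence.exists_eq_diag (h : IsParameterSequence V boxes M boxOf lam)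
    {b : Box (Place n)} (hb : b ∈ boxes) (hfree : IsFreeWeyrBox V b) (hw : IsWeyrBox M b)
    (x : Fin b.rows.card) : ∃ i, boxOf i = b ∧ lam i = squarePart M b.rows b.cols x x := by
  obtain ⟨r, c, ev, -, -, hup, -, -, -⟩ := hw.2.exists_classes
  exact (h.2.2 b hb hfree _).1 ((hasEigenvalue_iff_of_upper hup _).2 ⟨x, rfl⟩)

/-- The diagonal entries of free Weyr boxes are parameters. -/
theorem IsParameterSequence.exists_eq_apply (h : IsParameterSequence V boxes M boxOf lam)
    (hweyr : ∀ b ∈ boxes, b.kind = .weyr → IsWeyrBox M b) {x y : Place n} {i : Fin p}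
    (hd : IsDiagonalPlace (boxOf i).rows (boxOf i).cols x y) :
    ∃ j, IsDiagonalPlace (boxOf j).rows (boxOf j).cols x y ∧ M x y = lam j := by
  obtain ⟨hb, hf⟩ := h.1 i
  have hw := hweyr _ hb hf.1
  have hd' := hd
  obtain ⟨s, hR, hC, rfl, rfl⟩ := hd'
  obtain ⟨j, hj, hl⟩ := h.exists_eq_diag hb hf hw ⟨s, hR⟩
  refine ⟨j, by rw [hj]; exact hd, ?_⟩
  rw [hl, squarePart_apply hw.1]
  rfl

/-- As boxes are disjoint, a diagonal place of a parameter box lies in no other box, so only the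
diagonals of free Weyr boxes change. -/
theorem IsValueAt.apply_eq (hA : IsValueAt Γ V M boxOf lam a A) (hdisj : DisjointBoxes boxes)
    (h : IsParameterSequence V boxes M boxOf lam) {b : Box (Place n)} (hb : b ∈ boxes)
    (hfree : ∀ x ∈ b.rows, ∀ y ∈ b.cols, IsFreePlace V x y) {x y : Place n} (hx : x ∈ b.rows)
    (hy : y ∈ b.cols) (hne : ¬ (b.kind = .weyr ∧ IsDiagonalPlace b.rows b.cols x y)) :
    A x y = M x y := by
  refine hA.2.2 x y (hfree x hx y hy) ?_
  rintro ⟨i, hi⟩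
  have := hdisj _ (h.1 i).1 b hb x y hi.mem.1 hi.mem.2 hx hy
  rw [this] at hi
  exact hne ⟨this ▸ (h.1 i).2.1, hi⟩

/-- The shape of a free Weyr box of `M(a)`. -/
theorem IsValueAt.exists_classes (hA : IsValueAt Γ V M boxOf lam a A)
    (hdisj : DisjointBoxes boxes) (h : IsParameterSequence V boxes M boxOf lam)
    (ha : IncreasingParameters boxOf a) {b : Box (Place n)} (hb : b ∈ boxes)
    (hfree : IsFreeWeyrBox V b) (hw : IsWeyrBox M b) :
    IsWeyr (squarePart A b.rows b.cols) ∧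
    (∀ X : Matrix (Fin b.rows.card) (Fin b.rows.card) k,
      X * squarePart M b.rows b.cols = squarePart M b.rows b.cols * X ↔
        X * squarePart A b.rows b.cols = squarePart A b.rows b.cols * X) ∧
    ∀ μ, Module.End.HasEigenvalue (Matrix.toLin' (squarePart A b.rows b.cols)) μ ↔
      ∃ i, boxOf i = b ∧ a i = μ := by
  obtain ⟨r, c, ev, hev, hsurj, hup, hdiag, hoff, hrep⟩ := hw.2.exists_classes
  have hj : ∀ i, ∃ j, boxOf j = b ∧ lam j = ev i := by
    intro i
    obtain ⟨x, rfl⟩ := hsurj i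
    obtain ⟨j, h1, h2⟩ := h.exists_eq_diag hb hfree hw x
    exact ⟨j, h1, h2.trans (hdiag x)⟩
  choose j hjb hjl using hj
  -- The sequence `lam` increases along the indices of one box, so the order of the eigenvalues of
  -- `M` is the order of their indices, and `a` increases along these by `ha`.
  have hev' : StrictMono fun i => a (j i) := by
    intro i i' hi
    have hlt := hev hi
    rw [← hjl, ← hjl] at hlt
    refine ha _ _ ?_ ((hjb i).trans (hjb i').symm)
    rcases lt_trichotomy (j i) (j i') with h1 | h1 | h1
    · exact h1
    · rw [h1] at hlt
      exact (lt_irrefl _ hlt).elim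
    · exact (lt_asymm hlt (h.increasing _ _ h1 ((hjb i').trans (hjb i).symm))).elim
  have hdA : ∀ i x, boxOf i = b → squarePart M b.rows b.cols x x = lam i →
      squarePart A b.rows b.cols x x = a i := by
    intro i x hi hx
    rw [squarePart_apply hw.1] at hx ⊢
    refine hA.2.1 i _ _ ?_ hx
    rw [hi, isDiagonalPlace_iff]
  have hdiag' : ∀ x, squarePart A b.rows b.cols x x = a (j (c x)) :=
    fun x => hdA _ x (hjb _) (by rw [hjl, hdiag])
  have hoff' : ∀ x y, x ≠ y → squarePart A b.rows b.cols x y = squarePart M b.rows b.cols x y := by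
    intro x y hxy
    rw [squarePart_apply hw.1, squarePart_apply hw.1]
    refine hA.apply_eq hdisj h hb hfree.2 (Finset.orderEmbOfFin_mem _ _ _)
      (Finset.orderEmbOfFin_mem _ _ _) fun hd => hxy ?_
    exact (isDiagonalPlace_iff hw.1 x y).1 hd.2
  have hup' : ∀ x y, y < x → squarePart A b.rows b.cols x y = 0 := fun x y hxy =>
    (hoff' x y hxy.ne').trans (hup x y hxy)
  refine ⟨hrep _ _ hev' hdiag' hoff', fun X => ⟨?_, ?_⟩, fun μ => ?_⟩
  · exact commute_of_commute (ev' := fun i => a (j i)) hev.injective hup hdiag hoff hdiag' hoff'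
  · exact commute_of_commute hev'.injective hup' hdiag'
      (fun x y hxy h0 => hoff x y hxy (hoff' x y hxy ▸ h0)) hdiag fun x y hxy => (hoff' x y hxy).symm
  · rw [hasEigenvalue_iff_of_upper hup']
    constructor
    · rintro ⟨x, rfl⟩
      exact ⟨_, hjb _, (hdiag' x).symm⟩
    · rintro ⟨i, hi, rfl⟩
      obtain ⟨x, hx⟩ := (hasEigenvalue_iff_of_upper hup _).1
        ((h.2.2 b hb hfree (lam i)).2 ⟨i, hi, rfl⟩)
      exact ⟨x, hdA i x hi hx⟩

theorem IsValueAt.sameForm (hA : IsValueAt Γ V M boxOf lam a A)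
    (hdisj : DisjointBoxes boxes) (h : IsParameterSequence V boxes M boxOf lam)
    (ha : IncreasingParameters boxOf a) (hweyr : ∀ b ∈ boxes, b.kind = .weyr → IsWeyrBox M b) :
    SameForm (IsFreePlace V) boxes M A where
  eq_of_ne_weyr _ hb hfree hk _ hx _ hy := hA.apply_eq hdisj h hb hfree hx hy fun h => hk h.1
  isWeyr b hb hfree hk := (hA.exists_classes hdisj h ha hb ⟨hk, hfree⟩ (hweyr b hb hk)).1
  commute_iff b hb hfree hk := (hA.exists_classes hdisj h ha hb ⟨hk, hfree⟩ (hweyr b hb hk)).2.1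

theorem IsValueAt.isParameterSequence (hA : IsValueAt Γ V M boxOf lam a A)
    (hdisj : DisjointBoxes boxes) (h : IsParameterSequence V boxes M boxOf lam)
    (ha : IncreasingParameters boxOf a) (hweyr : ∀ b ∈ boxes, b.kind = .weyr → IsWeyrBox M b) :
    IsParameterSequence V boxes A boxOf a := by
  refine ⟨h.1, fun i j hij => ?_, fun b hb hfree =>
    (hA.exists_classes hdisj h ha hb hfree (hweyr b hb hfree.1)).2.2⟩
  rcases h.2.1 i j hij with h1 | ⟨h1, -⟩
  · exact Or.inl h1
  · exact Or.inr ⟨h1, ha i j hij h1⟩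

/-- It suffices to compare neighbouring parameters. -/
theorem IsParameterSequence.increasing_iff (h : IsParameterSequence V boxes M boxOf lam)
    (a : Fin p → k) : IncreasingParameters boxOf a ↔ ∀ (i : ℕ) (hi : i + 1 < p),
      boxOf ⟨i, Nat.lt_of_succ_lt hi⟩ = boxOf ⟨i + 1, hi⟩ → a ⟨i, Nat.lt_of_succ_lt hi⟩ < a ⟨i + 1, hi⟩ := by
  constructor
  · intro ha i hi hb
    exact ha _ _ (Fin.mk_lt_mk.2 (Nat.lt_succ_self i)) hb
  · intro ha
    have key : ∀ (i j : ℕ) (hij : i + 1 ≤ j) (hj : j < p),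
        boxOf ⟨i, by omega⟩ = boxOf ⟨j, hj⟩ → a ⟨i, by omega⟩ < a ⟨j, hj⟩ := by
      intro i j hij
      induction j, hij using Nat.le_induction with
      | base => exact fun hj hb => ha i hj hb
      | succ j hij ih =>
        intro hj hb
        -- The parameters of one box are consecutive: a different box in between would come both
        -- after it and before it.
        have h1 : boxOf ⟨i, by omega⟩ = boxOf ⟨j, by omega⟩ := by
          have e1 := h.2.1 ⟨i, by omega⟩ ⟨j, by omega⟩ (Fin.mk_lt_mk.2 (by omega))
          have e2 := h.2.1 ⟨j, by omega⟩ ⟨j + 1, hj⟩ (Fin.mk_lt_mk.2 (by omega))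
          rw [← hb] at e2
          rcases e1 with e1 | ⟨e1, -⟩
          · rcases e2 with e2 | ⟨e2, -⟩
            · exact (e1.asymm e2).elim
            · exact e2.symm
          · exact e1
        exact (ih (by omega) h1).trans (ha j hj (h1.symm.trans hb))
    intro i j hij hb
    exact key i j hij j.2 hb

theorem nonstableFree (hV : ∀ X ∈ Γ, ∀ Y ∈ V, X * Y ∈ V ∧ Y * X ∈ V) (hΓ : IsBasic Γ)
    (hn : IsStepSequence Γ n) (hA : A ∈ blowUp Γ V n) :
    NonstableFree (blowUpAlgebra Γ n) (IsFreePlace V) A :=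
  fun _ _ hB hle _ _ h1 h2 => isFreePlace_of_nonstable hV
    (isReducedAlgebra_blowUpAlgebra hΓ hn).isRed hB.isRed hle hA h1 h2

end Parameters

end Belitskii

end

/-! ### Assembly of the system of conditions -/

open Belitskii in
theorem theorem2p3 {k : Type*} [Field k] [IsAlgClosed k] [LinearOrder k] {t : ℕ}
    (Γ : Subalgebra k (Matrix (Fin t) (Fin t) k)) (hΓ : Belitskii.IsBasic Γ)
    (V : Submodule k (Matrix (Fin t) (Fin t) k))
    (hV : ∀ X ∈ Γ, ∀ Y ∈ V, X * Y ∈ V ∧ Y * X ∈ V)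
    (n : Fin t → ℕ) (hn : Belitskii.IsStepSequence Γ n)
    (M : Matrix (Belitskii.Place n) (Belitskii.Place n) k) (hM : M ∈ Belitskii.blowUp Γ V n)
    (boxes : Set (Belitskii.Box (Belitskii.Place n)))
    (hcan : Belitskii.IsStructuredCanonical (Belitskii.blowUpAlgebra Γ n)
      (Belitskii.initialStructure Γ n) M boxes)
    (p : ℕ) (boxOf : Fin p → Belitskii.Box (Belitskii.Place n)) (lam : Fin p → k)
    (hlam : Belitskii.IsParameterSequence V boxes M boxOf lam) :
    ∃ (F : Finset (MvPolynomial (Fin p) k)) (G : Finset (Finset (MvPolynomial (Fin p) k)))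
      (E : Set ℕ),
      Belitskii.parameterDomain Γ V M boxes boxOf lam =
        {a : Fin p → k |
          (∀ f ∈ F, MvPolynomial.eval a f = 0) ∧
          (∀ g ∈ G, ∃ d ∈ g, MvPolynomial.eval a d ≠ 0) ∧
          (∀ (i : ℕ) (h : i + 1 < p), i ∈ E → a ⟨i, by omega⟩ < a ⟨i + 1, h⟩)} := by
  have hinf : Infinite k := IsAlgClosed.instInfinite
  have hred := isReducedAlgebra_blowUpAlgebra hΓ hn
  have hrun := (isStructuredCanonical_iff hred).1 hcan
  obtain ⟨-, hd, hw⟩ := hrun.boxes_properties _ hred rfl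
  have hdisj : DisjointBoxes boxes := hd (fun b hb => hb.elim) (fun b hb => hb.elim)
  have hweyr := hw fun b hb => hb.elim
  obtain ⟨F, hF⟩ := exists_polynomial_entries (Γ := Γ) (V := V) (M := M) (boxOf := boxOf)
    (lam := lam) fun x y _ ⟨i, hi⟩ => hlam.exists_eq_apply hweyr hi
  set N : (Fin p → k) → Matrix (Place n) (Place n) k :=
    fun a => Matrix.of fun x y => MvPolynomial.eval a (F x y) with hN
  let adm : Set (Fin p → k) :=
    {a | IsValueAt Γ V M boxOf lam a (N a) ∧ IncreasingParameters boxOf a}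
  -- At the start no block has been treated: the set of places is empty and the algebra is the same
  -- for all `a`.
  have hbot : ∀ a, blowUpAlgebra Γ n ⊓ commutantOn (N a) (fun _ _ => False) =
      blowUpAlgebra Γ n := by
    intro a
    rw [inf_eq_left]
    exact fun S _ x y h => h.elim
  obtain ⟨K, hK, hrunK⟩ := hrun.exists_polyDefinable (N := N) (fun _ => rfl) (adm := adm) hdisj
    (fun a ha => ha.1.sameForm hdisj hlam ha.2 hweyr) (nonstableFree hV hΓ hn hM)
    (fun a ha => nonstableFree hV hΓ hn ha.1.1) _ hred rfl le_rfl (fun o ho => ho.elim)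
    (fun _ _ => False) Set.univ (Module.finrank k (blowUpAlgebra Γ n)) (by
      intro a _ _
      rw [hbot]
      exact ⟨hred, rfl, fun o ho => ho.elim⟩)
  obtain ⟨F', G', hFG⟩ := (polyDefinable_isValueAt (Γ := Γ) (V := V) (M := M) (boxOf := boxOf)
    (lam := lam) F).inter hK
  -- Only neighbouring parameters of one box are compared; between different boxes no order is
  -- required.
  refine ⟨F', G', {i | ∃ hi : i + 1 < p, boxOf ⟨i, by omega⟩ = boxOf ⟨i + 1, hi⟩}, ?_⟩
  ext a
  have hE : (∀ (i : ℕ) (h : i + 1 < p),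
      i ∈ {i | ∃ hi : i + 1 < p, boxOf ⟨i, by omega⟩ = boxOf ⟨i + 1, hi⟩} →
        a ⟨i, by omega⟩ < a ⟨i + 1, h⟩) ↔ IncreasingParameters boxOf a := by
    rw [hlam.increasing_iff]
    exact ⟨fun h i hi hb => h i hi ⟨hi, hb⟩, fun h i hi hb => h i hi hb.2⟩
  rw [Set.mem_ofPred_eq, hE, ← and_assoc, ← hFG]
  constructor
  · rintro ⟨A, hA, hAcan, hApar⟩
    -- A matrix that is a value at `a` is the evaluated one, so the witness `A` is eliminated.
    obtain rfl := hF a A hA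
    have hadm : a ∈ adm := ⟨hA, hApar.increasing⟩
    refine ⟨⟨hA, (hrunK a hadm trivial).1 ?_⟩, hadm.2⟩
    rw [hbot]
    exact (isStructuredCanonical_iff hred).1 hAcan
  · rintro ⟨⟨hA, haK⟩, hinc⟩
    have h1 := (hrunK a ⟨hA, hinc⟩ trivial).2 haK
    rw [hbot] at h1
    exact ⟨N a, hA, (isStructuredCanonical_iff hred).2 h1,
      IsValueAt.isParameterSequence hA hdisj hlam hinc hweyr⟩
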